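/- **Setting.** Let $d\ge 1$, $\Omega=[0,2\pi)^d$, and for $G\in\mathbb{Z}^d$ let $e_G(x)=(2\pi)^{-d/2}e^{\mathrm{i}G\cdot x}$. For $t\in\mathbb{R}$ let $H^t_p$ be the space of real-valued periodic $u=\sum_G \hat u_G e_G$ (so $\hat u_{-G}=\overline{\hat u_G}$) with $\|u\|_{H^t_p}^2=\sum_G(1+|G|^2)^t|\hat u_G|^2<\infty$, and $L^2_p=H^0_p$ with inner product $(\cdot,\cdot)$. Let $V\in H^\sigma_p$ with $\sigma>d/2$ and $0<\nu_*\le V\le\nu^*<\infty$; put $Lu=-\Delta u+Vu$, $a(u,v)=(\nabla u,\nabla v)+(Vu,v)$, $\|v\|_a=\sqrt{a(v,v)}$, $\alpha_*=\min(\nu_*,1)$, $\alpha^*=\max(\nu^*,1)$. For a finite set $\mathbb{G}=-\mathbb{G}\subset\mathbb{Z}^d$ let $V_{\mathbb{G}}=\operatorname{span}_{\mathbb C}\{e_G:G\in\mathbb{G}\}\cap H^1_p$, and let $\mathbb{G}^M=\{G\in\mathbb{Z}^d:|G|\le M\}$. **Eigenvalue cluster.** Let $\lambda_1\le\lambda_2\le\cdots$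 be the eigenvalues, repeated by multiplicity, of: find $u\in H^1_p$ with $a(u,v)=\lambda(u,v)$ for all $v\in H^1_p$; put $\lambda_0=0$. Let $\lambda_{k_0}<\lambda_{k_0+1}\le\cdots\le\lambda_{k_0+N}<\lambda_{k_0+N+1}$, let $\lambda_{(1)}<\cdots<\lambda_{(m)}$ be the distinct values among $\lambda_{k_0+1},\dots,\lambda_{k_0+N}$, with multiplicities $q_i$ ($N=\sum_i q_i$) and eigenspaces $M(\lambda_{(i)})$, and let $k_i=\sum_{j<i}q_j$ for $i=1,\dots,m$. **Algorithm.** Fix $\tilde\theta,\zeta,\mathit{tol}\in[0,1)$ and $M_0\in\mathbb{N}$, and put $\mathbb{G}_0=\mathbb{G}^{M_0}$. For $n=0,1,2,\dots$: (1) compute the $(k_0+1)$-th, …, $(k_0+N)$-th eigenvalues $\lambda_{\mathbb{G}_n,1}\le\dots\le\lambda_{\mathbb{G}_n,N}$ of the discrete problem ($a(u,v)=\lambda(u,v)$ for all $v\in V_{\mathbb{G}_n}$, $u\in V_{\mathbb{G}_n}$) with $L^2$-orthonormal eigenfunctions $u_{\mathbb{G}_n,1},\dots,u_{\mathbb{G}_n,N}$,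 and let $r_{n,l}=\lambda_{\mathbb{G}_n,l}u_{\mathbb{G}_n,l}-Lu_{\mathbb{G}_n,l}$, $r_n=(r_{n,l})_{l=1}^N$; (2) choose some $\tilde r_n\in(H^{-1}_p)^N$ with $\|\tilde r_n-r_n\|_{H^{-1}_p}\le\zeta\|\tilde r_n\|_{H^{-1}_p}$ (norms of $N$-tuples are root-sum-of-squares); (3) stop if $\|\tilde r_n\|_{H^{-1}_p}<\mathit{tol}/(1+\zeta)$; (4) choose a set $\delta\mathbb{G}_n$ of minimal cardinality among all finite sets $D=-D\subset\mathbb{Z}^d\setminus\mathbb{G}_n$ with $\|\Pi_{D}\tilde r_n\|_{H^{-1}_p}\ge\tilde\theta\|\tilde r_n\|_{H^{-1}_p}$, where $\Pi_D$ keeps the Fourier modes in $D$; put $\mathbb{G}_{n+1}=\mathbb{G}_n\cup\delta\mathbb{G}_n$. **Distance and approximation class.** Let $M_{\mathbb{G}_n}(\lambda_{(i)})=\operatorname{span}\{u_{\mathbb{G}_n,k_i+1},\dots,u_{\mathbb{G}_n,k_i+q_i}\}$, $\mathscr{M}=(M(\lambda_{(i)}))_{i=1}^m$, $\mathscr{M}_{\mathbb{G}_n}=(M_{\mathbb{G}_n}(\lambda_{(i)}))_{i=1}^m$.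 With $d(X,Y)=\sup_{u\in X,\|u\|_a=1}\inf_{v\in Y}\|u-v\|_a$ and $\delta_{H^1_p}(X,Y)=\max\{d(X,Y),d(Y,X)\}$ put $$\delta_{H^1_p}(\mathscr{M},\mathscr{M}_{\mathbb{G}_n})^2=\sum_{i=1}^m\delta_{H^1_p}\bigl(M(\lambda_{(i)}),M_{\mathbb{G}_n}(\lambda_{(i)})\bigr)^2 .$$ For $s>0$ let $\mathcal{A}^s=\{v\in H^1_p:|v|_s<\infty\}$, where $$|v|_s=\sup_{\varepsilon>0}\ \varepsilon\,\inf\bigl\{(|\mathbb{G}|-|\mathbb{G}_0|)^s:\ \mathbb{G}\text{ finite},\ \mathbb{G}_0\subset\mathbb{G}=-\mathbb{G},\ \inf_{w\in V_{\mathbb{G}}}\|v-w\|_a\le\varepsilon\bigr\}.$$ **Theorem.** Let $s>0$ and $\kappa=\sqrt{\alpha_*/(3\alpha^*)}$, and let $0<\tilde\theta<\kappa$, $0<\zeta<\tilde\theta$ and $\zeta<\frac{\kappa-\tilde\theta}{1+\kappa}$. Then there are $M_*\in\mathbb{N}$ and $C>0$, depending only on $d$, $V$, $\nu_*$, $\nu^*$,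 the cluster, $s$, $\tilde\theta$ and $\zeta$, such that the following holds for all $M_0\ge M_*$: if $M(\lambda_{(i)})\subset\mathcal{A}^s$ for $i=1,\dots,m$, then for every $\mathit{tol}\in[0,1)$, every sequence generated by the algorithm, and every iteration $n$ that it reaches with $|\mathbb{G}_n|>|\mathbb{G}_0|$, $$\delta_{H^1_p}(\mathscr{M},\mathscr{M}_{\mathbb{G}_n})\le C\,(|\mathbb{G}_n|-|\mathbb{G}_0|)^{-s}.$$ -/

import Mathlib

open MeasureTheory

noncomputable section

namespace Planewave

/-! ### Periodic function spaces -/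

/-- The periodicity cell `Ω = [0, 2π)^d`. -/
def cell (d : ℕ) : Set (Fin d → ℝ) :=
  Set.univ.pi fun _ => Set.Ico (0 : ℝ) (2 * Real.pi)

/-- Lebesgue measure on the cell. -/
def cellMeasure (d : ℕ) : Measure (Fin d → ℝ) :=
  volume.restrict (cell d)

/-- Real-valued `2π`-periodic functions that are locally square integrable. A periodic function
is identified with its restriction to the periodicity cell. -/
abbrev L2p (d : ℕ) : Type := Lp ℝ 2 (cellMeasure d)

/-- `|G|²`, the squared Euclidean norm of a multi-index. -/
def normSq {d : ℕ} (G : Fin d → ℤ) : ℝ := ∑ i, (G i : ℝ) ^ 2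

/-- The plane wave `e_G(x) = (2π)^{-d/2} exp(i G·x)`. -/
def planeWave {d : ℕ} (G : Fin d → ℤ) (x : Fin d → ℝ) : ℂ :=
  (((2 * Real.pi) ^ (-(d : ℝ) / 2) : ℝ) : ℂ) *
    Complex.exp (Complex.I * ((∑ i, (G i : ℝ) * x i : ℝ) : ℂ))

/-- The Fourier coefficient `(e_G, f) = (2π)^{-d/2} ∫_Ω f(x) exp(-i G·x) dx`. -/
def boxFourierCoeff {d : ℕ} (f : (Fin d → ℝ) → ℝ) (G : Fin d → ℤ) : ℂ :=
  ∫ x, (starRingEnd ℂ) (planeWave G x) * (f x : ℂ) ∂(cellMeasure d)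

/-- Membership of the (formal) Fourier series `∑ c_G e_G` in the space `H_p^s` of real-valued
periodic functions or distributions, `s ∈ ℝ`. -/
def MemSobolev {d : ℕ} (s : ℝ) (c : (Fin d → ℤ) → ℂ) : Prop :=
  Summable (fun G => (1 + normSq G) ^ s * ‖c G‖ ^ 2) ∧
    ∀ G, c (-G) = (starRingEnd ℂ) (c G)

/-- The `H_p^s` norm of `∑ c_G e_G`. -/
def sobolevNorm {d : ℕ} (s : ℝ) (c : (Fin d → ℤ) → ℂ) : ℝ :=
  Real.sqrt (∑' G, (1 + normSq G) ^ s * ‖c G‖ ^ 2)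

/-- The function space `H_p^1`. -/
def H1p (d : ℕ) : Set (L2p d) := {u | MemSobolev 1 (boxFourierCoeff u)}

/-- The symmetry `𝔾 = -𝔾` of a finite index set. -/
def IsSymm {d : ℕ} (𝔾 : Finset (Fin d → ℤ)) : Prop := ∀ G ∈ 𝔾, -G ∈ 𝔾

/-- The planewave space `V_𝔾 = span {e_G : G ∈ 𝔾} ∩ H_p^1` (complex span, real functions). -/
def VSpace {d : ℕ} (𝔾 : Finset (Fin d → ℤ)) : Set (L2p d) :=
  {v | (∃ c : (Fin d → ℤ) → ℂ,
      ∀ᵐ x ∂(cellMeasure d), ((v x : ℝ) : ℂ) = ∑ G ∈ 𝔾, c G * planeWave G x) ∧ v ∈ H1p d}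

/-- The index set `𝔾^M = {G ∈ ℤ^d : |G| ≤ M}`. -/
def ballIndex (d M : ℕ) : Finset (Fin d → ℤ) :=
  (Finset.Icc (fun _ => -(M : ℤ)) (fun _ => (M : ℤ))).filter
    fun G => ∑ i, (G i) ^ 2 ≤ (M : ℤ) ^ 2

/-! ### The operator `L = -Δ + V`, its energy and its eigenvalues -/

/-- The bilinear form `a(u,v) = (∇u, ∇v) + (V u, v)` on `H_p^1`; as usual for spaces defined
by Fourier series, the gradient of `∑ û_G e_G` is `∑ i G û_G e_G`. -/
def aForm {d : ℕ} (V u v : L2p d) : ℝ :=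
  (∑' G : Fin d → ℤ,
      normSq G * ((starRingEnd ℂ) (boxFourierCoeff u G) * boxFourierCoeff v G).re) +
    ∫ x, V x * u x * v x ∂(cellMeasure d)

/-- The energy norm `‖v‖_a`. -/
def aNorm {d : ℕ} (V v : L2p d) : ℝ := Real.sqrt (aForm V v v)

/-- All `u ∈ W` with `a(u,v) = μ (u,v)` for every `v ∈ W` (including `u = 0`). The choice
`W = H_p^1` is the eigenvalue problem of `L`, `W = V_𝔾` its planewave approximation. -/
def eigenspace {d : ℕ} (V : L2p d) (W : Set (L2p d)) (μ : ℝ) : Set (L2p d) :=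
  {u | u ∈ W ∧ ∀ v ∈ W, aForm V u v = μ * inner ℝ u v}

/-- The `k`-th smallest eigenvalue (`k = 1, 2, …`), counted with multiplicity, of the eigenvalue
problem on `W`: the least `t` such that the eigenspaces to eigenvalues `≤ t` together span at
least `k` dimensions. By convention the `0`-th one is `0`. -/
def eigenvalue {d : ℕ} (V : L2p d) (W : Set (L2p d)) (k : ℕ) : ℝ :=
  if k = 0 then 0 else
    sInf {t : ℝ | (k : Cardinal) ≤
      Module.rank ℝ (Submodule.span ℝ {u | ∃ μ ≤ t, u ∈ eigenspace V W μ})}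

/-- `λ_{k₀+1} ≤ … ≤ λ_{k₀+N}` is a cluster of eigenvalues, separated from the remaining ones,
whose distinct values are `lam 0 < … < lam (m-1)`, of multiplicities `q 0, …, q (m-1)`. -/
structure IsCluster {d : ℕ} (V : L2p d) (k₀ N m : ℕ) (lam : Fin m → ℝ) (q : Fin m → ℕ) :
    Prop where
  gap_below : eigenvalue V (H1p d) k₀ < eigenvalue V (H1p d) (k₀ + 1)
  gap_above : eigenvalue V (H1p d) (k₀ + N) < eigenvalue V (H1p d) (k₀ + N + 1)
  strictMono : StrictMono lam
  values : Set.range lam = {μ | ∃ l, 1 ≤ l ∧ l ≤ N ∧ μ = eigenvalue V (H1p d) (k₀ + l)}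
  multiplicity : ∀ i, q i = Module.finrank ℝ (Submodule.span ℝ (eigenspace V (H1p d) (lam i)))
  total : N = ∑ i, q i

/-- `k_i = q_1 + … + q_{i-1}`. -/
def offset {m : ℕ} (q : Fin m → ℕ) (i : Fin m) : ℕ := ∑ j ∈ Finset.univ.filter (· < i), q j

/-! ### Distances and the approximation class -/

/-- `inf_{v ∈ Y} ‖u - v‖_a`. -/
def bestApprox {d : ℕ} (V : L2p d) (Y : Set (L2p d)) (u : L2p d) : ℝ :=
  sInf ((fun v => aNorm V (u - v)) '' Y)

/-- `d(X,Y) = sup_{u ∈ X, ‖u‖_a = 1} inf_{v ∈ Y} ‖u - v‖_a`. -/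
def oneSidedDist {d : ℕ} (V : L2p d) (X Y : Set (L2p d)) : ℝ :=
  sSup (bestApprox V Y '' {u | u ∈ X ∧ aNorm V u = 1})

/-- `δ(X,Y) = max {d(X,Y), d(Y,X)}`. -/
def spaceDist {d : ℕ} (V : L2p d) (X Y : Set (L2p d)) : ℝ :=
  max (oneSidedDist V X Y) (oneSidedDist V Y X)

/-- The distance `δ(𝓜, 𝓜')` of tuples of subspaces: the root of the sum of squares. -/
def tupleDist {d m : ℕ} (V : L2p d) (X Y : Fin m → Set (L2p d)) : ℝ :=
  Real.sqrt (∑ i, spaceDist V (X i) (Y i) ^ 2)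

/-- The quantity `|v|_s` relative to the initial index set `𝔾₀`, with values in `[0,∞]`. -/
def approxSeminorm {d : ℕ} (V : L2p d) (𝔾₀ : Finset (Fin d → ℤ)) (s : ℝ) (v : L2p d) :
    ENNReal :=
  ⨆ (ε : ℝ) (_ : 0 < ε), ENNReal.ofReal ε *
    ⨅ (𝔾 : Finset (Fin d → ℤ)) (_ : 𝔾₀ ⊆ 𝔾 ∧ IsSymm 𝔾 ∧ bestApprox V (VSpace 𝔾) v ≤ ε),
      ENNReal.ofReal (((𝔾.card : ℝ) - (𝔾₀.card : ℝ)) ^ s)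

/-- The approximation class `𝓐^s`. -/
def approxClass {d : ℕ} (V : L2p d) (𝔾₀ : Finset (Fin d → ℤ)) (s : ℝ) : Set (L2p d) :=
  {v | v ∈ H1p d ∧ approxSeminorm V 𝔾₀ s v < ⊤}

/-! ### Residuals, error estimators and the adaptive algorithm

`N`-tuples are indexed by `l = 1, …, N`. -/

/-- Fourier coefficients of the residual `μ u + Δ u - V u`. -/
def residual {d : ℕ} (V : L2p d) (μ : ℝ) (u : L2p d) (G : Fin d → ℤ) : ℂ :=
  (μ : ℂ) * boxFourierCoeff u G - (normSq G : ℂ) * boxFourierCoeff u G -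
    boxFourierCoeff (fun x => V x * u x) G

/-- The `H_p^{-1}` norm of an `N`-tuple. -/
def negNorm {d : ℕ} (N : ℕ) (r : ℕ → (Fin d → ℤ) → ℂ) : ℝ :=
  Real.sqrt (∑ l ∈ Finset.Icc 1 N, sobolevNorm (-1) (r l) ^ 2)

/-- The `H_p^{-1}` norm of the `L²`-projection `Π_D r` of an `N`-tuple, `D` a finite index set. -/
def negNormOn {d : ℕ} (N : ℕ) (r : ℕ → (Fin d → ℤ) → ℂ) (D : Finset (Fin d → ℤ)) : ℝ :=
  Real.sqrt (∑ l ∈ Finset.Icc 1 N, ∑ G ∈ D, (1 + normSq G) ^ (-1 : ℝ) * ‖r l G‖ ^ 2)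

/-- `D` is an admissible result of the Dörfler marking with parameter `θ` at the index set `𝔾`,
for the estimator given by the `H_p^{-1}` norms of `r`. -/
def IsDorfler {d : ℕ} (N : ℕ) (r : ℕ → (Fin d → ℤ) → ℂ) (𝔾 : Finset (Fin d → ℤ)) (θ : ℝ)
    (D : Finset (Fin d → ℤ)) : Prop :=
  Disjoint D 𝔾 ∧ IsSymm D ∧ θ * negNorm N r ≤ negNormOn N r D

/-- The marking is of minimal cardinality. -/
def IsMinimalDorfler {d : ℕ} (N : ℕ) (r : ℕ → (Fin d → ℤ) → ℂ) (𝔾 : Finset (Fin d → ℤ))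
    (θ : ℝ) (D : Finset (Fin d → ℤ)) : Prop :=
  IsDorfler N r 𝔾 θ D ∧ ∀ D', IsDorfler N r 𝔾 θ D' → D.card ≤ D'.card

/-- `u_1, …, u_N` are `L²`-orthonormal discrete eigenfunctions in `V_𝔾`, where `u_l` belongs to the
`(k₀+l)`-th discrete eigenvalue. -/
def IsDiscreteSolution {d : ℕ} (V : L2p d) (k₀ N : ℕ) (𝔾 : Finset (Fin d → ℤ))
    (u : ℕ → L2p d) : Prop :=
  (∀ l ∈ Finset.Icc 1 N,
      u l ∈ eigenspace V (VSpace 𝔾) (eigenvalue V (VSpace 𝔾) (k₀ + l))) ∧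
    ∀ l ∈ Finset.Icc 1 N, ∀ l' ∈ Finset.Icc 1 N,
      inner ℝ (u l) (u l') = if l = l' then (1 : ℝ) else 0

/-- The residuals `r(u_1), …, r(u_N)` of a discrete solution in `V_𝔾`. -/
def discreteResidual {d : ℕ} (V : L2p d) (k₀ : ℕ) (𝔾 : Finset (Fin d → ℤ)) (u : ℕ → L2p d)
    (l : ℕ) : (Fin d → ℤ) → ℂ :=
  residual V (eigenvalue V (VSpace 𝔾) (k₀ + l)) (u l)

/-- The feasible adaptive planewave algorithm with parameters `θ`, `ζ`, `tol`, `M₀` and markings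
of minimal cardinality has run up to iteration `n` without stopping earlier, and produced the
index sets `𝔾 0, …, 𝔾 n`, the discrete solutions `u 0, …, u n`, the approximate residuals
`rt 0, …, rt (n-1)` and the marked sets `D 0, …, D (n-1)`. -/
structure IsRun {d : ℕ} (V : L2p d) (k₀ N : ℕ) (θ ζ tol : ℝ) (M₀ n : ℕ)
    (𝔾 : ℕ → Finset (Fin d → ℤ)) (u : ℕ → ℕ → L2p d) (rt : ℕ → ℕ → (Fin d → ℤ) → ℂ)
    (D : ℕ → Finset (Fin d → ℤ)) : Prop where
  start : 𝔾 0 = ballIndex d M₀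
  solve : ∀ j ≤ n, IsDiscreteSolution V k₀ N (𝔾 j) (u j)
  approx_mem : ∀ j < n, ∀ l ∈ Finset.Icc 1 N, MemSobolev (-1) (rt j l)
  approx : ∀ j < n,
    negNorm N (rt j - discreteResidual V k₀ (𝔾 j) (u j)) ≤ ζ * negNorm N (rt j)
  not_stopped : ∀ j < n, tol / (1 + ζ) ≤ negNorm N (rt j)
  mark : ∀ j < n, IsMinimalDorfler N (rt j) (𝔾 j) θ (D j)
  refine_eq : ∀ j < n, 𝔾 (j + 1) = 𝔾 j ∪ D j

/-- `M_𝔾(λ_(i)) = span {u_{k_i+1}, …, u_{k_i+q_i}}`. -/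
def discreteSpace {d m : ℕ} (q : Fin m → ℕ) (u : ℕ → L2p d) (i : Fin m) : Set (L2p d) :=
  (Submodule.span ℝ (u '' Set.Icc (offset q i + 1) (offset q i + q i)) : Set (L2p d))

end Planewave

end

/-!
# Optimal convergence rates of an adaptive planewave method for eigenvalue clusters

The energy form makes `H_p^1` a real Hilbert space `E` (`EnergySpace`), in which the eigenvalue
problem reads `u = λ K u`. Here `K` is the solution operator `a(K u, v) = (u, v)` (`solOp`), which
is compact, symmetric and positive definite, and a planewave discretization is the Galerkin method
in a closed subspace `W` of `E` with orthogonal projection `P`. All that matters about `W` in the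
abstract part is the quality `ρ` in `‖K x - P K x‖ ≤ ρ ‖x‖`, which tends to zero with the inverse
radius of a ball of frequencies contained in the index set (`exists_solOp_approx`).

*Comparison.* A discrete eigenvector `u` with eigenvalue `λ` is the projection of `w = λ K u`, so
that the residual of `u` is represented in `E` by `w - u = w - P w`. The component of `w` outside
of the exact eigenspace is of the order of `w - u`, because `1 - λ K` is bounded below on the
complement of the eigenspace (`IsSolutionOperator.exists_gap`); being itself a value of `K`, it is
approximated by `W` with an additional factor `ρ`. The components inside of the eigenspace form an
almost orthonormal system. Hence, for every linear `Q` dominated by `1 - P`, the sums of `‖Q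
w_l‖²` over the discrete eigenvectors and of `‖Q φ_k‖²` over an orthonormal eigenbasis differ at
most by a small multiple of the best approximation error `B² = ∑ ‖φ_k - P φ_k‖²`, called
`bestError` below (`IsSolutionOperator.exists_comparison`). The distance of the eigenspaces is of
order `B`. That the discrete eigenvalues of the cluster converge to the right limits follows by
counting eigenvalues (`exists_eigVal_close`, `IsAbstractCluster.eigVal_eq`).

*Estimator.* For nested index sets `𝔾 ⊆ 𝔾'`, the increment `P' w_l - P w_l` is the Riesz
representative of the residual restricted to the modes in `𝔾'`. Its energy norm is therefore
equivalent to the `H_p^{-1}` norm of that restriction, with constants `min νlow 1` and `max νup 1`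
(`tsum_negDensity_bounds`).

*Contraction and optimality.* By Pythagoras, `B² - B'²` is the sum of `‖P' φ_k - P φ_k‖²`. With
`Q = P' - P`, the comparison and the estimator show that the marking contracts `B²`
(`bestError_le_of_marking`) and, conversely, that every enrichment which reduces `B²` by a factor
of three captures the fraction `κ` of the residual (`le_negNormOn_of_bestError_le`) and so
competes with the minimal marking, the inexactness of the residual being absorbed by the gap
between `θ` and `κ`. Membership in the approximation class provides such an enrichment with
`O(B^{-1/s})` new modes (`exists_enrichment`), and summing these numbers along the geometrically
decreasing errors (`sum_rpow_neg_le`) gives the rate.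
-/

noncomputable section

namespace Planewave

/-! ### Galerkin approximation of a compact eigenvalue problem in Hilbert space -/

section Abstract

variable {E : Type*} [NormedAddCommGroup E] [InnerProductSpace ℝ E]

/-- The standing assumptions on the solution operator `K` in the energy space `E`: the second
bilinear form of the eigenvalue problem is `b(u, v) = ⟪K u, v⟫`. -/
structure IsSolutionOperator (K : E →L[ℝ] E) : Prop where
  compact : IsCompactOperator K
  symm : ∀ x y, inner ℝ (K x) y = inner ℝ x (K y)
  pos : ∀ x, x ≠ 0 → 0 < inner ℝ (K x) x

/-- The solutions `u ∈ W` of `⟪u, v⟫ = μ b(u, v)` for all `v ∈ W`. -/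
def eigSub (K : E →L[ℝ] E) (W : Submodule ℝ E) (μ : ℝ) : Submodule ℝ E where
  carrier := {u | u ∈ W ∧ ∀ v ∈ W, inner ℝ u v = μ * inner ℝ (K u) v}
  add_mem' := by
    rintro x y ⟨hx, hx'⟩ ⟨hy, hy'⟩
    refine ⟨W.add_mem hx hy, fun v hv => ?_⟩
    rw [map_add, inner_add_left, inner_add_left, hx' v hv, hy' v hv]; ring
  zero_mem' := ⟨W.zero_mem, by simp⟩
  smul_mem' := by
    rintro c x ⟨hx, hx'⟩
    refine ⟨W.smul_mem c hx, fun v hv => ?_⟩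
    rw [map_smul, real_inner_smul_left, real_inner_smul_left, hx' v hv]; ring

theorem mem_eigSub {K : E →L[ℝ] E} {W : Submodule ℝ E} {μ : ℝ} {u : E} :
    u ∈ eigSub K W μ ↔ u ∈ W ∧ ∀ v ∈ W, inner ℝ u v = μ * inner ℝ (K u) v := Iff.rfl

theorem mem_eigSub_top {K : E →L[ℝ] E} {μ : ℝ} {u : E} :
    u ∈ eigSub K ⊤ μ ↔ u = μ • K u := by
  rw [mem_eigSub]
  constructor
  · rintro ⟨-, h⟩
    refine ext_inner_right ℝ fun v => ?_
    rw [h v trivial, real_inner_smul_left]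
  · intro h
    refine ⟨trivial, fun v _ => ?_⟩
    conv_lhs => rw [h, real_inner_smul_left]

/-- A compact symmetric `1 - μ K` is bounded below on the orthogonal complement of its kernel. -/
theorem IsSolutionOperator.exists_gap [CompleteSpace E] {K : E →L[ℝ] E}
    (hK : IsSolutionOperator K) {μ : ℝ} (hμ : μ ≠ 0) :
    ∃ c > 0, ∀ e ∈ (eigSub K ⊤ μ)ᗮ, c * ‖e‖ ≤ ‖e - μ • K e‖ := by
  have hinv : ∀ e ∈ (eigSub K ⊤ μ)ᗮ, K e ∈ (eigSub K ⊤ μ)ᗮ := by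
    intro e he
    rw [Submodule.mem_orthogonal] at he ⊢
    intro x hx
    have h1 := he x hx
    rw [mem_eigSub_top] at hx
    rw [hx, real_inner_smul_left, hK.symm] at h1
    simpa [hμ] using h1
  set Z := (eigSub K ⊤ μ)ᗮ with hZ
  let T : Z →L[ℝ] Z := K.restrict hinv
  have hT : IsCompactOperator T := hK.compact.restrict' hinv
  have hne : ¬ Module.End.HasEigenvalue (T : Module.End ℝ Z) μ⁻¹ := by
    intro h
    obtain ⟨z, hz⟩ := h.exists_hasEigenvector
    have h1 : T z = μ⁻¹ • z := hz.apply_eq_smul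
    have h2 : K z = μ⁻¹ • (z : E) := congrArg Subtype.val h1
    have h3 : (z : E) ∈ eigSub K ⊤ μ := by
      rw [mem_eigSub_top, h2, smul_inv_smul₀ hμ]
    have h4 : inner ℝ (z : E) (z : E) = 0 := (Submodule.mem_orthogonal _ _).1 z.2 _ h3
    exact hz.2 (by ext; simpa using h4)
  obtain ⟨C, hC⟩ := hT.antilipschitz_of_not_hasEigenvalue (inv_ne_zero hμ) hne
  have hμ' : 0 < |μ| := abs_pos.2 hμ
  refine ⟨|μ| / (C + 1), by positivity, fun e he => ?_⟩
  have h1 : ‖(⟨e, he⟩ : Z)‖ ≤ C * ‖(T - μ⁻¹ • (1 : Z →L[ℝ] Z)) ⟨e, he⟩‖ := by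
    have := hC.le_mul_dist (⟨e, he⟩ : Z) 0
    rwa [map_zero, dist_zero_right, dist_zero_right] at this
  have h2 : ((T - μ⁻¹ • (1 : Z →L[ℝ] Z)) ⟨e, he⟩ : E) = K e - μ⁻¹ • e := rfl
  rw [Submodule.coe_norm, Submodule.coe_norm, h2] at h1
  have h3 : ‖e - μ • K e‖ = |μ| * ‖K e - μ⁻¹ • e‖ := by
    rw [← Real.norm_eq_abs, ← norm_smul, smul_sub, smul_inv_smul₀ hμ, norm_sub_rev]
  rw [h3, div_mul_eq_mul_div, div_le_iff₀ (by positivity), mul_assoc]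
  refine mul_le_mul_of_nonneg_left ?_ hμ'.le
  change ‖e‖ ≤ C * _ at h1
  nlinarith [norm_nonneg (K e - μ⁻¹ • e)]

/-- For a square matrix, `TᵀT - 1` and `TTᵀ - 1` have the same Frobenius norm. -/
theorem sum_sq_transpose_mul_sub_one {n : Type*} [Fintype n] [DecidableEq n] (T : Matrix n n ℝ) :
    ∑ i, ∑ j, (T.transpose * T - 1) i j ^ 2 = ∑ i, ∑ j, (T * T.transpose - 1) i j ^ 2 := by
  have key : ∀ A : Matrix n n ℝ, ∑ i, ∑ j, A i j ^ 2 = (A * A.transpose).trace := by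
    intro A
    simp [Matrix.trace, Matrix.mul_apply, sq]
  rw [key, key]
  simp only [Matrix.transpose_sub, Matrix.transpose_mul, Matrix.transpose_transpose,
    Matrix.transpose_one, sub_mul, mul_sub, mul_one, one_mul, Matrix.trace_sub]
  have h1 : (T.transpose * T * (T.transpose * T)).trace =
      (T * T.transpose * (T * T.transpose)).trace := by
    rw [Matrix.mul_assoc, Matrix.trace_mul_comm]
    simp only [Matrix.mul_assoc]
  rw [h1, Matrix.trace_mul_comm T.transpose T]

/-- `φ` is a `b`-orthonormal basis of the eigenspace of `K` that belongs to `μ`. -/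
structure IsEigenbasis {ι : Type*} [DecidableEq ι] (K : E →L[ℝ] E) (μ : ℝ) (φ : ι → E) :
    Prop where
  pos : 0 < μ
  mem : ∀ k, φ k ∈ eigSub K ⊤ μ
  orth : ∀ k k', inner ℝ (K (φ k)) (φ k') = if k = k' then (1 : ℝ) else 0
  span : eigSub K ⊤ μ ≤ Submodule.span ℝ (Set.range φ)

/-- `u` consists of `b`-orthonormal Galerkin eigenvectors in `W`, with eigenvalues `lam`. -/
structure IsGalerkin {ι : Type*} [DecidableEq ι] (K : E →L[ℝ] E) (W : Submodule ℝ E)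
    (lam : ι → ℝ) (u : ι → E) : Prop where
  mem : ∀ l, u l ∈ eigSub K W (lam l)
  orth : ∀ l l', inner ℝ (K (u l)) (u l') = if l = l' then (1 : ℝ) else 0

section Basic

variable {ι : Type*} [DecidableEq ι] {K : E →L[ℝ] E} {μ : ℝ} {φ : ι → E}

theorem IsEigenbasis.map_eq (h : IsEigenbasis K μ φ) (k : ι) : K (φ k) = μ⁻¹ • φ k := by
  have h1 := mem_eigSub_top.1 (h.mem k)
  rw [eq_comm, inv_smul_eq_iff₀ h.pos.ne']
  exact h1

theorem IsEigenbasis.eigSub_eq (h : IsEigenbasis K μ φ) :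
    eigSub K ⊤ μ = Submodule.span ℝ (Set.range φ) :=
  le_antisymm h.span (Submodule.span_le.2 (by rintro _ ⟨k, rfl⟩; exact h.mem k))

theorem IsEigenbasis.norm_sq (h : IsEigenbasis K μ φ) (k : ι) : ‖φ k‖ ^ 2 = μ := by
  rw [← real_inner_self_eq_norm_sq, (h.mem k).2 _ trivial, h.orth, if_pos rfl, mul_one]

theorem IsGalerkin.norm_sq {W : Submodule ℝ E} {lam : ι → ℝ} {u : ι → E}
    (h : IsGalerkin K W lam u) (l : ι) : ‖u l‖ ^ 2 = lam l := by
  rw [← real_inner_self_eq_norm_sq, (h.mem l).2 _ (h.mem l).1, h.orth, if_pos rfl, mul_one]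

/-- A Galerkin eigenvector is the elliptic projection of `λ K u`. -/
theorem IsGalerkin.starProjection_eq {W : Submodule ℝ E} [W.HasOrthogonalProjection]
    {lam : ι → ℝ} {u : ι → E} (h : IsGalerkin K W lam u) (l : ι) :
    W.starProjection (lam l • K (u l)) = u l := by
  refine Submodule.eq_starProjection_of_mem_of_inner_eq_zero (h.mem l).1 fun v hv => ?_
  rw [inner_sub_left, (h.mem l).2 v hv, real_inner_smul_left, sub_self]

theorem sum_inner_smul_of_mem_span [Fintype ι] {b : E → E → ℝ} (φ : ι → E)
    (hadd : ∀ x y z, b (x + y) z = b x z + b y z) (hsmul : ∀ (c : ℝ) x z, b (c • x) z = c * b x z)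
    (orth : ∀ k k', b (φ k) (φ k') = if k = k' then (1 : ℝ) else 0)
    {x : E} (hx : x ∈ Submodule.span ℝ (Set.range φ)) : ∑ k, b x (φ k) • φ k = x := by
  induction hx using Submodule.span_induction with
  | mem x hx => obtain ⟨k, rfl⟩ := hx; simp [orth]
  | zero =>
    have h0 : ∀ z, b 0 z = 0 := fun z => by simpa using hsmul 0 0 z
    simp [h0]
  | add x y _ _ hx hy => simp only [hadd, add_smul, Finset.sum_add_distrib, hx, hy]
  | smul c x _ hx => simp only [hsmul, mul_smul, ← Finset.smul_sum, hx]

theorem sum_inner_map_smul [Fintype ι] {K : E →L[ℝ] E} {φ : ι → E}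
    (orth : ∀ k k', inner ℝ (K (φ k)) (φ k') = if k = k' then (1 : ℝ) else 0)
    {x : E} (hx : x ∈ Submodule.span ℝ (Set.range φ)) :
    ∑ k, inner ℝ (K x) (φ k) • φ k = x :=
  sum_inner_smul_of_mem_span (b := fun x y => inner ℝ (K x) y) φ
    (fun x y z => by simp [inner_add_left]) (fun c x z => by simp [real_inner_smul_left]) orth hx

end Basic

end Abstract

end Planewave

namespace Planewave

/-! ### Comparison of Galerkin eigenvectors with a single eigenspace -/

section Abstract

variable {E : Type*} [NormedAddCommGroup E] [InnerProductSpace ℝ E]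

section Comparison

variable {ι : Type*} [Fintype ι] {K : E →L[ℝ] E} {μ : ℝ} {φ : ι → E}

/-- The part of `x` in the eigenspace spanned by the `b`-orthonormal family `φ`. For an
eigenbasis it is both the `b`-orthogonal and the energy-orthogonal projection of `x`. -/
def eigPart (K : E →L[ℝ] E) (φ : ι → E) (x : E) : E := ∑ k, inner ℝ (K x) (φ k) • φ k

theorem eigPart_smul (c : ℝ) (x : E) : eigPart K φ (c • x) = c • eigPart K φ x := by
  simp [eigPart, real_inner_smul_left, Finset.smul_sum, mul_smul]

theorem eigPart_sub (x y : E) : eigPart K φ (x - y) = eigPart K φ x - eigPart K φ y := by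
  simp [eigPart, inner_sub_left, sub_smul, Finset.sum_sub_distrib]

variable [DecidableEq ι]

theorem IsEigenbasis.eigPart_mem (h : IsEigenbasis K μ φ) (x : E) :
    eigPart K φ x ∈ eigSub K ⊤ μ :=
  Submodule.sum_mem _ fun k _ => Submodule.smul_mem _ _ (h.mem k)

theorem IsEigenbasis.sub_eigPart_mem (hK : IsSolutionOperator K) (h : IsEigenbasis K μ φ) (x : E) :
    x - eigPart K φ x ∈ (eigSub K ⊤ μ)ᗮ := by
  have key : ∀ j, inner ℝ (φ j) (x - eigPart K φ x) = 0 := by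
    intro j
    have h1 : inner ℝ (φ j) x = μ * inner ℝ (K x) (φ j) := by
      rw [hK.symm, h.map_eq, real_inner_smul_right, mul_inv_cancel_left₀ h.pos.ne',
        real_inner_comm]
    have h2 : ∀ k, inner ℝ (φ j) (φ k) = if k = j then μ else 0 := by
      intro k
      rw [(h.mem j).2 _ trivial, h.orth]
      simp [eq_comm]
    simp only [eigPart, inner_sub_right, inner_sum, real_inner_smul_right, h2, h1]
    simp [mul_comm]
  rw [Submodule.mem_orthogonal, h.eigSub_eq]
  intro y hy
  induction hy using Submodule.span_induction with
  | mem y hy => obtain ⟨j, rfl⟩ := hy; exact key j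
  | zero => simp
  | add y z _ _ hy hz => rw [inner_add_left, hy, hz, add_zero]
  | smul c y _ hy => rw [real_inner_smul_left, hy, mul_zero]

theorem IsEigenbasis.map_eigPart (hK : IsSolutionOperator K) (h : IsEigenbasis K μ φ) (x : E) :
    K (eigPart K φ x) = eigPart K φ (K x) := by
  simp only [eigPart, map_sum, map_smul]
  refine Finset.sum_congr rfl fun k _ => ?_
  rw [h.map_eq, smul_smul, hK.symm (K x), h.map_eq, real_inner_smul_right, mul_comm]

theorem IsEigenbasis.norm_sq_eigPart (hK : IsSolutionOperator K) (h : IsEigenbasis K μ φ) (x : E) :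
    ‖x‖ ^ 2 = ‖eigPart K φ x‖ ^ 2 + ‖x - eigPart K φ x‖ ^ 2 := by
  have h1 : inner ℝ (eigPart K φ x) (x - eigPart K φ x) = 0 :=
    (Submodule.mem_orthogonal _ _).1 (h.sub_eigPart_mem hK x) _ (h.eigPart_mem x)
  have h2 := norm_add_sq_real (eigPart K φ x) (x - eigPart K φ x)
  rw [h1, add_sub_cancel] at h2
  linarith

theorem IsEigenbasis.norm_eigPart_le (hK : IsSolutionOperator K) (h : IsEigenbasis K μ φ) (x : E) :
    ‖eigPart K φ x‖ ≤ ‖x‖ := by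
  have := h.norm_sq_eigPart hK x
  exact le_of_sq_le_sq (by nlinarith [sq_nonneg ‖x - eigPart K φ x‖]) (norm_nonneg _)

theorem IsEigenbasis.norm_sub_eigPart_le (hK : IsSolutionOperator K) (h : IsEigenbasis K μ φ)
    (x : E) : ‖x - eigPart K φ x‖ ≤ ‖x‖ := by
  have := h.norm_sq_eigPart hK x
  exact le_of_sq_le_sq (by nlinarith [sq_nonneg ‖eigPart K φ x‖]) (norm_nonneg _)

/-- Quantitative comparison of Galerkin eigenvectors `u` with an eigenspace of `K`. For
`w = λ K u`, whose elliptic projection is `u`, the error `w - u` is controlled both by the best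
approximation errors of the eigenspace and by the approximation quality `ρ` of `W`, and the part
of `w` outside the eigenspace is of higher order. -/
theorem IsSolutionOperator.exists_galerkin_bounds [CompleteSpace E] (hK : IsSolutionOperator K)
    (hφ : IsEigenbasis K μ φ) :
    ∃ C > 0, ∃ ρ₀ > 0, ∃ ε₀ > 0, ∀ (W : Submodule ℝ E) [W.HasOrthogonalProjection]
      (lam : ι → ℝ) (u : ι → E) (ρ : ℝ), IsGalerkin K W lam u → (∀ l, |lam l - μ| ≤ ε₀) →
      0 ≤ ρ → ρ ≤ ρ₀ → (∀ x, ‖K x - W.starProjection (K x)‖ ≤ ρ * ‖x‖) →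
      ∀ l, ‖u l‖ ≤ C ∧ ‖eigPart K φ (lam l • K (u l))‖ ≤ C ∧
        (∀ k, |inner ℝ (K (lam l • K (u l))) (φ k)| ≤ C) ∧
        ‖lam l • K (u l) - u l‖ ≤ C * ρ ∧
        ‖lam l • K (u l) - u l‖ ≤ C * ∑ k, ‖φ k - W.starProjection (φ k)‖ ∧
        ‖eigPart K φ (lam l • K (u l)) - u l‖ ≤ C * ‖lam l • K (u l) - u l‖ ∧
        ‖(lam l • K (u l) - eigPart K φ (lam l • K (u l))) -
            W.starProjection (lam l • K (u l) - eigPart K φ (lam l • K (u l)))‖ ≤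
          C * ρ * ‖lam l • K (u l) - u l‖ := by
  obtain ⟨c, hc, hgap⟩ := hK.exists_gap hφ.pos.ne'
  have hμ := hφ.pos
  set κ := ‖K‖ with hκ
  have hκ0 : 0 ≤ κ := norm_nonneg K
  have hKle : ∀ x, ‖K x‖ ≤ κ * ‖x‖ := K.le_opNorm
  set R := 2 * μ + 1 with hR
  have hR0 : 0 < R := by positivity
  -- the coefficients of `w` in the basis `φ` are bounded by `T`
  set T := κ * (2 * μ * (κ * R)) * R with hT
  have hT0 : 0 ≤ T := by positivity
  set C := R + 2 * μ * (κ * R) + T + 2 * μ * R + 2 * T + (1 + 2 * μ * κ * (2 / c)) +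
    2 * μ * (2 / c) with hC
  refine ⟨C, by positivity, c / (8 * μ), by positivity, min (μ / 2) (c / (2 * (κ + 1))),
    by positivity, ?_⟩
  intro W _ lam u ρ hu hlam hρ hρ₀ hW l
  have h2c : 0 < 2 / c := by positivity
  have n1 : 0 ≤ 2 * μ * (κ * R) := by positivity
  have n2 : 0 ≤ 2 * μ * R := by positivity
  have n3 : 0 ≤ 2 * μ * κ * (2 / c) := by positivity
  have n4 : 0 ≤ 2 * μ * (2 / c) := by positivity
  have hl1 := (hlam l).trans (min_le_left _ _)
  have hl2 := (hlam l).trans (min_le_right _ _)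
  rw [abs_le] at hl1
  have hl0 : 0 < lam l := by linarith
  have hlM : lam l ≤ 2 * μ := by linarith
  have huR : ‖u l‖ ≤ R := by
    refine abs_le_of_sq_le_sq' ?_ hR0.le |>.2
    rw [hu.norm_sq]; nlinarith
  have hφR : ∀ k, ‖φ k‖ ≤ R := by
    intro k
    refine abs_le_of_sq_le_sq' ?_ hR0.le |>.2
    rw [hφ.norm_sq]; nlinarith
  set w := lam l • K (u l) with hw
  have hwR : ‖w‖ ≤ 2 * μ * (κ * R) := by
    rw [hw, norm_smul, Real.norm_of_nonneg hl0.le]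
    gcongr
    exact (hKle _).trans (by gcongr)
  have ht : ∀ k, |inner ℝ (K w) (φ k)| ≤ T := by
    intro k
    refine (abs_real_inner_le_norm _ _).trans ?_
    have := (hKle w).trans (mul_le_mul_of_nonneg_left hwR hκ0)
    exact mul_le_mul this (hφR k) (norm_nonneg _) (by positivity)
  have hPw : W.starProjection w = u l := hu.starProjection_eq l
  set z := w - u l with hz
  have hz1 : ‖z‖ ≤ 2 * μ * R * ρ := by
    have h1 : z = lam l • (K (u l) - W.starProjection (K (u l))) := by
      have h2 : lam l • W.starProjection (K (u l)) = u l := by rw [← map_smul]; exact hPw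
      rw [hz, smul_sub, h2]
    rw [h1, norm_smul, Real.norm_of_nonneg hl0.le]
    calc lam l * ‖K (u l) - W.starProjection (K (u l))‖ ≤ (2 * μ) * (ρ * R) := by
          refine mul_le_mul hlM ((hW _).trans (by gcongr)) (norm_nonneg _) (by positivity)
      _ = _ := by ring
  set e := u l - eigPart K φ (u l) with he
  have he1 : ‖e‖ ≤ 2 / c * ‖z‖ := by
    have h1 : e - lam l • K e = -(z - eigPart K φ z) := by
      rw [he, map_sub, hφ.map_eigPart hK, smul_sub, ← eigPart_smul, ← hw, hz, eigPart_sub]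
      abel
    have h2 : ‖e - lam l • K e‖ ≤ ‖z‖ := by
      rw [h1, norm_neg]; exact hφ.norm_sub_eigPart_le hK z
    have h3 : c * ‖e‖ ≤ ‖e - μ • K e‖ := hgap e (hφ.sub_eigPart_mem hK _)
    have h4 : ‖e - μ • K e‖ ≤ ‖e - lam l • K e‖ + ‖(lam l - μ) • K e‖ := by
      refine (le_of_eq ?_).trans (norm_add_le _ _)
      congr 1; rw [sub_smul]; abel
    have h5 : ‖(lam l - μ) • K e‖ ≤ c / 2 * ‖e‖ := by
      rw [norm_smul, Real.norm_eq_abs]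
      calc |lam l - μ| * ‖K e‖ ≤ (c / (2 * (κ + 1))) * ((κ + 1) * ‖e‖) := by
            refine mul_le_mul hl2 ((hKle e).trans ?_) (norm_nonneg _) (by positivity)
            gcongr; linarith
        _ = _ := by field_simp
    rw [div_mul_eq_mul_div, le_div_iff₀ hc]
    linarith
  set x := eigPart K φ w with hx
  have hg : w - x = lam l • K e := by
    rw [he, map_sub, hφ.map_eigPart hK, smul_sub, ← eigPart_smul]
  have hg1 : ‖w - x‖ ≤ 2 * μ * κ * (2 / c) * ‖z‖ := by
    rw [hg, norm_smul, Real.norm_of_nonneg hl0.le]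
    calc lam l * ‖K e‖ ≤ (2 * μ) * (κ * (2 / c * ‖z‖)) := by
          refine mul_le_mul hlM ((hKle e).trans (by gcongr)) (norm_nonneg _) (by positivity)
      _ = _ := by ring
  have hg2 : ‖(w - x) - W.starProjection (w - x)‖ ≤ 2 * μ * (2 / c) * ρ * ‖z‖ := by
    rw [hg, map_smul, ← smul_sub, norm_smul, Real.norm_of_nonneg hl0.le]
    calc lam l * ‖K e - W.starProjection (K e)‖ ≤ (2 * μ) * (ρ * (2 / c * ‖z‖)) := by
          refine mul_le_mul hlM ((hW e).trans (by gcongr)) (norm_nonneg _) (by positivity)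
      _ = _ := by ring
  have hxP : ‖x - W.starProjection x‖ ≤ T * ∑ k, ‖φ k - W.starProjection (φ k)‖ := by
    have h1 : x - W.starProjection x =
        ∑ k, inner ℝ (K w) (φ k) • (φ k - W.starProjection (φ k)) := by
      simp only [hx, eigPart, map_sum, map_smul, smul_sub, Finset.sum_sub_distrib]
    rw [h1, Finset.mul_sum]
    refine (norm_sum_le _ _).trans (Finset.sum_le_sum fun k _ => ?_)
    rw [norm_smul, Real.norm_eq_abs]
    exact mul_le_mul_of_nonneg_right (ht k) (norm_nonneg _)
  have hz2 : ‖z‖ ≤ 2 * T * ∑ k, ‖φ k - W.starProjection (φ k)‖ := by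
    have h1 : z = (x - W.starProjection x) + ((w - x) - W.starProjection (w - x)) := by
      rw [map_sub, hPw, hz]; abel
    have h2 : ‖z‖ ≤ ‖x - W.starProjection x‖ + ‖(w - x) - W.starProjection (w - x)‖ := by
      conv_lhs => rw [h1]
      exact norm_add_le _ _
    have h3 : 2 * μ * (2 / c) * ρ ≤ 1 / 2 := by
      calc 2 * μ * (2 / c) * ρ ≤ 2 * μ * (2 / c) * (c / (8 * μ)) := by gcongr
        _ = 1 / 2 := by field_simp; norm_num
    nlinarith [norm_nonneg z]
  have hS : 0 ≤ ∑ k, ‖φ k - W.starProjection (φ k)‖ := Finset.sum_nonneg fun _ _ => norm_nonneg _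
  refine ⟨by linarith, ((hφ.norm_eigPart_le hK w).trans hwR).trans (by linarith),
    fun k => (ht k).trans (by linarith), hz1.trans ?_, hz2.trans ?_, ?_, hg2.trans ?_⟩
  · exact mul_le_mul_of_nonneg_right (by linarith) hρ
  · exact mul_le_mul_of_nonneg_right (by linarith) hS
  · have h1 : x - u l = z - (w - x) := by rw [hz]; abel
    have h2 : ‖x - u l‖ ≤ ‖z‖ + ‖w - x‖ := by rw [h1]; exact norm_sub_le _ _
    have h3 : ‖x - u l‖ ≤ (1 + 2 * μ * κ * (2 / c)) * ‖z‖ := by linarith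
    exact h3.trans (mul_le_mul_of_nonneg_right (by linarith) (norm_nonneg _))
  · refine mul_le_mul_of_nonneg_right (mul_le_mul_of_nonneg_right (by linarith) hρ) (norm_nonneg _)

end Comparison

end Abstract

end Planewave

namespace Planewave

section Abstract

variable {E : Type*} [NormedAddCommGroup E] [InnerProductSpace ℝ E]

section Comparison

variable {ι : Type*} [Fintype ι] {K : E →L[ℝ] E} {μ : ℝ} {φ : ι → E}

/-- The coefficients of the vectors `w l` in the basis `φ`. -/
def coeffMatrix (K : E →L[ℝ] E) (φ w : ι → E) : Matrix ι ι ℝ :=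
  fun l k => inner ℝ (K (w l)) (φ k)

theorem eigPart_eq_sum_coeffMatrix (w : ι → E) (l : ι) :
    eigPart K φ (w l) = ∑ k, coeffMatrix K φ w l k • φ k := rfl

variable [DecidableEq ι]

theorem IsEigenbasis.coeffMatrix_mul_transpose (h : IsEigenbasis K μ φ) (w : ι → E) (l l' : ι) :
    (coeffMatrix K φ w * (coeffMatrix K φ w).transpose) l l' =
      inner ℝ (K (eigPart K φ (w l))) (eigPart K φ (w l')) := by
  rw [eigPart_eq_sum_coeffMatrix, eigPart_eq_sum_coeffMatrix, map_sum, sum_inner, Matrix.mul_apply]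
  refine Finset.sum_congr rfl fun k _ => ?_
  simp [inner_sum, real_inner_smul_left, real_inner_smul_right, h.orth, mul_comm]

/-- If the parts of `w` in the eigenspace are close to a `b`-orthonormal system, then the
coefficient matrix is almost orthogonal. -/
theorem IsEigenbasis.abs_transpose_mul_sub_one_le (h : IsEigenbasis K μ φ) {u w : ι → E} {C δ : ℝ}
    (hC : 0 ≤ C) (hδ : 0 ≤ δ)
    (hu : ∀ l l', inner ℝ (K (u l)) (u l') = if l = l' then (1 : ℝ) else 0)
    (h1 : ∀ l, ‖u l‖ ≤ C) (h2 : ∀ l, ‖eigPart K φ (w l)‖ ≤ C)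
    (h3 : ∀ l, ‖eigPart K φ (w l) - u l‖ ≤ δ) (k k' : ι) :
    |((coeffMatrix K φ w).transpose * coeffMatrix K φ w - 1) k k'| ≤
      Fintype.card ι * (2 * ‖K‖ * C * δ) := by
  set T := coeffMatrix K φ w with hT
  have e1 : ∀ l l', |(T * T.transpose - 1) l l'| ≤ 2 * ‖K‖ * C * δ := by
    intro l l'
    have e2 : (T * T.transpose - 1) l l' =
        inner ℝ (K (eigPart K φ (w l) - u l)) (eigPart K φ (w l')) +
          inner ℝ (K (u l)) (eigPart K φ (w l') - u l') := by
      rw [Matrix.sub_apply, hT, h.coeffMatrix_mul_transpose, Matrix.one_apply, ← hu l l', map_sub,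
        inner_sub_left, inner_sub_right]
      ring
    have e3 : ∀ x y : E, |inner ℝ (K x) y| ≤ ‖K‖ * ‖x‖ * ‖y‖ := fun x y =>
      (abs_real_inner_le_norm _ _).trans
        (mul_le_mul_of_nonneg_right (K.le_opNorm x) (norm_nonneg _))
    rw [e2]
    calc _ ≤ ‖K‖ * ‖eigPart K φ (w l) - u l‖ * ‖eigPart K φ (w l')‖ +
          ‖K‖ * ‖u l‖ * ‖eigPart K φ (w l') - u l'‖ :=
          (abs_add_le _ _).trans (add_le_add (e3 _ _) (e3 _ _))
      _ ≤ ‖K‖ * δ * C + ‖K‖ * C * δ := by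
          gcongr
          · exact h3 l
          · exact h2 l'
          · exact h1 l
          · exact h3 l'
      _ = _ := by ring
  have e4 := sum_sq_transpose_mul_sub_one T
  have e5 : ∑ i, ∑ j, (T * T.transpose - 1) i j ^ 2 ≤
      (Fintype.card ι * (2 * ‖K‖ * C * δ)) ^ 2 := by
    calc _ ≤ ∑ _i : ι, ∑ _j : ι, (2 * ‖K‖ * C * δ) ^ 2 := by
          refine Finset.sum_le_sum fun i _ => Finset.sum_le_sum fun j _ => ?_
          rw [← sq_abs]
          exact pow_le_pow_left₀ (abs_nonneg _) (e1 i j) 2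
      _ = _ := by simp; ring
  have e6 : (T.transpose * T - 1) k k' ^ 2 ≤ ∑ i, ∑ j, (T.transpose * T - 1) i j ^ 2 := by
    refine le_trans ?_ (Finset.single_le_sum
      (f := fun i => ∑ j, (T.transpose * T - 1) i j ^ 2) (fun i _ => by positivity)
      (Finset.mem_univ k))
    exact Finset.single_le_sum (f := fun j => (T.transpose * T - 1) k j ^ 2)
      (fun j _ => by positivity) (Finset.mem_univ k')
  refine abs_le_of_sq_le_sq ?_ (by positivity)
  linarith

/-- The energy errors of the auxiliary vectors `w l` and of the basis `φ` agree up to a factor that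
is close to one if the coefficient matrix is almost orthogonal. -/
theorem abs_sum_norm_sq_sub_le {w : ι → E} {A r β C : ℝ} (hr : 0 ≤ r) (hA : 0 ≤ A)
    (hβ : 0 ≤ β) (hC : 0 ≤ C) (Q : E →ₗ[ℝ] E)
    (h1 : ∀ k k', |((coeffMatrix K φ w).transpose * coeffMatrix K φ w - 1) k k'| ≤ A)
    (h2 : ∀ l k, |coeffMatrix K φ w l k| ≤ C)
    (h3 : ∑ k, ‖Q (φ k)‖ ≤ β) (h4 : ∀ l, ‖Q (w l - eigPart K φ (w l))‖ ≤ r * β) :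
    |∑ l, ‖Q (w l)‖ ^ 2 - ∑ k, ‖Q (φ k)‖ ^ 2| ≤
      (Fintype.card ι * (r * (2 * C + r)) + A) * β ^ 2 := by
  set T := coeffMatrix K φ w with hT
  set p : ι → E := fun l => Q (eigPart K φ (w l)) with hp
  have hp1 : ∀ l, p l = ∑ k, T l k • Q (φ k) := by
    intro l
    simp only [hp, eigPart_eq_sum_coeffMatrix, map_sum, map_smul, hT]
  have e1 : ∑ l, ‖p l‖ ^ 2 - ∑ k, ‖Q (φ k)‖ ^ 2 =
      ∑ k, ∑ k', (T.transpose * T - 1) k k' * inner ℝ (Q (φ k)) (Q (φ k')) := by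
    have f1 : ∀ l, ‖p l‖ ^ 2 = ∑ k, ∑ k', T l k * T l k' * inner ℝ (Q (φ k)) (Q (φ k')) := by
      intro l
      rw [← real_inner_self_eq_norm_sq, hp1, sum_inner]
      refine Finset.sum_congr rfl fun k _ => ?_
      rw [inner_sum]
      refine Finset.sum_congr rfl fun k' _ => ?_
      rw [real_inner_smul_left, real_inner_smul_right]; ring
    have f2 : ∑ l, ‖p l‖ ^ 2 =
        ∑ k, ∑ k', (T.transpose * T) k k' * inner ℝ (Q (φ k)) (Q (φ k')) := by
      simp only [f1]
      rw [Finset.sum_comm]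
      refine Finset.sum_congr rfl fun k _ => ?_
      rw [Finset.sum_comm]
      refine Finset.sum_congr rfl fun k' _ => ?_
      rw [Matrix.mul_apply, Finset.sum_mul]
      rfl
    rw [f2]
    simp only [Matrix.sub_apply, sub_mul, Finset.sum_sub_distrib, Matrix.one_apply, ite_mul,
      one_mul, zero_mul, Finset.sum_ite_eq, Finset.mem_univ, if_true, real_inner_self_eq_norm_sq]
  have e2 : |∑ l, ‖p l‖ ^ 2 - ∑ k, ‖Q (φ k)‖ ^ 2| ≤ A * β ^ 2 := by
    rw [e1]
    calc _ ≤ ∑ k, ∑ k', A * (‖Q (φ k)‖ * ‖Q (φ k')‖) := by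
          refine (Finset.abs_sum_le_sum_abs _ _).trans (Finset.sum_le_sum fun k _ => ?_)
          refine (Finset.abs_sum_le_sum_abs _ _).trans (Finset.sum_le_sum fun k' _ => ?_)
          rw [abs_mul]
          exact mul_le_mul (h1 k k') (abs_real_inner_le_norm _ _) (abs_nonneg _) hA
      _ = A * (∑ k, ‖Q (φ k)‖) ^ 2 := by
          rw [sq, Finset.sum_mul_sum]
          simp only [Finset.mul_sum]
      _ ≤ A * β ^ 2 := by
          have : 0 ≤ ∑ k, ‖Q (φ k)‖ := Finset.sum_nonneg fun _ _ => norm_nonneg _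
          gcongr
  have e3 : ∀ l, |‖Q (w l)‖ ^ 2 - ‖p l‖ ^ 2| ≤ r * (2 * C + r) * β ^ 2 := by
    intro l
    have g1 : ‖p l‖ ≤ C * β := by
      rw [hp1]
      calc _ ≤ ∑ k, C * ‖Q (φ k)‖ := by
            refine (norm_sum_le _ _).trans (Finset.sum_le_sum fun k _ => ?_)
            rw [norm_smul, Real.norm_eq_abs]
            exact mul_le_mul_of_nonneg_right (h2 l k) (norm_nonneg _)
        _ ≤ _ := by rw [← Finset.mul_sum]; exact mul_le_mul_of_nonneg_left h3 hC
    have g2 : Q (w l) = p l + Q (w l - eigPart K φ (w l)) := by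
      rw [map_sub]; simp [hp]
    have g3 : |‖Q (w l)‖ - ‖p l‖| ≤ r * β := by
      refine (abs_norm_sub_norm_le _ _).trans ?_
      rw [g2, add_sub_cancel_left]
      exact h4 l
    have g4 : ‖Q (w l)‖ + ‖p l‖ ≤ (2 * C + r) * β := by
      have := (abs_le.1 g3).2
      linarith
    have g5 : ‖Q (w l)‖ ^ 2 - ‖p l‖ ^ 2 = (‖Q (w l)‖ - ‖p l‖) * (‖Q (w l)‖ + ‖p l‖) := by ring
    have g6 : 0 ≤ ‖Q (w l)‖ + ‖p l‖ := by positivity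
    rw [g5, abs_mul, abs_of_nonneg g6]
    calc _ ≤ (r * β) * ((2 * C + r) * β) := mul_le_mul g3 g4 g6 (by positivity)
      _ = _ := by ring
  have e4 : |∑ l, ‖Q (w l)‖ ^ 2 - ∑ l, ‖p l‖ ^ 2| ≤
      Fintype.card ι * (r * (2 * C + r)) * β ^ 2 := by
    rw [← Finset.sum_sub_distrib]
    refine (Finset.abs_sum_le_sum_abs _ _).trans ((Finset.sum_le_sum fun l _ => e3 l).trans ?_)
    simp [mul_assoc]
  have := abs_sub_le (∑ l, ‖Q (w l)‖ ^ 2) (∑ l, ‖p l‖ ^ 2) (∑ k, ‖Q (φ k)‖ ^ 2)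
  linarith

/-- Comparison of an eigenspace of `K`, spanned by `φ`, with Galerkin eigenvectors `u` whose
eigenvalues are close to `μ`. For `w = λ K u`, the (partial) energy errors of `w` and `φ` agree up
to a factor that tends to one with `ρ → 0`, and the spans of `φ` and `u` differ by the best
approximation error of `φ`. -/
theorem IsSolutionOperator.exists_comparison [CompleteSpace E] (hK : IsSolutionOperator K)
    (hφ : IsEigenbasis K μ φ) :
    ∃ C > 0, ∃ ρ₀ > 0, ∃ ε₀ > 0, ∀ (W : Submodule ℝ E) [W.HasOrthogonalProjection]
      (lam : ι → ℝ) (u : ι → E) (ρ : ℝ), IsGalerkin K W lam u → (∀ l, |lam l - μ| ≤ ε₀) →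
      0 ≤ ρ → ρ ≤ ρ₀ → (∀ x, ‖K x - W.starProjection (K x)‖ ≤ ρ * ‖x‖) →
      (∀ Q : E →ₗ[ℝ] E, (∀ x, ‖Q x‖ ≤ ‖x - W.starProjection x‖) →
        |∑ l, ‖Q (lam l • K (u l))‖ ^ 2 - ∑ k, ‖Q (φ k)‖ ^ 2| ≤
          C * ρ * ∑ k, ‖φ k - W.starProjection (φ k)‖ ^ 2) ∧
      (∀ v ∈ Submodule.span ℝ (Set.range u), ∃ x ∈ Submodule.span ℝ (Set.range φ),
        ‖v - x‖ ≤ C * Real.sqrt (∑ k, ‖φ k - W.starProjection (φ k)‖ ^ 2) * ‖v‖) ∧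
      (∀ x ∈ Submodule.span ℝ (Set.range φ), ∃ v ∈ Submodule.span ℝ (Set.range u),
        ‖x - v‖ ≤ C * Real.sqrt (∑ k, ‖φ k - W.starProjection (φ k)‖ ^ 2) * ‖x‖) := by
  obtain ⟨C, hC, ρ₀, hρ₀, ε₀, hε₀, hmain⟩ := hK.exists_galerkin_bounds hφ
  set n := (Fintype.card ι : ℝ) with hn
  have hn0 : 0 ≤ n := Nat.cast_nonneg _
  set κ := ‖K‖ with hκ
  have hκ0 : 0 ≤ κ := norm_nonneg K
  set F := μ + 1 with hF
  have hF0 : 0 < F := by have := hφ.pos; positivity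
  have hφF : ∀ k, ‖φ k‖ ≤ F := by
    intro k
    refine abs_le_of_sq_le_sq' ?_ hF0.le |>.2
    rw [hφ.norm_sq]; nlinarith [hφ.pos]
  -- three constants for the three assertions, and their sum
  set D := n * (2 * κ * C * (C * C)) with hD
  have hD0 : 0 ≤ D := by positivity
  set C₁ := (n * (C * C * (2 * C + C * C * ρ₀)) + D) * n ^ 2 with hC₁
  set C₂ := n * (κ * C * (C * C)) * n with hC₂
  set C₃ := (n * (n * (D * (κ * F) * F)) + n * (κ * C * (C * C))) * n with hC₃
  have p1 : 0 ≤ C₁ := by positivity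
  have p2 : 0 ≤ C₂ := by positivity
  have p3 : 0 ≤ C₃ := by positivity
  refine ⟨C₁ + C₂ + C₃ + 1, by positivity, ρ₀, hρ₀, ε₀, hε₀, ?_⟩
  intro W _ lam u ρ hu hlam hρ hρρ₀ hW
  have hm := hmain W lam u ρ hu hlam hρ hρρ₀ hW
  set w : ι → E := fun l => lam l • K (u l) with hw
  set β := ∑ k, ‖φ k - W.starProjection (φ k)‖ with hβ
  set B := Real.sqrt (∑ k, ‖φ k - W.starProjection (φ k)‖ ^ 2) with hB
  have hβ0 : 0 ≤ β := Finset.sum_nonneg fun _ _ => norm_nonneg _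
  have hB0 : 0 ≤ B := Real.sqrt_nonneg _
  have hBsq : B ^ 2 = ∑ k, ‖φ k - W.starProjection (φ k)‖ ^ 2 :=
    Real.sq_sqrt (Finset.sum_nonneg fun _ _ => sq_nonneg _)
  have hβB : β ≤ n * B := by
    have : ∀ k ∈ (Finset.univ : Finset ι), ‖φ k - W.starProjection (φ k)‖ ≤ B := fun k hk =>
      Real.le_sqrt_of_sq_le (Finset.single_le_sum
        (f := fun k => ‖φ k - W.starProjection (φ k)‖ ^ 2) (fun _ _ => sq_nonneg _) hk)
    simpa using Finset.sum_le_card_nsmul _ _ _ this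
  have hz : ∀ l, ‖w l - u l‖ ≤ C * β := fun l => (hm l).2.2.2.2.1
  have hzρ : ∀ l, ‖w l - u l‖ ≤ C * ρ := fun l => (hm l).2.2.2.1
  have hxu : ∀ l, ‖eigPart K φ (w l) - u l‖ ≤ C * ‖w l - u l‖ := fun l => (hm l).2.2.2.2.2.1
  have hxu' : ∀ l, ‖eigPart K φ (w l) - u l‖ ≤ C * C * β := fun l => (hxu l).trans (by
    rw [mul_assoc]; exact mul_le_mul_of_nonneg_left (hz l) hC.le)
  have hTT : ∀ δ, 0 ≤ δ → (∀ l, ‖w l - u l‖ ≤ C * δ) → ∀ k k',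
      |((coeffMatrix K φ w).transpose * coeffMatrix K φ w - 1) k k'| ≤ D * δ := by
    intro δ hδ h k k'
    refine (hφ.abs_transpose_mul_sub_one_le (δ := C * (C * δ)) hC.le (by positivity) hu.orth
      (fun l => (hm l).1) (fun l => (hm l).2.1)
      (fun l => (hxu l).trans (mul_le_mul_of_nonneg_left (h l) hC.le)) k k').trans (le_of_eq ?_)
    rw [hD]; ring
  have hT : ∀ l k, |coeffMatrix K φ w l k| ≤ C := fun l k => (hm l).2.2.1 k
  have hb : ∀ x y : E, |inner ℝ (K x) y| ≤ κ * ‖x‖ * ‖y‖ := fun x y =>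
    (abs_real_inner_le_norm _ _).trans (mul_le_mul_of_nonneg_right (K.le_opNorm x) (norm_nonneg _))
  refine ⟨fun Q hQ => ?_, fun v hv => ?_, fun x hx => ?_⟩
  · have h3 : ∑ k, ‖Q (φ k)‖ ≤ β := Finset.sum_le_sum fun k _ => hQ _
    have h4 : ∀ l, ‖Q (w l - eigPart K φ (w l))‖ ≤ (C * C * ρ) * β := fun l =>
      (hQ _).trans ((hm l).2.2.2.2.2.2.trans (by
        calc C * ρ * ‖w l - u l‖ ≤ C * ρ * (C * β) := by gcongr; exact hz l
          _ = _ := by ring))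
    have h5 := abs_sum_norm_sq_sub_le (A := D * ρ) (r := C * C * ρ) (β := β) (C := C)
      (by positivity) (by positivity) hβ0 hC.le Q (hTT ρ hρ hzρ) hT h3 h4
    refine h5.trans ?_
    rw [← hBsq]
    have h6 : Fintype.card ι * (C * C * ρ * (2 * C + C * C * ρ)) + D * ρ ≤
        (n * (C * C * (2 * C + C * C * ρ₀)) + D) * ρ := by
      have : n * (C * C * ρ * (2 * C + C * C * ρ)) ≤ n * (C * C * ρ * (2 * C + C * C * ρ₀)) := by
        gcongr
      linarith
    have h7 : β ^ 2 ≤ n ^ 2 * B ^ 2 := by rw [← mul_pow]; gcongr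
    calc _ ≤ ((n * (C * C * (2 * C + C * C * ρ₀)) + D) * ρ) * (n ^ 2 * B ^ 2) := by
          refine mul_le_mul h6 h7 (by positivity) (by positivity)
      _ = C₁ * ρ * B ^ 2 := by rw [hC₁]; ring
      _ ≤ _ := by gcongr; linarith
  · refine ⟨∑ l, inner ℝ (K v) (u l) • eigPart K φ (w l),
      Submodule.sum_mem _ fun l _ => Submodule.smul_mem _ _ (hφ.span (hφ.eigPart_mem _)), ?_⟩
    have h1 := sum_inner_map_smul hu.orth hv
    have h2 : v - ∑ l, inner ℝ (K v) (u l) • eigPart K φ (w l) =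
        -∑ l, inner ℝ (K v) (u l) • (eigPart K φ (w l) - u l) := by
      simp only [smul_sub, Finset.sum_sub_distrib, h1]; abel
    rw [h2, norm_neg]
    calc _ ≤ ∑ _l : ι, (κ * ‖v‖ * C) * (C * C * β) := by
          refine (norm_sum_le _ _).trans (Finset.sum_le_sum fun l _ => ?_)
          rw [norm_smul, Real.norm_eq_abs]
          refine mul_le_mul ((hb _ _).trans ?_) (hxu' l) (norm_nonneg _) (by positivity)
          exact mul_le_mul_of_nonneg_left (hm l).1 (by positivity)
      _ = n * (κ * C * (C * C)) * ‖v‖ * β := by simp; ring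
      _ ≤ n * (κ * C * (C * C)) * ‖v‖ * (n * B) := by gcongr
      _ = C₂ * B * ‖v‖ := by rw [hC₂]; ring
      _ ≤ _ := by gcongr; linarith
  · set T := coeffMatrix K φ w with hTdef
    set b : ι → ℝ := fun k => inner ℝ (K x) (φ k) with hbdef
    have hxb : ∑ k, b k • φ k = x := sum_inner_map_smul hφ.orth hx
    set γ : ι → ℝ := fun l => ∑ k, T l k * b k with hγ
    have hγ1 : ∀ l, |γ l| ≤ κ * ‖x‖ * C := by
      intro l
      have : γ l = inner ℝ (K x) (eigPart K φ (w l)) := by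
        rw [eigPart_eq_sum_coeffMatrix, inner_sum]
        simp only [hγ, hbdef, real_inner_smul_right, hTdef]
      rw [this]
      exact (hb _ _).trans (mul_le_mul_of_nonneg_left (hm l).2.1 (by positivity))
    refine ⟨∑ l, γ l • u l, Submodule.sum_mem _ fun l _ => Submodule.smul_mem _ _
      (Submodule.subset_span ⟨l, rfl⟩), ?_⟩
    have h1 : ∑ l, γ l • eigPart K φ (w l) = ∑ k, ∑ k', (T.transpose * T) k k' • b k' • φ k := by
      simp only [hγ, eigPart_eq_sum_coeffMatrix, Finset.smul_sum, Matrix.mul_apply, ← hTdef]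
      rw [Finset.sum_comm]
      refine Finset.sum_congr rfl fun k _ => ?_
      simp only [Finset.sum_smul]
      rw [Finset.sum_comm]
      refine Finset.sum_congr rfl fun k' _ => Finset.sum_congr rfl fun l _ => ?_
      rw [Matrix.transpose_apply, smul_smul, smul_smul]
      congr 1; ring
    have h2 : x - ∑ l, γ l • u l = -(∑ k, ∑ k', (T.transpose * T - 1) k k' • b k' • φ k) +
        ∑ l, γ l • (eigPart K φ (w l) - u l) := by
      have h3 : ∑ k, ∑ k', (1 : Matrix ι ι ℝ) k k' • b k' • φ k = x := by
        simp [Matrix.one_apply, hxb]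
      simp only [Matrix.sub_apply, sub_smul, smul_sub, Finset.sum_sub_distrib, h3, ← h1]
      abel
    rw [h2]
    calc _ ≤ ∑ _k : ι, ∑ _k' : ι, (D * β) * ((κ * ‖x‖ * F) * F) +
          ∑ _l : ι, (κ * ‖x‖ * C) * (C * C * β) := by
          refine (norm_add_le _ _).trans (add_le_add ?_ ?_)
          · rw [norm_neg]
            refine (norm_sum_le _ _).trans (Finset.sum_le_sum fun k _ => ?_)
            refine (norm_sum_le _ _).trans (Finset.sum_le_sum fun k' _ => ?_)
            rw [norm_smul, norm_smul, Real.norm_eq_abs, Real.norm_eq_abs]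
            refine mul_le_mul (hTT β hβ0 hz k k') ?_ (by positivity) (by positivity)
            refine mul_le_mul ((hb _ _).trans ?_) (hφF k) (norm_nonneg _) (by positivity)
            exact mul_le_mul_of_nonneg_left (hφF k') (by positivity)
          · refine (norm_sum_le _ _).trans (Finset.sum_le_sum fun l _ => ?_)
            rw [norm_smul, Real.norm_eq_abs]
            exact mul_le_mul (hγ1 l) (hxu' l) (norm_nonneg _) (by positivity)
      _ = (n * (n * (D * (κ * F) * F)) + n * (κ * C * (C * C))) * ‖x‖ * β := by simp; ring
      _ ≤ (n * (n * (D * (κ * F) * F)) + n * (κ * C * (C * C))) * ‖x‖ * (n * B) := by gcongr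
      _ = C₃ * B * ‖x‖ := by rw [hC₃]; ring
      _ ≤ _ := by gcongr; linarith

end Comparison

end Abstract

end Planewave

namespace Planewave

/-! ### Counting eigenvalues -/

section Abstract

variable {E : Type*} [NormedAddCommGroup E] [InnerProductSpace ℝ E]

section Counting

variable {K : E →L[ℝ] E} {W : Submodule ℝ E} {t t' : ℝ} {A : Set ℝ}

/-- The span of the eigenvectors in `W` with eigenvalue in `A`. -/
def eigSpan (K : E →L[ℝ] E) (W : Submodule ℝ E) (A : Set ℝ) : Submodule ℝ E :=
  Submodule.span ℝ {u | ∃ μ ∈ A, u ∈ eigSub K W μ}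

theorem eigSub_le_eigSpan {μ : ℝ} (h : μ ∈ A) : eigSub K W μ ≤ eigSpan K W A :=
  fun _ hu => Submodule.subset_span ⟨μ, h, hu⟩

theorem eigSpan_mono {B : Set ℝ} (h : A ⊆ B) : eigSpan K W A ≤ eigSpan K W B :=
  Submodule.span_mono fun _ ⟨μ, hμ, hu⟩ => ⟨μ, h hμ, hu⟩

theorem eigSpan_le : eigSpan K W A ≤ W :=
  Submodule.span_le.2 fun _ ⟨_, _, hu⟩ => hu.1

theorem exists_finsupp_of_mem_eigSpan {v : E} (hv : v ∈ eigSpan K W A) :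
    ∃ f : ℝ →₀ E, (∀ μ ∈ f.support, μ ∈ A) ∧ (∀ μ, f μ ∈ eigSub K W μ) ∧
      ∑ μ ∈ f.support, f μ = v := by
  classical
  induction hv using Submodule.span_induction with
  | mem v hv =>
    obtain ⟨μ, hμ, hu⟩ := hv
    refine ⟨Finsupp.single μ v, fun ν hν => ?_, fun ν => ?_, ?_⟩
    · have := Finsupp.support_single_subset hν
      rw [Finset.mem_singleton] at this
      rwa [this]
    · by_cases h : μ = ν
      · subst h; simpa using hu
      · rw [Finsupp.single_eq_of_ne (Ne.symm h)]; exact Submodule.zero_mem _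
    · exact Finsupp.sum_single_index (h := fun _ x => x) rfl
  | zero => exact ⟨0, by simp, fun μ => Submodule.zero_mem _, by simp⟩
  | add x y _ _ hx hy =>
    obtain ⟨f, hf1, hf2, hf3⟩ := hx
    obtain ⟨g, hg1, hg2, hg3⟩ := hy
    refine ⟨f + g, fun μ hμ => ?_, fun μ => Submodule.add_mem _ (hf2 μ) (hg2 μ), ?_⟩
    · rcases Finset.mem_union.1 (Finsupp.support_add hμ) with h | h
      · exact hf1 μ h
      · exact hg1 μ h
    · rw [← hf3, ← hg3]
      exact Finsupp.sum_add_index' (h := fun _ x => x) (fun _ => rfl) (fun _ _ _ => rfl)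
  | smul c x _ hx =>
    obtain ⟨f, hf1, hf2, hf3⟩ := hx
    refine ⟨c • f, fun μ hμ => hf1 μ (Finsupp.support_smul hμ),
      fun μ => Submodule.smul_mem _ _ (hf2 μ), ?_⟩
    rw [← hf3, Finset.smul_sum]
    exact Finsupp.sum_smul_index' (h := fun _ x => x) (fun _ => rfl)

theorem inner_eq_zero_of_mem_eigSub (hK : IsSolutionOperator K) {μ ν : ℝ} (h : μ ≠ ν) {u v : E}
    (hu : u ∈ eigSub K W μ) (hv : v ∈ eigSub K W ν) :
    inner ℝ u v = 0 ∧ inner ℝ (K u) v = 0 := by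
  have h1 := hu.2 v hv.1
  have h2 := hv.2 u hu.1
  rw [real_inner_comm, real_inner_comm u, ← hK.symm] at h2
  have h3 : (μ - ν) * inner ℝ (K u) v = 0 := by
    rw [sub_mul, ← h1, ← h2, sub_self]
  have h4 : inner ℝ (K u) v = 0 := (mul_eq_zero.1 h3).resolve_left (sub_ne_zero.2 h)
  exact ⟨by rw [h1, h4, mul_zero], h4⟩

theorem norm_sq_eq_of_mem_eigSub {μ : ℝ} {u : E} (hu : u ∈ eigSub K W μ) :
    ‖u‖ ^ 2 = μ * inner ℝ (K u) u := by
  rw [← real_inner_self_eq_norm_sq, hu.2 u hu.1]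

theorem IsSolutionOperator.inner_nonneg (hK : IsSolutionOperator K) (x : E) :
    0 ≤ inner ℝ (K x) x := by
  by_cases h : x = 0
  · simp [h]
  · exact (hK.pos x h).le

theorem pos_of_mem_eigSub (hK : IsSolutionOperator K) {μ : ℝ} {u : E} (hu : u ∈ eigSub K W μ)
    (h0 : u ≠ 0) : 0 < μ := by
  have h1 := norm_sq_eq_of_mem_eigSub hu
  have h2 := hK.pos u h0
  have h3 : 0 < ‖u‖ := norm_pos_iff.2 h0
  by_contra h
  nlinarith [mul_nonneg (neg_nonneg.2 (not_lt.1 h)) h2.le, sq_nonneg ‖u‖, mul_pos h3 h3]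

theorem norm_sq_sum_smul_of_eigSub (hK : IsSolutionOperator K) {f : ℝ → E} (J : Finset ℝ)
    (hf : ∀ μ, f μ ∈ eigSub K W μ) (c : ℝ → ℝ) :
    ‖∑ μ ∈ J, c μ • f μ‖ ^ 2 = ∑ μ ∈ J, c μ ^ 2 * ‖f μ‖ ^ 2 := by
  classical
  rw [← real_inner_self_eq_norm_sq, sum_inner]
  refine Finset.sum_congr rfl fun μ hμ => ?_
  rw [inner_sum, Finset.sum_eq_single μ]
  · rw [real_inner_smul_left, real_inner_smul_right, real_inner_self_eq_norm_sq]; ring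
  · intro ν _ hν
    rw [real_inner_smul_left, real_inner_smul_right,
      (inner_eq_zero_of_mem_eigSub hK (Ne.symm hν) (hf μ) (hf ν)).1, mul_zero, mul_zero]
  · exact fun h => absurd hμ h

theorem inner_map_sum_of_eigSub (hK : IsSolutionOperator K) {f : ℝ → E} (J : Finset ℝ)
    (hf : ∀ μ, f μ ∈ eigSub K W μ) :
    inner ℝ (K (∑ μ ∈ J, f μ)) (∑ μ ∈ J, f μ) = ∑ μ ∈ J, inner ℝ (K (f μ)) (f μ) := by
  classical
  rw [map_sum, sum_inner]
  refine Finset.sum_congr rfl fun μ hμ => ?_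
  rw [inner_sum, Finset.sum_eq_single μ]
  · intro ν _ hν
    exact (inner_eq_zero_of_mem_eigSub hK (Ne.symm hν) (hf μ) (hf ν)).2
  · exact fun h => absurd hμ h

/-- The Rayleigh quotient on the span of the eigenvectors to eigenvalues `≤ t` is at most `t`. -/
theorem norm_sq_le_of_mem_eigSpan (hK : IsSolutionOperator K) {v : E}
    (hv : v ∈ eigSpan K W (Set.Iic t)) : ‖v‖ ^ 2 ≤ t * inner ℝ (K v) v := by
  obtain ⟨f, hf1, hf2, rfl⟩ := exists_finsupp_of_mem_eigSpan hv
  have h := norm_sq_sum_smul_of_eigSub hK f.support hf2 (fun _ => 1)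
  simp only [one_smul, one_pow, one_mul] at h
  rw [h, inner_map_sum_of_eigSub hK _ hf2, Finset.mul_sum]
  refine Finset.sum_le_sum fun μ hμ => ?_
  rw [norm_sq_eq_of_mem_eigSub (hf2 μ)]
  exact mul_le_mul_of_nonneg_right (hf1 μ hμ) (hK.inner_nonneg _)

/-- Elements of the span of the exact eigenvectors to eigenvalues `≤ t` are values of `K`, with
control of the preimage. -/
theorem exists_map_eq_of_mem_eigSpan (hK : IsSolutionOperator K) {v : E}
    (hv : v ∈ eigSpan K ⊤ (Set.Iic t)) (ht : 0 ≤ t) : ∃ y, K y = v ∧ ‖y‖ ≤ t * ‖v‖ := by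
  obtain ⟨f, hf1, hf2, rfl⟩ := exists_finsupp_of_mem_eigSpan hv
  refine ⟨∑ μ ∈ f.support, μ • f μ, ?_, ?_⟩
  · rw [map_sum]
    refine Finset.sum_congr rfl fun μ _ => ?_
    rw [map_smul, ← mem_eigSub_top.1 (hf2 μ)]
  · refine le_of_sq_le_sq ?_ (by positivity)
    have h := norm_sq_sum_smul_of_eigSub hK f.support hf2 (fun _ => 1)
    simp only [one_smul, one_pow, one_mul] at h
    rw [norm_sq_sum_smul_of_eigSub hK f.support hf2 (fun μ => μ), mul_pow, h, Finset.mul_sum]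
    refine Finset.sum_le_sum fun μ hμ => mul_le_mul_of_nonneg_right ?_ (sq_nonneg _)
    have h1 := pos_of_mem_eigSub hK (hf2 μ) (Finsupp.mem_support_iff.1 hμ)
    exact pow_le_pow_left₀ h1.le (hf1 μ hμ) 2

/-- The Rayleigh quotient on the orthogonal complement, within `W`, of the eigenvectors to
eigenvalues `≤ t` is at least `t`. -/
theorem le_norm_sq_of_mem_orthogonal [CompleteSpace E] (hK : IsSolutionOperator K)
    (hW : IsClosed (W : Set E)) (ht : 0 < t) {v : E} (hvW : v ∈ W)
    (hv : v ∈ (eigSpan K W (Set.Iic t))ᗮ) : t * inner ℝ (K v) v ≤ ‖v‖ ^ 2 := by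
  set S := eigSpan K W (Set.Iic t) with hS
  set Z : Submodule ℝ E := W ⊓ Sᗮ with hZ
  have hZc : IsClosed (Z : Set E) := hW.inter (Submodule.isClosed_orthogonal S)
  have : CompleteSpace Z := hZc.completeSpace_coe
  have : CompleteSpace (Sᗮ : Submodule ℝ E) := (Submodule.isClosed_orthogonal S).completeSpace_coe
  let T : Z →L[ℝ] Z := Z.orthogonalProjectionOnto ∘L K ∘L Z.subtypeL
  have hTin : ∀ x y : Z, inner ℝ (T x) y = inner ℝ (K (x : E)) (y : E) := by
    intro x y
    change inner ℝ (Z.orthogonalProjectionOnto (K (x : E))) y = _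
    rw [Submodule.inner_orthogonalProjectionOnto_eq_of_mem_right]
  have hTc : IsCompactOperator T :=
    (hK.compact.comp_clm Z.subtypeL).clm_comp Z.orthogonalProjectionOnto
  have hTs : (T : Z →ₗ[ℝ] Z).IsSymmetric := by
    intro x y
    change inner ℝ (T x) y = inner ℝ x (T y)
    rw [hTin x y, real_inner_comm (T y) x, hTin y x, hK.symm, real_inner_comm]
  -- every positive spectral value of `T` is the reciprocal of an eigenvalue `> t`
  have hspec : ∀ κ ∈ spectrum ℝ T, ‖κ‖₊ ≤ (1 / t).toNNReal := by
    intro κ hκ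
    by_cases h0 : κ = 0
    · simp [h0]
    obtain ⟨z, hz⟩ := ((hTc.hasEigenvalue_iff_mem_spectrum h0).2 hκ).exists_hasEigenvector
    have hz1 : T z = κ • z := hz.apply_eq_smul
    have hz0 : (z : E) ≠ 0 := fun h => hz.2 (by ext; simpa using h)
    have hz2 : ∀ y ∈ Z, inner ℝ (K (z : E)) y = κ * inner ℝ (z : E) y := by
      intro y hy
      have := hTin z ⟨y, hy⟩
      rw [hz1, real_inner_smul_left] at this
      exact this.symm
    have hκ0 : 0 < κ := by
      have h1 := hz2 z z.2
      rw [real_inner_self_eq_norm_sq] at h1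
      have h2 := hK.pos _ hz0
      by_contra h
      nlinarith [mul_nonneg (neg_nonneg.2 (not_lt.1 h)) (sq_nonneg ‖(z : E)‖)]
    have hzS : ∀ s ∈ S, inner ℝ s (K (z : E)) = 0 := by
      intro s hs
      induction hs using Submodule.span_induction with
      | mem s hs =>
        obtain ⟨ν, hνA, hν⟩ := hs
        by_cases hs0 : s = 0
        · simp [hs0]
        have h1 := hν.2 z z.2.1
        have h2 : inner ℝ s (z : E) = 0 :=
          (Submodule.mem_orthogonal _ _).1 z.2.2 s (Submodule.subset_span ⟨ν, hνA, hν⟩)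
        rw [h2] at h1
        rw [← hK.symm]
        exact (mul_eq_zero.1 h1.symm).resolve_left (pos_of_mem_eigSub hK hν hs0).ne'
      | zero => simp
      | add x y _ _ hx hy => rw [inner_add_left, hx, hy, add_zero]
      | smul c x _ hx => rw [real_inner_smul_left, hx, mul_zero]
    have hKz : K (z : E) ∈ Sᗮ := (Submodule.mem_orthogonal _ _).2 hzS
    have hclos : Sᗮᗮ ≤ W := by
      rw [Submodule.orthogonal_orthogonal_eq_closure]
      exact Submodule.topologicalClosure_minimal _ eigSpan_le hW
    by_contra hlt
    have hlt' : 1 / t < κ := by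
      rw [not_le, Real.toNNReal_lt_iff_lt_coe (by positivity), coe_nnnorm,
        Real.norm_of_nonneg hκ0.le] at hlt
      exact hlt
    have hmem : (z : E) ∈ eigSub K W κ⁻¹ := by
      refine ⟨z.2.1, fun y hy => ?_⟩
      obtain ⟨y₁, hy₁, y₂, hy₂, rfl⟩ := Sᗮ.exists_add_mem_mem_orthogonal y
      have hy₁W : y₁ ∈ W := by
        have := W.sub_mem hy (hclos hy₂)
        rwa [add_sub_cancel_right] at this
      rw [inner_add_right, inner_add_right, (Submodule.mem_orthogonal _ _).1 hy₂ _ z.2.2,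
        (Submodule.mem_orthogonal _ _).1 hy₂ _ hKz, hz2 y₁ ⟨hy₁W, hy₁⟩, add_zero, add_zero,
        inv_mul_cancel_left₀ h0]
    have hmem' : (z : E) ∈ S := by
      refine Submodule.subset_span ⟨κ⁻¹, ?_, hmem⟩
      rw [Set.mem_Iic, inv_le_comm₀ hκ0 ht, ← one_div]
      exact hlt'.le
    have := (Submodule.mem_orthogonal _ _).1 z.2.2 _ hmem'
    exact hz0 (inner_self_eq_zero.1 this)
  have hnorm : ‖T‖ ≤ 1 / t := by
    have h1 : spectralRadius ℝ T ≤ ((1 / t).toNNReal : ENNReal) :=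
      iSup₂_le fun κ hκ => by
        have := hspec κ hκ
        exact_mod_cast this
    rw [T.spectralRadius_eq_nnnorm hTs.isSelfAdjoint, ENNReal.coe_le_coe] at h1
    have h2 : (‖T‖₊ : ℝ) ≤ ((1 / t).toNNReal : ℝ) := h1
    rwa [Real.coe_toNNReal _ (by positivity)] at h2
  have h1 := hTin ⟨v, hvW, hv⟩ ⟨v, hvW, hv⟩
  have h2 : inner ℝ (K v) v ≤ 1 / t * ‖v‖ * ‖v‖ := by
    rw [← h1]
    refine (real_inner_le_norm _ _).trans ?_
    refine mul_le_mul_of_nonneg_right ?_ (norm_nonneg _)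
    exact (T.le_opNorm _).trans (mul_le_mul_of_nonneg_right hnorm (norm_nonneg _))
  calc t * inner ℝ (K v) v ≤ t * (1 / t * ‖v‖ * ‖v‖) := by gcongr
    _ = _ := by field_simp

theorem exists_mem_orthogonal_of_rank_lt {S B : Submodule ℝ E} [FiniteDimensional ℝ B]
    (h : Module.rank ℝ B < Module.rank ℝ S) : ∃ v ∈ S, v ≠ 0 ∧ v ∈ Bᗮ := by
  by_contra! hne
  let L : S →ₗ[ℝ] B := (B.orthogonalProjectionOnto : E →ₗ[ℝ] B) ∘ₗ S.subtype
  have hL : Function.Injective L := by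
    rw [← LinearMap.ker_eq_bot, LinearMap.ker_eq_bot']
    intro x hx
    by_contra h0
    refine hne x x.2 (fun h => h0 (by ext; simpa using h)) ?_
    rw [← Submodule.orthogonalProjectionOnto_eq_zero_iff]
    exact hx
  exact absurd (LinearMap.rank_le_of_injective L hL) (not_le.2 h)

theorem finiteDimensional_of_rank_lt_nat {S : Submodule ℝ E} {k : ℕ}
    (h : Module.rank ℝ S < (k : Cardinal)) : FiniteDimensional ℝ S :=
  Module.rank_lt_aleph0_iff.1 (h.trans Cardinal.natCast_lt_aleph0)

/-- Galerkin eigenvalues are not smaller than the exact ones, in terms of counting functions. -/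
theorem le_rank_eigSpan_top [CompleteSpace E] (hK : IsSolutionOperator K) {k : ℕ} (h : t' < t)
    (hk : (k : Cardinal) ≤ Module.rank ℝ (eigSpan K W (Set.Iic t'))) :
    (k : Cardinal) ≤ Module.rank ℝ (eigSpan K ⊤ (Set.Iic t)) := by
  by_contra! hlt
  have := finiteDimensional_of_rank_lt_nat hlt
  obtain ⟨v, hv, h0, hv'⟩ := exists_mem_orthogonal_of_rank_lt (hlt.trans_le hk)
  have h1 := norm_sq_le_of_mem_eigSpan hK hv
  have h2 := hK.pos v h0
  have h3 : 0 < ‖v‖ ^ 2 := by positivity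
  have ht' : 0 < t' := by
    by_contra hneg
    nlinarith [mul_nonneg (neg_nonneg.2 (not_lt.1 hneg)) h2.le]
  have h4 := le_norm_sq_of_mem_orthogonal (W := ⊤) hK isClosed_univ (ht'.trans h) trivial hv'
  nlinarith

theorem isClosed_of_hasOrthogonalProjection (W : Submodule ℝ E) [W.HasOrthogonalProjection] :
    IsClosed (W : Set E) := by
  rw [← W.orthogonal_orthogonal]
  exact Submodule.isClosed_orthogonal _

/-- For a good approximation space the Galerkin eigenvalues are not much larger than the exact
ones, in terms of counting functions. -/
theorem exists_le_rank_eigSpan [CompleteSpace E] (hK : IsSolutionOperator K) {k : ℕ} (h : t < t')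
    (hk : (k : Cardinal) ≤ Module.rank ℝ (eigSpan K ⊤ (Set.Iic t))) :
    ∃ ρ₀ > 0, ∀ (W : Submodule ℝ E) [W.HasOrthogonalProjection],
      (∀ x, ‖K x - W.starProjection (K x)‖ ≤ ρ₀ * ‖x‖) →
      (k : Cardinal) ≤ Module.rank ℝ (eigSpan K W (Set.Iic t')) := by
  have hd : 0 < t' - t := sub_pos.2 h
  refine ⟨(t' - t) / (4 * (‖K‖ + 1) * (t ^ 2 + 1) * (|t'| + 1)), by positivity, ?_⟩
  intro W _ hρ
  set ρ := (t' - t) / (4 * (‖K‖ + 1) * (t ^ 2 + 1) * (|t'| + 1)) with hρdef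
  have hρ0 : 0 < ρ := by positivity
  by_contra! hlt
  have := finiteDimensional_of_rank_lt_nat hlt
  obtain ⟨x, hx, h0, hx'⟩ := exists_mem_orthogonal_of_rank_lt (hlt.trans_le hk)
  have h1 := norm_sq_le_of_mem_eigSpan hK hx
  have h2 := hK.pos x h0
  have h3 : 0 < ‖x‖ ^ 2 := by positivity
  have ht : 0 < t := by
    by_contra hneg
    nlinarith [mul_nonneg (neg_nonneg.2 (not_lt.1 hneg)) h2.le]
  obtain ⟨y, hy, hyn⟩ := exists_map_eq_of_mem_eigSpan hK hx ht.le
  set p := W.starProjection x with hp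
  have hxp : ‖x - p‖ ≤ ρ * (t * ‖x‖) := by
    have := hρ y
    rw [hy] at this
    exact this.trans (mul_le_mul_of_nonneg_left hyn hρ0.le)
  have hpx : ‖p‖ ≤ ‖x‖ := W.norm_starProjection_apply_le x
  have hpS : p ∈ (eigSpan K W (Set.Iic t'))ᗮ := by
    rw [Submodule.mem_orthogonal] at hx' ⊢
    intro s hs
    have h4 := W.starProjection_inner_eq_zero x s (eigSpan_le hs)
    rw [inner_sub_left, sub_eq_zero, real_inner_comm, hx' s hs] at h4
    rw [real_inner_comm]; exact h4.symm
  have h5 := le_norm_sq_of_mem_orthogonal hK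
    (isClosed_of_hasOrthogonalProjection W) (ht.trans h)
    (W.starProjection_apply_mem x) hpS
  have h6 : inner ℝ (K x) x - inner ℝ (K p) p ≤ 2 * ‖K‖ * ‖x‖ * ‖x - p‖ := by
    have e1 : inner ℝ (K x) x - inner ℝ (K p) p =
        inner ℝ (K (x - p)) x + inner ℝ (K p) (x - p) := by
      rw [map_sub, inner_sub_left, inner_sub_right]; ring
    have e2 : ∀ a b : E, inner ℝ (K a) b ≤ ‖K‖ * ‖a‖ * ‖b‖ := fun a b =>
      (real_inner_le_norm _ _).trans (mul_le_mul_of_nonneg_right (K.le_opNorm a) (norm_nonneg _))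
    rw [e1]
    calc _ ≤ ‖K‖ * ‖x - p‖ * ‖x‖ + ‖K‖ * ‖p‖ * ‖x - p‖ := add_le_add (e2 _ _) (e2 _ _)
      _ ≤ ‖K‖ * ‖x - p‖ * ‖x‖ + ‖K‖ * ‖x‖ * ‖x - p‖ := by gcongr
      _ = _ := by ring
  have h7 : 2 * ‖K‖ * ‖x‖ * ‖x - p‖ ≤ 2 * ‖K‖ * ρ * t ^ 2 * inner ℝ (K x) x := by
    calc 2 * ‖K‖ * ‖x‖ * ‖x - p‖ ≤ 2 * ‖K‖ * ‖x‖ * (ρ * (t * ‖x‖)) := by gcongr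
      _ = 2 * ‖K‖ * ρ * t * ‖x‖ ^ 2 := by ring
      _ ≤ 2 * ‖K‖ * ρ * t * (t * inner ℝ (K x) x) := by gcongr
      _ = _ := by ring
  have h8 : ‖p‖ ^ 2 ≤ ‖x‖ ^ 2 := by gcongr
  have h9 : t' * (2 * ‖K‖ * ρ * t ^ 2) ≤ (t' - t) / 2 := by
    have e1 : t' ≤ |t'| + 1 := (le_abs_self _).trans (by linarith)
    calc t' * (2 * ‖K‖ * ρ * t ^ 2) ≤ (|t'| + 1) * (2 * (‖K‖ + 1) * ρ * (t ^ 2 + 1)) := by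
          have : ‖K‖ ≤ ‖K‖ + 1 := by linarith
          have : t ^ 2 ≤ t ^ 2 + 1 := by linarith
          gcongr
      _ = (t' - t) / 2 := by rw [hρdef]; field_simp; norm_num
  have h10 : t' * inner ℝ (K x) x ≤ t * inner ℝ (K x) x +
      t' * (2 * ‖K‖ * ρ * t ^ 2) * inner ℝ (K x) x := by
    have e1 : t' * (inner ℝ (K x) x - inner ℝ (K p) p) ≤
        t' * (2 * ‖K‖ * ρ * t ^ 2 * inner ℝ (K x) x) :=
      mul_le_mul_of_nonneg_left (h6.trans h7) (ht.trans h).le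
    linarith
  have h11 := mul_le_mul_of_nonneg_right h9 h2.le
  nlinarith [mul_pos hd h2]

end Counting

end Abstract

end Planewave

namespace Planewave

section Abstract

variable {E : Type*} [NormedAddCommGroup E] [InnerProductSpace ℝ E]

section Eigenvalues

variable {K : E →L[ℝ] E} {W : Submodule ℝ E} {t : ℝ} {k : ℕ}

/-- The levels `t` below which there are at least `k` eigenvalues, counted with multiplicity. -/
def levelSet (K : E →L[ℝ] E) (W : Submodule ℝ E) (k : ℕ) : Set ℝ :=
  {t | (k : Cardinal) ≤ Module.rank ℝ (eigSpan K W (Set.Iic t))}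

/-- The `k`-th smallest eigenvalue, counted with multiplicity, of `⟪u, v⟫ = μ b(u, v)` in `W`. -/
def eigVal (K : E →L[ℝ] E) (W : Submodule ℝ E) (k : ℕ) : ℝ :=
  if k = 0 then 0 else sInf (levelSet K W k)

theorem nonneg_of_mem_levelSet (hK : IsSolutionOperator K) (hk : k ≠ 0)
    (h : t ∈ levelSet K W k) : 0 ≤ t := by
  by_contra hneg
  have h1 : eigSpan K W (Set.Iic t) = ⊥ := by
    rw [Submodule.eq_bot_iff]
    intro v hv
    by_contra h0
    have h2 := norm_sq_le_of_mem_eigSpan hK hv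
    have h3 := hK.pos v h0
    have h4 : 0 < ‖v‖ ^ 2 := by positivity
    nlinarith
  have h2 : (k : Cardinal) ≤ Module.rank ℝ (eigSpan K W (Set.Iic t)) := h
  rw [h1, rank_bot] at h2
  exact hk (by exact_mod_cast le_antisymm h2 zero_le)

theorem bddBelow_levelSet (hK : IsSolutionOperator K) (hk : k ≠ 0) :
    BddBelow (levelSet K W k) :=
  ⟨0, fun _ ht => nonneg_of_mem_levelSet hK hk ht⟩

theorem eigVal_nonneg (hK : IsSolutionOperator K) : 0 ≤ eigVal K W k := by
  unfold eigVal
  split_ifs with h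
  · exact le_rfl
  · exact Real.sInf_nonneg fun t ht => nonneg_of_mem_levelSet hK h ht

theorem eigVal_le (hK : IsSolutionOperator K) (hk : k ≠ 0) (h : t ∈ levelSet K W k) :
    eigVal K W k ≤ t := by
  rw [eigVal, if_neg hk]
  exact csInf_le (bddBelow_levelSet hK hk) h

theorem levelSet_nonempty_of_pos (h : 0 < eigVal K W k) : (levelSet K W k).Nonempty := by
  by_contra hne
  rw [Set.not_nonempty_iff_eq_empty] at hne
  rw [eigVal, hne, Real.sInf_empty] at h
  split_ifs at h <;> exact lt_irrefl _ h

theorem levelSet_antitone {k' : ℕ} (h : k ≤ k') : levelSet K W k' ⊆ levelSet K W k :=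
  fun _ ht => le_trans (α := Cardinal) (Nat.cast_le.2 h) ht

theorem mem_levelSet_of_le {t' : ℝ} (h : t ≤ t') (ht : t ∈ levelSet K W k) :
    t' ∈ levelSet K W k := by
  have h1 : (k : Cardinal) ≤ Module.rank ℝ (eigSpan K W (Set.Iic t)) := ht
  exact h1.trans (Submodule.rank_mono (eigSpan_mono (Set.Iic_subset_Iic.2 h)))

theorem mem_levelSet_of_eigVal_lt (hne : (levelSet K W k).Nonempty)
    (h : eigVal K W k < t) : t ∈ levelSet K W k := by
  by_cases hk : k = 0
  · subst hk; simp [levelSet]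
  rw [eigVal, if_neg hk] at h
  obtain ⟨t', ht', hlt⟩ := exists_lt_of_csInf_lt hne h
  exact mem_levelSet_of_le hlt.le ht'

theorem eigVal_mono (hK : IsSolutionOperator K) {k' : ℕ} (h : k ≤ k')
    (hne : (levelSet K W k').Nonempty) : eigVal K W k ≤ eigVal K W k' := by
  by_cases hk : k = 0
  · subst hk
    rw [eigVal, if_pos rfl]
    exact eigVal_nonneg hK
  have hk' : k' ≠ 0 := by omega
  rw [eigVal, if_neg hk, eigVal, if_neg hk']
  exact csInf_le_csInf (bddBelow_levelSet hK hk) hne (levelSet_antitone h)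

theorem eigVal_top_le [CompleteSpace E] (hK : IsSolutionOperator K)
    (hne : (levelSet K W k).Nonempty) : eigVal K ⊤ k ≤ eigVal K W k := by
  by_cases hk : k = 0
  · simp [eigVal, hk]
  conv_rhs => rw [eigVal, if_neg hk]
  refine le_csInf hne fun t' ht' => ?_
  refine le_of_forall_gt_imp_ge_of_dense fun t ht => eigVal_le hK hk ?_
  exact le_rank_eigSpan_top hK ht ht'

/-- Galerkin eigenvalues converge to the exact ones. -/
theorem exists_eigVal_close [CompleteSpace E] (hK : IsSolutionOperator K)
    (hne : (levelSet K ⊤ k).Nonempty) (hk : k ≠ 0) {ε : ℝ} (hε : 0 < ε) :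
    ∃ ρ₀ > 0, ∀ (W : Submodule ℝ E) [W.HasOrthogonalProjection],
      (∀ x, ‖K x - W.starProjection (K x)‖ ≤ ρ₀ * ‖x‖) →
      |eigVal K W k - eigVal K ⊤ k| ≤ ε := by
  have h1 : eigVal K ⊤ k + ε / 2 ∈ levelSet K ⊤ k :=
    mem_levelSet_of_eigVal_lt hne (by linarith)
  obtain ⟨ρ₀, hρ₀, h⟩ := exists_le_rank_eigSpan hK
    (show eigVal K ⊤ k + ε / 2 < eigVal K ⊤ k + ε by linarith) h1
  refine ⟨ρ₀, hρ₀, fun W _ hW => ?_⟩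
  have h2 : eigVal K ⊤ k + ε ∈ levelSet K W k := h W hW
  have h3 := eigVal_le hK hk h2
  have h4 := eigVal_top_le hK ⟨_, h2⟩
  rw [abs_le]
  constructor <;> linarith

end Eigenvalues

section Cluster

variable {K : E →L[ℝ] E}

theorem eigSpan_insert {A : Set ℝ} {μ : ℝ} :
    eigSpan K ⊤ (insert μ A) = eigSpan K ⊤ A ⊔ eigSub K ⊤ μ := by
  apply le_antisymm
  · refine Submodule.span_le.2 ?_
    rintro u ⟨ν, hν | hν, hu⟩
    · subst hν; exact Submodule.mem_sup_right hu
    · exact Submodule.mem_sup_left (eigSub_le_eigSpan hν hu)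
  · exact sup_le (eigSpan_mono (Set.subset_insert _ _)) (eigSub_le_eigSpan (Set.mem_insert _ _))

theorem finrank_eigSpan_insert (hK : IsSolutionOperator K) {A : Set ℝ} {μ : ℝ} (hμ : μ ∉ A)
    [FiniteDimensional ℝ (eigSpan K ⊤ (insert μ A))] :
    Module.finrank ℝ (eigSpan K ⊤ (insert μ A)) =
      Module.finrank ℝ (eigSpan K ⊤ A) + Module.finrank ℝ (eigSub K ⊤ μ) := by
  have hf1 : FiniteDimensional ℝ (eigSpan K ⊤ A) :=
    Submodule.finiteDimensional_of_le (eigSpan_mono (Set.subset_insert μ A))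
  have hf2 : FiniteDimensional ℝ (eigSub K ⊤ μ) :=
    Submodule.finiteDimensional_of_le (eigSub_le_eigSpan (Set.mem_insert μ A))
  have h := Submodule.finrank_sup_add_finrank_inf_eq (eigSpan K ⊤ A) (eigSub K ⊤ μ)
  have hinf : eigSpan K ⊤ A ⊓ eigSub K ⊤ μ = ⊥ := by
    rw [Submodule.eq_bot_iff]
    rintro v ⟨hv1, hv2⟩
    obtain ⟨f, hf1, hf2, hf3⟩ := exists_finsupp_of_mem_eigSpan hv1
    have : inner ℝ v v = 0 := by
      nth_rw 1 [← hf3]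
      rw [sum_inner]
      refine Finset.sum_eq_zero fun ν hν => ?_
      exact (inner_eq_zero_of_mem_eigSub hK (fun h : ν = μ => hμ (h ▸ hf1 ν hν)) (hf2 ν) hv2).1
    exact inner_self_eq_zero.1 this
  rw [hinf, finrank_bot, add_zero] at h
  rw [eigSpan_insert, h]

theorem finrank_eigSpan_union_image (hK : IsSolutionOperator K) {m : ℕ} {lam : Fin m → ℝ}
    (hlam : Function.Injective lam) {A : Set ℝ} (J : Finset (Fin m)) (hJ : ∀ j ∈ J, lam j ∉ A)
    (hfin : FiniteDimensional ℝ (eigSpan K ⊤ (A ∪ lam '' J))) :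
    Module.finrank ℝ (eigSpan K ⊤ (A ∪ lam '' J)) =
      Module.finrank ℝ (eigSpan K ⊤ A) + ∑ j ∈ J, Module.finrank ℝ (eigSub K ⊤ (lam j)) := by
  classical
  induction J using Finset.induction_on with
  | empty =>
    have h0 : A ∪ lam '' ((∅ : Finset (Fin m)) : Set (Fin m)) = A := by simp
    rw [h0, Finset.sum_empty, add_zero]
  | insert a J ha ih =>
    have hset : A ∪ lam '' (insert a J : Finset (Fin m)) = insert (lam a) (A ∪ lam '' J) := by
      rw [Finset.coe_insert, Set.image_insert_eq, Set.union_insert]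
    rw [hset] at hfin ⊢
    have hnot : lam a ∉ A ∪ lam '' (J : Set (Fin m)) := by
      rintro (h | ⟨b, hb, hab⟩)
      · exact hJ a (Finset.mem_insert_self _ _) h
      · exact ha (by rw [← hlam hab]; exact hb)
    rw [finrank_eigSpan_insert hK hnot, ih (fun j hj => hJ j (Finset.mem_insert_of_mem hj))
      (Submodule.finiteDimensional_of_le (eigSpan_mono (Set.subset_insert (lam a) _))),
      Finset.sum_insert ha]
    ring

/-- The abstract form of the assumptions on the eigenvalue cluster. -/
structure IsAbstractCluster (K : E →L[ℝ] E) (k₀ N m : ℕ) (lam : Fin m → ℝ) (q : Fin m → ℕ) :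
    Prop where
  gap_below : eigVal K ⊤ k₀ < eigVal K ⊤ (k₀ + 1)
  gap_above : eigVal K ⊤ (k₀ + N) < eigVal K ⊤ (k₀ + N + 1)
  strictMono : StrictMono lam
  values : Set.range lam = {μ | ∃ l, 1 ≤ l ∧ l ≤ N ∧ μ = eigVal K ⊤ (k₀ + l)}
  multiplicity : ∀ i, q i = Module.finrank ℝ (eigSub K ⊤ (lam i))
  total : N = ∑ i, q i

variable {k₀ N m : ℕ} {lam : Fin m → ℝ} {q : Fin m → ℕ}

theorem IsAbstractCluster.levelSet_nonempty (hK : IsSolutionOperator K)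
    (h : IsAbstractCluster K k₀ N m lam q) {k : ℕ} (hk : k ≤ k₀ + N + 1) :
    (levelSet K ⊤ k).Nonempty :=
  (levelSet_nonempty_of_pos ((eigVal_nonneg hK).trans_lt h.gap_above)).mono (levelSet_antitone hk)

theorem IsAbstractCluster.mem_Icc (hK : IsSolutionOperator K)
    (h : IsAbstractCluster K k₀ N m lam q) (i : Fin m) :
    eigVal K ⊤ (k₀ + 1) ≤ lam i ∧ lam i ≤ eigVal K ⊤ (k₀ + N) := by
  have h1 : lam i ∈ Set.range lam := ⟨i, rfl⟩
  rw [h.values] at h1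
  obtain ⟨l, hl1, hl2, hl⟩ := h1
  rw [hl]
  exact ⟨eigVal_mono hK (by omega) (h.levelSet_nonempty hK (by omega)),
    eigVal_mono hK (by omega) (h.levelSet_nonempty hK (by omega))⟩

theorem IsAbstractCluster.pos (hK : IsSolutionOperator K)
    (h : IsAbstractCluster K k₀ N m lam q) (i : Fin m) : 0 < lam i :=
  ((eigVal_nonneg hK).trans_lt h.gap_below).trans_le (h.mem_Icc hK i).1

/-- A level above the cluster and below the rest of the spectrum. -/
theorem IsAbstractCluster.exists_level (hK : IsSolutionOperator K)
    (h : IsAbstractCluster K k₀ N m lam q) : ∃ t, (∀ i, lam i ≤ t) ∧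
      FiniteDimensional ℝ (eigSpan K ⊤ (Set.Iic t)) ∧
      Module.finrank ℝ (eigSpan K ⊤ (Set.Iic t)) ≤ k₀ + N := by
  obtain ⟨t, ht1, ht2⟩ := exists_between h.gap_above
  have hlt : Module.rank ℝ (eigSpan K ⊤ (Set.Iic t)) < ((k₀ + N + 1 : ℕ) : Cardinal) := by
    by_contra hle
    exact absurd (eigVal_le hK (by omega) (not_lt.1 hle)) (not_le.2 ht2)
  have hfin := finiteDimensional_of_rank_lt_nat hlt
  refine ⟨t, fun i => (h.mem_Icc hK i).2.trans ht1.le, hfin, ?_⟩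
  rw [← Module.finrank_eq_rank] at hlt
  have : Module.finrank ℝ (eigSpan K ⊤ (Set.Iic t)) < k₀ + N + 1 := by exact_mod_cast hlt
  omega

theorem IsAbstractCluster.finiteDimensional (hK : IsSolutionOperator K)
    (h : IsAbstractCluster K k₀ N m lam q) (i : Fin m) :
    FiniteDimensional ℝ (eigSub K ⊤ (lam i)) := by
  obtain ⟨t, ht1, ht2, -⟩ := h.exists_level hK
  exact Submodule.finiteDimensional_of_le (eigSub_le_eigSpan (A := Set.Iic t) (ht1 i))

/-- The enumeration of the cluster by its distinct values and their multiplicities. -/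
theorem IsAbstractCluster.eigVal_eq (hK : IsSolutionOperator K)
    (h : IsAbstractCluster K k₀ N m lam q) (i : Fin m) {l : ℕ} (hl1 : offset q i < l)
    (hl2 : l ≤ offset q i + q i) : eigVal K ⊤ (k₀ + l) = lam i := by
  classical
  obtain ⟨t₁, ht₁, hfin, hrank⟩ := h.exists_level hK
  have hle : offset q i + q i + ∑ j ∈ Finset.univ.filter (i < ·), q j = N := by
    rw [h.total, offset, add_assoc, ← Finset.sum_filter_add_sum_filter_not Finset.univ (· < i)]
    congr 1
    have : Finset.univ.filter (fun j => ¬ j < i) = insert i (Finset.univ.filter (i < ·)) := by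
      ext j; simp [le_iff_eq_or_lt, eq_comm]
    rw [this, Finset.sum_insert (by simp)]
  have hlN : l ≤ N := by omega
  apply le_antisymm
  · -- below and including `lam i` there are at least `k₀ + offset q i + q i` eigenvalues
    refine eigVal_le hK (by omega) ?_
    obtain ⟨t₀, ht₀, ht₀'⟩ := exists_between h.gap_below
    have h0 : t₀ ∈ levelSet K ⊤ k₀ :=
      mem_levelSet_of_eigVal_lt (h.levelSet_nonempty hK (by omega)) ht₀
    set J : Finset (Fin m) := insert i (Finset.univ.filter (· < i)) with hJ
    have hJlam : ∀ j ∈ J, lam j ≤ lam i := by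
      intro j hj
      rcases Finset.mem_insert.1 hj with rfl | hj
      · exact le_rfl
      · exact (h.strictMono (by simpa using hj)).le
    have hsub : Set.Iic t₀ ∪ lam '' (J : Set (Fin m)) ⊆ Set.Iic (lam i) := by
      rintro x (hx | ⟨j, hj, rfl⟩)
      · exact (Set.mem_Iic.1 hx).trans (ht₀'.le.trans (h.mem_Icc hK i).1)
      · exact hJlam j hj
    have hfin1 : FiniteDimensional ℝ (eigSpan K ⊤ (Set.Iic (lam i))) :=
      Submodule.finiteDimensional_of_le (eigSpan_mono (Set.Iic_subset_Iic.2 (ht₁ i)))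
    have hfin2 : FiniteDimensional ℝ (eigSpan K ⊤ (Set.Iic t₀ ∪ lam '' (J : Set (Fin m)))) :=
      Submodule.finiteDimensional_of_le (eigSpan_mono hsub)
    have hfin3 : FiniteDimensional ℝ (eigSpan K ⊤ (Set.Iic t₀)) :=
      Submodule.finiteDimensional_of_le
        (eigSpan_mono (Set.subset_union_left (t := lam '' (J : Set (Fin m)))))
    have h1 := finrank_eigSpan_union_image hK h.strictMono.injective J (A := Set.Iic t₀)
      (fun j _ => not_le.2 (ht₀'.trans_le (h.mem_Icc hK j).1)) hfin2
    have h2 : k₀ ≤ Module.finrank ℝ (eigSpan K ⊤ (Set.Iic t₀)) := by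
      have h3 : (k₀ : Cardinal) ≤ Module.rank ℝ (eigSpan K ⊤ (Set.Iic t₀)) := h0
      rw [← Module.finrank_eq_rank] at h3
      exact_mod_cast h3
    have h4 := Submodule.finrank_mono (eigSpan_mono (K := K) (W := ⊤) hsub)
    simp only [← h.multiplicity] at h1
    rw [hJ, Finset.sum_insert (by simp)] at h1
    change _ = _ + (q i + offset q i) at h1
    have h5 : k₀ + l ≤ Module.finrank ℝ (eigSpan K ⊤ (Set.Iic (lam i))) := by
      rw [hJ] at h4; omega
    change ((k₀ + l : ℕ) : Cardinal) ≤ Module.rank ℝ (eigSpan K ⊤ (Set.Iic (lam i)))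
    rw [← Module.finrank_eq_rank]
    exact_mod_cast h5
  · -- strictly below `lam i` there are at most `k₀ + offset q i` eigenvalues
    by_contra hlt
    obtain ⟨t, ht, ht'⟩ := exists_between (not_le.1 hlt)
    have h0 : t ∈ levelSet K ⊤ (k₀ + l) :=
      mem_levelSet_of_eigVal_lt (h.levelSet_nonempty hK (by omega)) ht
    set J : Finset (Fin m) := insert i (Finset.univ.filter (i < ·)) with hJ
    have hJlam : ∀ j ∈ J, lam i ≤ lam j := by
      intro j hj
      rcases Finset.mem_insert.1 hj with rfl | hj
      · exact le_rfl
      · exact (h.strictMono (by simpa using hj)).le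
    have hsub : Set.Iic t ∪ lam '' (J : Set (Fin m)) ⊆ Set.Iic t₁ := by
      rintro x (hx | ⟨j, hj, rfl⟩)
      · exact (Set.mem_Iic.1 hx).trans (ht'.le.trans (ht₁ i))
      · exact ht₁ j
    have hfin2 : FiniteDimensional ℝ (eigSpan K ⊤ (Set.Iic t ∪ lam '' (J : Set (Fin m)))) :=
      Submodule.finiteDimensional_of_le (eigSpan_mono hsub)
    have hfin3 : FiniteDimensional ℝ (eigSpan K ⊤ (Set.Iic t)) :=
      Submodule.finiteDimensional_of_le
        (eigSpan_mono (Set.subset_union_left (t := lam '' (J : Set (Fin m)))))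
    have h1 := finrank_eigSpan_union_image hK h.strictMono.injective J (A := Set.Iic t)
      (fun j hj => not_le.2 (ht'.trans_le (hJlam j hj))) hfin2
    have h2 : k₀ + l ≤ Module.finrank ℝ (eigSpan K ⊤ (Set.Iic t)) := by
      have h3 : ((k₀ + l : ℕ) : Cardinal) ≤ Module.rank ℝ (eigSpan K ⊤ (Set.Iic t)) := h0
      rw [← Module.finrank_eq_rank] at h3
      exact_mod_cast h3
    have h4 := Submodule.finrank_mono (eigSpan_mono (K := K) (W := ⊤) hsub)
    simp only [← h.multiplicity] at h1
    rw [hJ, Finset.sum_insert (by simp)] at h1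
    rw [hJ] at h4
    omega

end Cluster

end Abstract

end Planewave

namespace Planewave

/-! ### Fourier series on the periodicity cell -/

section Torus

/-- Haar probability measure on the circle, the normalisation of the multivariate Fourier series. -/
local instance circleMeasureSpace : MeasureSpace UnitAddCircle := ⟨AddCircle.haarAddCircle⟩

local instance circleProbability : IsProbabilityMeasure (volume : Measure UnitAddCircle) :=
  inferInstanceAs (IsProbabilityMeasure AddCircle.haarAddCircle)

variable {d : ℕ}

/-- The projection of `ℝ^d` onto the torus `(ℝ / ℤ)^d`, after scaling by `2π`. -/
def toTorus (x : Fin d → ℝ) : UnitAddTorus (Fin d) :=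
  fun i => ((x i / (2 * Real.pi) : ℝ) : UnitAddCircle)

/-- The inverse of `toTorus` on the cell. -/
def ofTorus (t : UnitAddTorus (Fin d)) : Fin d → ℝ :=
  fun i => 2 * Real.pi * (AddCircle.equivIco 1 0 (t i) : ℝ)

theorem toTorus_ofTorus (t : UnitAddTorus (Fin d)) : toTorus (ofTorus t) = t := by
  ext i
  have : 2 * Real.pi * (AddCircle.equivIco 1 0 (t i) : ℝ) / (2 * Real.pi) =
      (AddCircle.equivIco 1 0 (t i) : ℝ) := by field_simp
  simp only [toTorus, ofTorus, this]
  exact AddCircle.coe_equivIco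

theorem ofTorus_toTorus {x : Fin d → ℝ} (hx : x ∈ cell d) : ofTorus (toTorus x) = x := by
  ext i
  have h := hx i trivial
  have hpi := Real.pi_pos
  have h1 : x i / (2 * Real.pi) ∈ Set.Ico (0 : ℝ) (0 + 1) := by
    constructor
    · exact div_nonneg h.1 (by positivity)
    · rw [zero_add, div_lt_one (by positivity)]; exact h.2
  simp only [toTorus, ofTorus]
  rw [AddCircle.equivIco_coe_of_mem h1]
  field_simp

theorem measurable_toTorus : Measurable (toTorus (d := d)) :=
  measurable_pi_lambda _ fun i =>
    AddCircle.measurable_mk'.comp ((measurable_pi_apply i).div_const _)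

theorem measurable_ofTorus : Measurable (ofTorus (d := d)) :=
  measurable_pi_lambda _ fun i => (measurable_subtype_coe.comp
    ((AddCircle.measurableEquivIco 1 0).measurable.comp (measurable_pi_apply i))).const_mul _

/-- The volume of the periodicity cell. -/
def cellVolume (d : ℕ) : ENNReal := ENNReal.ofReal (2 * Real.pi) ^ d

theorem measurePreserving_toTorus :
    MeasurePreserving toTorus (cellMeasure d)
      (cellVolume d • (volume : Measure (UnitAddTorus (Fin d)))) := by
  have hpi : (0 : ℝ) < 2 * Real.pi := by positivity
  have h1 : MeasurePreserving (fun x : ℝ => ((x / (2 * Real.pi) : ℝ) : UnitAddCircle))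
      (volume.restrict (Set.Ico 0 (2 * Real.pi)))
      (ENNReal.ofReal (2 * Real.pi) • (volume : Measure UnitAddCircle)) := by
    have e1 : MeasurePreserving (fun x : ℝ => x / (2 * Real.pi))
        (volume.restrict (Set.Ico 0 (2 * Real.pi)))
        (ENNReal.ofReal (2 * Real.pi) • volume.restrict (Set.Ico 0 1)) := by
      have hm : Measurable (fun x : ℝ => x / (2 * Real.pi)) := measurable_id.div_const _
      refine ⟨hm, ?_⟩
      have e2 : Set.Ico 0 (2 * Real.pi) = (fun x : ℝ => x / (2 * Real.pi)) ⁻¹' Set.Ico 0 1 := by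
        ext x
        simp only [Set.mem_Ico, Set.mem_preimage, div_lt_one hpi]
        rw [le_div_iff₀ hpi, zero_mul]
      rw [e2, ← Measure.restrict_map hm measurableSet_Ico]
      have e3 : (fun x : ℝ => x / (2 * Real.pi)) = (· * (2 * Real.pi)⁻¹) := by
        ext x; rw [div_eq_mul_inv]
      rw [e3, Real.map_volume_mul_right (inv_ne_zero hpi.ne'), inv_inv, abs_of_pos hpi,
        Measure.restrict_smul]
    have e4 : MeasurePreserving (fun x : ℝ => (x : UnitAddCircle))
        (volume.restrict (Set.Ico (0 : ℝ) 1)) AddCircle.haarAddCircle := by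
      have := UnitAddCircle.measurePreserving_mk 0
      rw [zero_add, AddCircle.volume_eq_smul_haarAddCircle, ENNReal.ofReal_one, one_smul] at this
      rwa [Measure.restrict_congr_set Ico_ae_eq_Ioc]
    exact (e4.smul_measure _).comp e1
  have hfin : IsFiniteMeasure (ENNReal.ofReal (2 * Real.pi) • (volume : Measure UnitAddCircle)) :=
    Measure.smul_finite _ ENNReal.ofReal_ne_top
  have h2 := measurePreserving_pi (fun _ : Fin d => volume.restrict (Set.Ico 0 (2 * Real.pi)))
    (fun _ : Fin d => ENNReal.ofReal (2 * Real.pi) • (volume : Measure UnitAddCircle))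
    (fun _ => h1)
  have h3 : Measure.pi (fun _ : Fin d => volume.restrict (Set.Ico 0 (2 * Real.pi))) =
      cellMeasure d := by
    rw [cellMeasure, cell, volume_pi, Measure.restrict_pi_pi]
  have h4 : Measure.pi (fun _ : Fin d =>
      ENNReal.ofReal (2 * Real.pi) • (volume : Measure UnitAddCircle)) =
      cellVolume d • (volume : Measure (UnitAddTorus (Fin d))) := by
    refine Measure.pi_eq fun s _ => ?_
    rw [Measure.smul_apply, volume_pi, Measure.pi_pi]
    simp [Measure.smul_apply, Finset.prod_mul_distrib, cellVolume]
  rw [h3, h4] at h2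
  exact h2

theorem cellVolume_ne_top : cellVolume d ≠ ⊤ := ENNReal.pow_ne_top ENNReal.ofReal_ne_top

theorem cellVolume_ne_zero : cellVolume d ≠ 0 :=
  pow_ne_zero _ (by have := Real.pi_pos; rw [Ne, ENNReal.ofReal_eq_zero]; linarith)

theorem cellVolume_toReal : (cellVolume d).toReal = (2 * Real.pi) ^ d := by
  rw [cellVolume, ENNReal.toReal_pow, ENNReal.toReal_ofReal (by positivity)]

theorem ae_mem_cell : ∀ᵐ x ∂(cellMeasure d), x ∈ cell d :=
  ae_restrict_mem (MeasurableSet.univ_pi fun _ => measurableSet_Ico)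

theorem measurePreserving_ofTorus :
    MeasurePreserving ofTorus (cellVolume d • (volume : Measure (UnitAddTorus (Fin d))))
      (cellMeasure d) := by
  refine ⟨measurable_ofTorus, ?_⟩
  rw [← measurePreserving_toTorus.map_eq, Measure.map_map measurable_ofTorus measurable_toTorus]
  have : ofTorus ∘ toTorus =ᵐ[cellMeasure d] id := by
    filter_upwards [ae_mem_cell] with x hx
    exact ofTorus_toTorus hx
  rw [Measure.map_congr this, Measure.map_id]

instance : IsFiniteMeasure (cellMeasure d) :=
  ⟨by
    rw [← measurePreserving_ofTorus.map_eq, Measure.map_apply measurable_ofTorus MeasurableSet.univ,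
      Set.preimage_univ, Measure.smul_apply, measure_univ, smul_eq_mul, mul_one]
    exact cellVolume_ne_top.lt_top⟩

theorem planeWave_eq (G : Fin d → ℤ) (x : Fin d → ℝ) :
    planeWave G x = (((2 * Real.pi) ^ (-(d : ℝ) / 2) : ℝ) : ℂ) *
      UnitAddTorus.mFourier G (toTorus x) := by
  rw [planeWave]
  congr 1
  change _ = ∏ i, fourier (G i) (toTorus x i)
  simp only [toTorus, fourier_coe_apply]
  rw [← Complex.exp_sum]
  congr 1
  push_cast
  rw [Finset.mul_sum]
  refine Finset.sum_congr rfl fun i _ => ?_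
  have : (Real.pi : ℂ) ≠ 0 := by exact_mod_cast Real.pi_ne_zero
  field_simp

theorem memLp_comp_ofTorus {f : (Fin d → ℝ) → ℂ} (hf : MemLp f 2 (cellMeasure d)) :
    MemLp (f ∘ ofTorus) 2 (volume : Measure (UnitAddTorus (Fin d))) := by
  have h1 := hf.comp_measurePreserving measurePreserving_ofTorus
  have h2 := h1.smul_measure (c := (cellVolume d)⁻¹) (ENNReal.inv_ne_top.2 cellVolume_ne_zero)
  rwa [smul_smul, ENNReal.inv_mul_cancel cellVolume_ne_zero cellVolume_ne_top, one_smul] at h2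

theorem memLp_comp_toTorus {g : UnitAddTorus (Fin d) → ℂ}
    (hg : MemLp g 2 (volume : Measure (UnitAddTorus (Fin d)))) :
    MemLp (g ∘ toTorus) 2 (cellMeasure d) :=
  (hg.smul_measure cellVolume_ne_top).comp_measurePreserving measurePreserving_toTorus

theorem integral_cell_eq {F : Type*} [NormedAddCommGroup F] [NormedSpace ℝ F]
    {f : (Fin d → ℝ) → F} (hf : AEStronglyMeasurable f (cellMeasure d)) :
    ∫ x, f x ∂(cellMeasure d) =
      ((2 * Real.pi) ^ d : ℝ) • ∫ t : UnitAddTorus (Fin d), f (ofTorus t) := by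
  have h := measurePreserving_ofTorus (d := d)
  rw [← h.map_eq] at hf
  conv_lhs => rw [← h.map_eq]
  rw [integral_map h.measurable.aemeasurable hf, integral_smul_measure, cellVolume_toReal]

/-- The Fourier coefficient `(e_G, f)` of a complex function on the cell. -/
def cellCoeff (f : (Fin d → ℝ) → ℂ) (G : Fin d → ℤ) : ℂ :=
  ∫ x, (starRingEnd ℂ) (planeWave G x) * f x ∂(cellMeasure d)

theorem boxFourierCoeff_eq_cellCoeff (f : (Fin d → ℝ) → ℝ) (G : Fin d → ℤ) :
    boxFourierCoeff f G = cellCoeff (fun x => (f x : ℂ)) G := rfl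

theorem continuous_planeWave (G : Fin d → ℤ) : Continuous (planeWave G) := by
  unfold planeWave; fun_prop

theorem norm_planeWave_le (G : Fin d → ℤ) (x : Fin d → ℝ) :
    ‖planeWave G x‖ ≤ (2 * Real.pi) ^ (-(d : ℝ) / 2) := by
  have hp : (0 : ℝ) < 2 * Real.pi := by positivity
  rw [planeWave, norm_mul, mul_comm Complex.I, Complex.norm_exp_ofReal_mul_I, mul_one,
    Complex.norm_real, Real.norm_of_nonneg (by positivity)]

theorem memLp_planeWave (G : Fin d → ℤ) : MemLp (planeWave G) 2 (cellMeasure d) :=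
  MemLp.of_bound (continuous_planeWave G).aestronglyMeasurable _
    (Filter.Eventually.of_forall (norm_planeWave_le G))

theorem integrable_conj_planeWave_mul {f : (Fin d → ℝ) → ℂ} (hf : MemLp f 2 (cellMeasure d))
    (G : Fin d → ℤ) :
    Integrable (fun x => (starRingEnd ℂ) (planeWave G x) * f x) (cellMeasure d) := by
  refine Integrable.bdd_mul (c := (2 * Real.pi) ^ (-(d : ℝ) / 2)) (hf.integrable one_le_two)
    (Complex.continuous_conj.comp (continuous_planeWave G)).aestronglyMeasurable
    (Filter.Eventually.of_forall fun x => ?_)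
  rw [RCLike.norm_conj]
  exact norm_planeWave_le G x

theorem cellCoeff_eq {f : (Fin d → ℝ) → ℂ} (hf : MemLp f 2 (cellMeasure d)) (G : Fin d → ℤ) :
    cellCoeff f G = (((2 * Real.pi) ^ ((d : ℝ) / 2) : ℝ) : ℂ) *
      UnitAddTorus.mFourierCoeff (f ∘ ofTorus) G := by
  have hp : (0 : ℝ) < 2 * Real.pi := by positivity
  rw [cellCoeff, integral_cell_eq (integrable_conj_planeWave_mul hf G).aestronglyMeasurable]
  have h1 : ∀ t : UnitAddTorus (Fin d), (starRingEnd ℂ) (planeWave G (ofTorus t)) * f (ofTorus t) =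
      (((2 * Real.pi) ^ (-(d : ℝ) / 2) : ℝ) : ℂ) *
        (UnitAddTorus.mFourier (-G) t • (f ∘ ofTorus) t) := by
    intro t
    rw [planeWave_eq, toTorus_ofTorus, map_mul, Complex.conj_ofReal, UnitAddTorus.mFourier_neg,
      smul_eq_mul, mul_assoc]
    rfl
  simp only [h1]
  rw [integral_const_mul, UnitAddTorus.mFourierCoeff, Complex.real_smul, ← mul_assoc]
  congr 1
  rw [← Complex.ofReal_mul]
  congr 1
  rw [← Real.rpow_natCast, ← Real.rpow_add hp]
  congr 1; ring

/-- **Parseval's identity** on the cell. -/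
theorem hasSum_norm_sq_cellCoeff {f : (Fin d → ℝ) → ℂ} (hf : MemLp f 2 (cellMeasure d)) :
    HasSum (fun G => ‖cellCoeff f G‖ ^ 2) (∫ x, ‖f x‖ ^ 2 ∂(cellMeasure d)) := by
  have hp : (0 : ℝ) < 2 * Real.pi := by positivity
  set F := (memLp_comp_ofTorus hf).toLp (f ∘ ofTorus) with hF
  have hFae : F =ᵐ[volume] f ∘ ofTorus := MemLp.coeFn_toLp _
  have h1 := UnitAddTorus.hasSum_sq_mFourierCoeff F
  have h2 : ∀ G, UnitAddTorus.mFourierCoeff F G =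
      UnitAddTorus.mFourierCoeff (f ∘ ofTorus) G := fun G =>
    integral_congr_ae (by filter_upwards [hFae] with t ht; rw [ht])
  have h3 : ∫ t, ‖F t‖ ^ 2 = ∫ t, ‖f (ofTorus t)‖ ^ 2 :=
    integral_congr_ae (by filter_upwards [hFae] with t ht; rw [ht]; rfl)
  simp only [h2] at h1
  rw [h3] at h1
  rw [integral_cell_eq (f := fun x => ‖f x‖ ^ 2) (hf.aestronglyMeasurable.norm.pow 2)]
  refine (h1.mul_left ((2 * Real.pi) ^ d : ℝ)).congr_fun fun G => ?_
  rw [cellCoeff_eq hf, norm_mul, mul_pow, Complex.norm_real, Real.norm_of_nonneg (by positivity)]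
  congr 1
  rw [← Real.rpow_natCast, ← Real.rpow_mul hp.le, ← Real.rpow_natCast]
  congr 1; push_cast; ring

/-- **Riesz–Fischer** on the cell. -/
theorem exists_cellCoeff_eq {c : (Fin d → ℤ) → ℂ} (hc : Summable fun G => ‖c G‖ ^ 2) :
    ∃ f : (Fin d → ℝ) → ℂ, MemLp f 2 (cellMeasure d) ∧ ∀ G, cellCoeff f G = c G := by
  have hp : (0 : ℝ) < 2 * Real.pi := by positivity
  set a : ℂ := (((2 * Real.pi) ^ ((d : ℝ) / 2) : ℝ) : ℂ) with ha
  have ha0 : a ≠ 0 := by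
    rw [ha, Complex.ofReal_ne_zero]
    exact (Real.rpow_pos_of_pos hp _).ne'
  have hc' : Memℓp (fun G => a⁻¹ * c G) 2 := by
    refine memℓp_gen ?_
    simp only [ENNReal.toReal_ofNat, Real.rpow_ofNat, norm_mul, mul_pow]
    exact hc.mul_left _
  let y : lp (fun _ : Fin d → ℤ => ℂ) 2 := ⟨_, hc'⟩
  set g := (UnitAddTorus.mFourierBasis (d := Fin d)).repr.symm y with hg
  have hgm : MemLp g 2 (volume : Measure (UnitAddTorus (Fin d))) := Lp.memLp g
  refine ⟨g ∘ toTorus, memLp_comp_toTorus hgm, fun G => ?_⟩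
  rw [cellCoeff_eq (memLp_comp_toTorus hgm)]
  have h1 : (⇑g ∘ toTorus) ∘ ofTorus = g := by
    ext t; simp only [Function.comp_apply, toTorus_ofTorus]
  rw [h1, ← UnitAddTorus.mFourierBasis_repr, hg, LinearIsometryEquiv.apply_symm_apply]
  change a * (a⁻¹ * c G) = c G
  rw [mul_inv_cancel_left₀ ha0]

theorem cellCoeff_planeWave (G G' : Fin d → ℤ) :
    cellCoeff (planeWave G') G = if G = G' then 1 else 0 := by
  have hp : (0 : ℝ) < 2 * Real.pi := by positivity
  rw [cellCoeff_eq (memLp_planeWave G')]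
  have h1 : planeWave G' ∘ ofTorus = fun t : UnitAddTorus (Fin d) =>
      (((2 * Real.pi) ^ (-(d : ℝ) / 2) : ℝ) : ℂ) * UnitAddTorus.mFourier G' t := by
    ext t; rw [Function.comp_apply, planeWave_eq, toTorus_ofTorus]
  have h2 : UnitAddTorus.mFourierCoeff (UnitAddTorus.mFourier G') G =
      if G = G' then (1 : ℂ) else 0 := by
    rw [← UnitAddTorus.mFourierCoeff_toLp, ← UnitAddTorus.mFourierBasis_repr]
    change UnitAddTorus.mFourierBasis.repr (UnitAddTorus.mFourierLp 2 G') G = _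
    rw [← UnitAddTorus.coe_mFourierBasis, HilbertBasis.repr_self, lp.single_apply, Pi.single_apply]
  have h3 : UnitAddTorus.mFourierCoeff (planeWave G' ∘ ofTorus) G =
      (((2 * Real.pi) ^ (-(d : ℝ) / 2) : ℝ) : ℂ) *
        UnitAddTorus.mFourierCoeff (UnitAddTorus.mFourier G') G := by
    rw [h1, UnitAddTorus.mFourierCoeff, UnitAddTorus.mFourierCoeff, ← integral_const_mul]
    refine integral_congr_ae (Filter.Eventually.of_forall fun t => ?_)
    simp only [smul_eq_mul]; ring
  rw [h3, h2, ← mul_assoc, ← Complex.ofReal_mul, ← Real.rpow_add hp]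
  have : (d : ℝ) / 2 + -(d : ℝ) / 2 = 0 := by ring
  rw [this, Real.rpow_zero, Complex.ofReal_one, one_mul]

end Torus

end Planewave

namespace Planewave

variable {d : ℕ}

section RealFourier

theorem memLp_ofReal (u : L2p d) : MemLp (fun x => ((u x : ℝ) : ℂ)) 2 (cellMeasure d) :=
  (Lp.memLp u).ofReal

theorem boxFourierCoeff_congr {f g : (Fin d → ℝ) → ℝ} (h : f =ᵐ[cellMeasure d] g) (G : Fin d → ℤ) :
    boxFourierCoeff f G = boxFourierCoeff g G :=
  integral_congr_ae (by filter_upwards [h] with x hx; rw [hx])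

theorem boxFourierCoeff_add {f g : (Fin d → ℝ) → ℝ} (hf : MemLp f 2 (cellMeasure d))
    (hg : MemLp g 2 (cellMeasure d)) (G : Fin d → ℤ) :
    boxFourierCoeff (f + g) G = boxFourierCoeff f G + boxFourierCoeff g G := by
  have h1 : ∀ x, (starRingEnd ℂ) (planeWave G x) * ((f + g) x : ℂ) =
      (starRingEnd ℂ) (planeWave G x) * (f x : ℂ) +
        (starRingEnd ℂ) (planeWave G x) * (g x : ℂ) := by
    intro x; push_cast [Pi.add_apply]; ring
  rw [boxFourierCoeff]
  simp only [h1]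
  exact integral_add (integrable_conj_planeWave_mul hf.ofReal G)
    (integrable_conj_planeWave_mul hg.ofReal G)

theorem boxFourierCoeff_const_smul (a : ℝ) (f : (Fin d → ℝ) → ℝ) (G : Fin d → ℤ) :
    boxFourierCoeff (a • f) G = a * boxFourierCoeff f G := by
  rw [boxFourierCoeff, boxFourierCoeff, ← integral_const_mul]
  refine integral_congr_ae (Filter.Eventually.of_forall fun x => ?_)
  simp only [Pi.smul_apply, smul_eq_mul]; push_cast; ring

theorem planeWave_neg (G : Fin d → ℤ) (x : Fin d → ℝ) :
    planeWave (-G) x = (starRingEnd ℂ) (planeWave G x) := by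
  rw [planeWave, planeWave, map_mul, Complex.conj_ofReal, ← Complex.exp_conj, map_mul,
    Complex.conj_I, Complex.conj_ofReal]
  congr 2
  simp only [Pi.neg_apply, Int.cast_neg, neg_mul, Finset.sum_neg_distrib]
  push_cast; ring

theorem boxFourierCoeff_neg_index (f : (Fin d → ℝ) → ℝ) (G : Fin d → ℤ) :
    boxFourierCoeff f (-G) = (starRingEnd ℂ) (boxFourierCoeff f G) := by
  rw [boxFourierCoeff, boxFourierCoeff, ← integral_conj]
  refine integral_congr_ae (Filter.Eventually.of_forall fun x => ?_)
  simp only [map_mul, Complex.conj_ofReal, planeWave_neg]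

theorem fc_add (u v : L2p d) (G : Fin d → ℤ) :
    boxFourierCoeff (u + v : L2p d) G = boxFourierCoeff u G + boxFourierCoeff v G := by
  rw [boxFourierCoeff_congr (Lp.coeFn_add u v)]
  exact boxFourierCoeff_add (Lp.memLp u) (Lp.memLp v) G

theorem fc_smul (a : ℝ) (u : L2p d) (G : Fin d → ℤ) :
    boxFourierCoeff (a • u : L2p d) G = a * boxFourierCoeff u G := by
  rw [boxFourierCoeff_congr (Lp.coeFn_smul a u)]
  exact boxFourierCoeff_const_smul a u G

theorem fc_sub (u v : L2p d) (G : Fin d → ℤ) :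
    boxFourierCoeff (u - v : L2p d) G = boxFourierCoeff u G - boxFourierCoeff v G := by
  have h : u - v = u + (-1 : ℝ) • v := by rw [neg_one_smul, sub_eq_add_neg]
  rw [h, fc_add, fc_smul]; push_cast; ring

theorem fc_zero (G : Fin d → ℤ) : boxFourierCoeff (0 : L2p d) G = 0 := by
  have := fc_smul (0 : ℝ) (0 : L2p d) G
  simpa using this

theorem integral_sq_eq_norm_sq (u : L2p d) : ∫ x, u x ^ 2 ∂(cellMeasure d) = ‖u‖ ^ 2 := by
  rw [← real_inner_self_eq_norm_sq, L2.inner_def]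
  refine integral_congr_ae (Filter.Eventually.of_forall fun x => ?_)
  simp [sq]

theorem hasSum_norm_sq_fc (u : L2p d) :
    HasSum (fun G => ‖boxFourierCoeff u G‖ ^ 2) (‖u‖ ^ 2) := by
  have h := hasSum_norm_sq_cellCoeff (memLp_ofReal u)
  simp only [Complex.norm_real, Real.norm_eq_abs, sq_abs] at h
  rwa [integral_sq_eq_norm_sq] at h

theorem re_conj_mul_eq (a b : ℂ) :
    ((starRingEnd ℂ) a * b).re = (‖a + b‖ ^ 2 - ‖a - b‖ ^ 2) / 4 := by
  rw [Complex.sq_norm, Complex.sq_norm, Complex.normSq_apply, Complex.normSq_apply]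
  simp; ring

theorem hasSum_inner_fc (u v : L2p d) :
    HasSum (fun G => ((starRingEnd ℂ) (boxFourierCoeff u G) * boxFourierCoeff v G).re)
      (inner ℝ u v) := by
  have h := ((hasSum_norm_sq_fc (u + v)).sub (hasSum_norm_sq_fc (u - v))).div_const 4
  have h2 : (‖u + v‖ ^ 2 - ‖u - v‖ ^ 2) / 4 = inner ℝ u v := by
    rw [norm_add_sq_real, norm_sub_sq_real]; ring
  rw [h2] at h
  refine h.congr_fun fun G => ?_
  rw [re_conj_mul_eq, fc_add, fc_sub]

theorem fc_injective {u v : L2p d} (h : ∀ G, boxFourierCoeff u G = boxFourierCoeff v G) :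
    u = v := by
  have h1 := hasSum_norm_sq_fc (u - v)
  have h2 : (fun G => ‖boxFourierCoeff (u - v : L2p d) G‖ ^ 2) = fun _ => 0 := by
    ext G; rw [fc_sub, h G]; simp
  rw [h2] at h1
  have h3 := h1.unique hasSum_zero
  rw [sq_eq_zero_iff, norm_eq_zero, sub_eq_zero] at h3
  exact h3

/-- Every square summable family with the symmetry of real functions consists of the Fourier
coefficients of a real function. -/
theorem exists_fc_eq {c : (Fin d → ℤ) → ℂ} (hc : Summable fun G => ‖c G‖ ^ 2)
    (hsymm : ∀ G, c (-G) = (starRingEnd ℂ) (c G)) :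
    ∃ u : L2p d, ∀ G, boxFourierCoeff u G = c G := by
  obtain ⟨f, hf, hfc⟩ := exists_cellCoeff_eq hc
  have hre : MemLp (fun x => (f x).re) 2 (cellMeasure d) := hf.re
  refine ⟨hre.toLp _, fun G => ?_⟩
  rw [boxFourierCoeff_congr (MemLp.coeFn_toLp hre)]
  have hI : ∀ G, boxFourierCoeff (fun x => (f x).re) G =
      (cellCoeff f G + (starRingEnd ℂ) (cellCoeff f (-G))) / 2 := by
    intro G
    have h1 : (starRingEnd ℂ) (cellCoeff f (-G)) =
        ∫ x, (starRingEnd ℂ) (planeWave G x) * (starRingEnd ℂ) (f x) ∂(cellMeasure d) := by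
      rw [cellCoeff, ← integral_conj]
      refine integral_congr_ae (Filter.Eventually.of_forall fun x => ?_)
      simp only [map_mul, planeWave_neg, Complex.conj_conj]
    have h2 : MemLp (fun x => (starRingEnd ℂ) (f x)) 2 (cellMeasure d) := hf.star
    rw [h1, cellCoeff, ← integral_add (integrable_conj_planeWave_mul hf G)
      (integrable_conj_planeWave_mul h2 G), boxFourierCoeff, ← integral_div]
    refine integral_congr_ae (Filter.Eventually.of_forall fun x => ?_)
    have h3 := Complex.add_conj (f x)
    simp only
    rw [← mul_add, h3]
    push_cast; ring
  rw [hI, hfc, hfc, hsymm, Complex.conj_conj]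
  ring

end RealFourier

/-! ### The Sobolev space of order one and the energy form -/

section Energy

theorem normSq_nonneg (G : Fin d → ℤ) : 0 ≤ normSq G := Finset.sum_nonneg fun _ _ => sq_nonneg _

theorem normSq_neg (G : Fin d → ℤ) : normSq (-G) = normSq G := by simp [normSq]

theorem mem_H1p_iff {u : L2p d} :
    u ∈ H1p d ↔ Summable fun G => (1 + normSq G) * ‖boxFourierCoeff u G‖ ^ 2 := by
  simp only [H1p, MemSobolev, Set.mem_ofPred_eq, Real.rpow_one]
  exact ⟨fun h => h.1, fun h => ⟨h, fun G => boxFourierCoeff_neg_index _ G⟩⟩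

theorem norm_add_sq_le (a b : ℂ) : ‖a + b‖ ^ 2 ≤ 2 * ‖a‖ ^ 2 + 2 * ‖b‖ ^ 2 := by
  have h := norm_add_le a b
  have h1 : ‖a + b‖ ^ 2 ≤ (‖a‖ + ‖b‖) ^ 2 := by gcongr
  nlinarith [sq_nonneg (‖a‖ - ‖b‖)]

/-- `H_p^1` as a subspace of `L_p^2`. -/
def H1sub (d : ℕ) : Submodule ℝ (L2p d) where
  carrier := H1p d
  zero_mem' := by rw [mem_H1p_iff]; simp only [fc_zero]; simp
  add_mem' := by
    intro u v hu hv
    rw [mem_H1p_iff] at *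
    refine Summable.of_nonneg_of_le (fun G => ?_) (fun G => ?_)
      ((hu.mul_left 2).add (hv.mul_left 2))
    · have := normSq_nonneg G; positivity
    · have := normSq_nonneg G
      rw [fc_add]
      have h := norm_add_sq_le (boxFourierCoeff u G) (boxFourierCoeff v G)
      nlinarith [mul_le_mul_of_nonneg_left h (show 0 ≤ 1 + normSq G by linarith)]
  smul_mem' := by
    intro a u hu
    change a • u ∈ H1p d
    rw [mem_H1p_iff] at *
    refine (hu.mul_left (a ^ 2)).congr fun G => ?_
    rw [fc_smul, norm_mul, Complex.norm_real, mul_pow, Real.norm_eq_abs, sq_abs]; ring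

/-- The squared `H_p^1` norm. -/
def h1Sq (u : L2p d) : ℝ := ∑' G, (1 + normSq G) * ‖boxFourierCoeff u G‖ ^ 2

theorem summable_normSq_mul {u : L2p d} (hu : u ∈ H1p d) :
    Summable fun G => normSq G * ‖boxFourierCoeff u G‖ ^ 2 := by
  refine Summable.of_nonneg_of_le (fun G => ?_) (fun G => ?_) (mem_H1p_iff.1 hu)
  · have := normSq_nonneg G; positivity
  · nlinarith [sq_nonneg ‖boxFourierCoeff u G‖]

theorem h1Sq_eq {u : L2p d} (hu : u ∈ H1p d) :
    h1Sq u = ∑' G, normSq G * ‖boxFourierCoeff u G‖ ^ 2 + ‖u‖ ^ 2 := by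
  rw [← (hasSum_norm_sq_fc u).tsum_eq, ← (summable_normSq_mul hu).tsum_add
    (hasSum_norm_sq_fc u).summable]
  exact tsum_congr fun G => by ring

theorem abs_re_conj_mul_le (a b : ℂ) : |((starRingEnd ℂ) a * b).re| ≤ ‖a‖ ^ 2 + ‖b‖ ^ 2 := by
  refine (Complex.abs_re_le_norm _).trans ?_
  rw [norm_mul, RCLike.norm_conj]
  nlinarith [sq_nonneg (‖a‖ - ‖b‖), sq_nonneg ‖a‖, sq_nonneg ‖b‖]

theorem summable_gradient {u v : L2p d} (hu : u ∈ H1p d) (hv : v ∈ H1p d) :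
    Summable fun G => normSq G *
      ((starRingEnd ℂ) (boxFourierCoeff u G) * boxFourierCoeff v G).re := by
  refine Summable.of_norm_bounded ((summable_normSq_mul hu).add (summable_normSq_mul hv))
    fun G => ?_
  rw [norm_mul, Real.norm_of_nonneg (normSq_nonneg G), ← mul_add]
  exact mul_le_mul_of_nonneg_left (abs_re_conj_mul_le _ _) (normSq_nonneg G)

/-- The assumptions on the potential. -/
structure IsPotential (V : L2p d) (νlow νup : ℝ) : Prop where
  pos : 0 < νlow
  low : ∀ᵐ x ∂(cellMeasure d), νlow ≤ V x
  up : ∀ᵐ x ∂(cellMeasure d), V x ≤ νup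

variable {V : L2p d} {νlow νup : ℝ}

theorem IsPotential.bound (h : IsPotential V νlow νup) :
    ∀ᵐ x ∂(cellMeasure d), ‖V x‖ ≤ νup := by
  filter_upwards [h.low, h.up] with x h1 h2
  rw [Real.norm_of_nonneg (h.pos.le.trans h1)]
  exact h2

theorem IsPotential.memLp_mul (h : IsPotential V νlow νup) (u : L2p d) :
    MemLp (fun x => V x * u x) 2 (cellMeasure d) := by
  refine MemLp.of_le_mul (c := νup) (Lp.memLp u)
    ((Lp.memLp V).aestronglyMeasurable.mul (Lp.memLp u).aestronglyMeasurable) ?_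
  filter_upwards [h.bound] with x hx
  rw [norm_mul]
  exact mul_le_mul_of_nonneg_right hx (norm_nonneg _)

/-- The product `V u`. -/
def IsPotential.mul (h : IsPotential V νlow νup) (u : L2p d) : L2p d := (h.memLp_mul u).toLp _

theorem IsPotential.coe_mul (h : IsPotential V νlow νup) (u : L2p d) :
    h.mul u =ᵐ[cellMeasure d] fun x => V x * u x := MemLp.coeFn_toLp _

theorem IsPotential.integral_eq (h : IsPotential V νlow νup) (u v : L2p d) :
    ∫ x, V x * u x * v x ∂(cellMeasure d) = inner ℝ (h.mul u) v := by
  rw [L2.inner_def]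
  refine integral_congr_ae ?_
  filter_upwards [h.coe_mul u] with x hx
  rw [hx]
  simp [mul_comm]

theorem IsPotential.mul_add (h : IsPotential V νlow νup) (u v : L2p d) :
    h.mul (u + v) = h.mul u + h.mul v := by
  refine Lp.ext ?_
  filter_upwards [h.coe_mul (u + v), h.coe_mul u, h.coe_mul v, Lp.coeFn_add u v,
    Lp.coeFn_add (h.mul u) (h.mul v)] with x h1 h2 h3 h4 h5
  rw [h1, h5, Pi.add_apply, h2, h3, h4, Pi.add_apply]; ring

theorem IsPotential.mul_smul (h : IsPotential V νlow νup) (a : ℝ) (u : L2p d) :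
    h.mul (a • u) = a • h.mul u := by
  refine Lp.ext ?_
  filter_upwards [h.coe_mul (a • u), h.coe_mul u, Lp.coeFn_smul a u,
    Lp.coeFn_smul a (h.mul u)] with x h1 h2 h3 h4
  rw [h1, h4, Pi.smul_apply, h2, h3, Pi.smul_apply, smul_eq_mul, smul_eq_mul]; ring

theorem IsPotential.inner_comm (h : IsPotential V νlow νup) (u v : L2p d) :
    inner ℝ (h.mul u) v = inner ℝ (h.mul v) u := by
  rw [← h.integral_eq, ← h.integral_eq]
  exact integral_congr_ae (Filter.Eventually.of_forall fun x => by simp only; ring)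

theorem IsPotential.integrable (h : IsPotential V νlow νup) (u : L2p d) :
    Integrable (fun x => V x * u x * u x) (cellMeasure d) :=
  (h.memLp_mul u).integrable_mul (Lp.memLp u)

theorem IsPotential.inner_mul_ge (h : IsPotential V νlow νup) (u : L2p d) :
    νlow * ‖u‖ ^ 2 ≤ inner ℝ (h.mul u) u := by
  rw [← h.integral_eq, ← integral_sq_eq_norm_sq, ← integral_const_mul]
  refine integral_mono_ae ((Lp.memLp u).integrable_sq.const_mul _) (h.integrable u) ?_
  filter_upwards [h.low] with x hx
  nlinarith [mul_le_mul_of_nonneg_right hx (sq_nonneg (u x))]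

theorem IsPotential.inner_mul_le (h : IsPotential V νlow νup) (u : L2p d) :
    inner ℝ (h.mul u) u ≤ νup * ‖u‖ ^ 2 := by
  rw [← h.integral_eq, ← integral_sq_eq_norm_sq, ← integral_const_mul]
  refine integral_mono_ae (h.integrable u) ((Lp.memLp u).integrable_sq.const_mul _) ?_
  filter_upwards [h.up] with x hx
  nlinarith [mul_le_mul_of_nonneg_right hx (sq_nonneg (u x))]

theorem IsPotential.norm_mul_le (h : IsPotential V νlow νup) (u : L2p d) :
    ‖h.mul u‖ ≤ νup * ‖u‖ := by
  refine Lp.norm_le_mul_norm_of_ae_le_mul ?_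
  filter_upwards [h.bound, h.coe_mul u] with x hx h2
  rw [h2, norm_mul]
  exact mul_le_mul_of_nonneg_right hx (norm_nonneg _)

theorem IsPotential.aForm_eq (h : IsPotential V νlow νup) (u v : L2p d) :
    aForm V u v = ∑' G, normSq G *
      ((starRingEnd ℂ) (boxFourierCoeff u G) * boxFourierCoeff v G).re + inner ℝ (h.mul u) v := by
  rw [aForm, h.integral_eq]

theorem IsPotential.aForm_comm (h : IsPotential V νlow νup) (u v : L2p d) :
    aForm V u v = aForm V v u := by
  rw [h.aForm_eq, h.aForm_eq, h.inner_comm]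
  congr 1
  refine tsum_congr fun G => ?_
  congr 1
  simp only [Complex.mul_re, Complex.conj_re, Complex.conj_im]; ring

theorem IsPotential.aForm_add (h : IsPotential V νlow νup) {u v w : L2p d} (hu : u ∈ H1p d)
    (hv : v ∈ H1p d) (hw : w ∈ H1p d) : aForm V (u + v) w = aForm V u w + aForm V v w := by
  rw [h.aForm_eq, h.aForm_eq, h.aForm_eq, h.mul_add, inner_add_left]
  have : ∑' G, normSq G *
      ((starRingEnd ℂ) (boxFourierCoeff (u + v : L2p d) G) * boxFourierCoeff w G).re =
      ∑' G, normSq G * ((starRingEnd ℂ) (boxFourierCoeff u G) * boxFourierCoeff w G).re +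
      ∑' G, normSq G * ((starRingEnd ℂ) (boxFourierCoeff v G) * boxFourierCoeff w G).re := by
    rw [← (summable_gradient hu hw).tsum_add (summable_gradient hv hw)]
    refine tsum_congr fun G => ?_
    rw [fc_add, map_add, add_mul, Complex.add_re]; ring
  rw [this]; ring

theorem IsPotential.aForm_smul (h : IsPotential V νlow νup) (a : ℝ) (u w : L2p d) :
    aForm V (a • u) w = a * aForm V u w := by
  rw [h.aForm_eq, h.aForm_eq, h.mul_smul, real_inner_smul_left, _root_.mul_add, ← tsum_mul_left]
  congr 1
  refine tsum_congr fun G => ?_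
  rw [fc_smul, map_mul, Complex.conj_ofReal, mul_assoc, Complex.re_ofReal_mul]; ring

theorem re_conj_mul_self (a : ℂ) : ((starRingEnd ℂ) a * a).re = ‖a‖ ^ 2 := by
  rw [re_conj_mul_eq, sub_self, norm_zero, ← two_mul, norm_mul]
  norm_num; ring

theorem IsPotential.aForm_self (h : IsPotential V νlow νup) (u : L2p d) :
    aForm V u u = ∑' G, normSq G * ‖boxFourierCoeff u G‖ ^ 2 + inner ℝ (h.mul u) u := by
  rw [h.aForm_eq]
  simp only [re_conj_mul_self]

theorem tsum_normSq_nonneg (u : L2p d) :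
    0 ≤ ∑' G, normSq G * ‖boxFourierCoeff u G‖ ^ 2 :=
  tsum_nonneg fun G => mul_nonneg (normSq_nonneg G) (sq_nonneg _)

theorem IsPotential.le_aForm (h : IsPotential V νlow νup) {u : L2p d} (hu : u ∈ H1p d) :
    min νlow 1 * h1Sq u ≤ aForm V u u := by
  rw [h.aForm_self, h1Sq_eq hu, _root_.mul_add]
  have h1 := tsum_normSq_nonneg u
  have h2 := h.inner_mul_ge u
  have h3 : min νlow 1 * ‖u‖ ^ 2 ≤ νlow * ‖u‖ ^ 2 :=
    mul_le_mul_of_nonneg_right (min_le_left _ _) (sq_nonneg _)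
  have h4 := mul_le_mul_of_nonneg_right (min_le_right νlow 1) h1
  linarith

theorem IsPotential.aForm_le (h : IsPotential V νlow νup) {u : L2p d} (hu : u ∈ H1p d) :
    aForm V u u ≤ max νup 1 * h1Sq u := by
  rw [h.aForm_self, h1Sq_eq hu, _root_.mul_add]
  have h1 := tsum_normSq_nonneg u
  have h2 := h.inner_mul_le u
  have h3 : νup * ‖u‖ ^ 2 ≤ max νup 1 * ‖u‖ ^ 2 :=
    mul_le_mul_of_nonneg_right (le_max_left _ _) (sq_nonneg _)
  have h4 := mul_le_mul_of_nonneg_right (le_max_right νup 1) h1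
  linarith

end Energy

end Planewave

namespace Planewave

variable {d : ℕ} {V : L2p d} {νlow νup : ℝ}

/-! ### The energy space and the solution operator -/

section EnergySpace

/-- `H_p^1` with the energy inner product `a(·,·)`. The argument carries the coercivity of the
energy form. -/
def EnergySpace (_h : IsPotential V νlow νup) : Type := H1sub d

variable {h : IsPotential V νlow νup}

instance : AddCommGroup (EnergySpace h) := inferInstanceAs (AddCommGroup (H1sub d))

instance : Module ℝ (EnergySpace h) := inferInstanceAs (Module ℝ (H1sub d))

/-- The embedding of the energy space into `L_p^2`. -/
def toL2Lin (h : IsPotential V νlow νup) : EnergySpace h →ₗ[ℝ] L2p d := (H1sub d).subtype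

theorem toL2Lin_mem (u : EnergySpace h) : toL2Lin h u ∈ H1p d := u.2

theorem toL2Lin_injective : Function.Injective (toL2Lin h) := Subtype.val_injective

theorem exists_toL2Lin_eq {u : L2p d} (hu : u ∈ H1p d) : ∃ x : EnergySpace h, toL2Lin h x = u :=
  ⟨⟨u, hu⟩, rfl⟩

theorem IsPotential.min_pos (h : IsPotential V νlow νup) : 0 < min νlow 1 :=
  lt_min h.pos one_pos

theorem max_pos (νup : ℝ) : 0 < max νup 1 := lt_max_of_lt_right one_pos

theorem norm_sq_le_h1Sq {u : L2p d} (hu : u ∈ H1p d) : ‖u‖ ^ 2 ≤ h1Sq u := by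
  rw [h1Sq_eq hu]
  linarith [tsum_normSq_nonneg u]

theorem h1Sq_nonneg (u : L2p d) : 0 ≤ h1Sq u :=
  tsum_nonneg fun G => mul_nonneg (by linarith [normSq_nonneg G]) (sq_nonneg _)

/-- The energy inner product. -/
@[reducible]
def energyCore (h : IsPotential V νlow νup) : InnerProductSpace.Core ℝ (EnergySpace h) where
  inner u v := aForm V (toL2Lin h u) (toL2Lin h v)
  conj_inner_symm u v := h.aForm_comm _ _
  re_inner_nonneg u := by
    have h1 := h.le_aForm (toL2Lin_mem u)
    exact (mul_nonneg h.min_pos.le (h1Sq_nonneg _)).trans h1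
  add_left u v w := by
    rw [map_add]
    exact h.aForm_add (toL2Lin_mem u) (toL2Lin_mem v) (toL2Lin_mem w)
  smul_left u v r := by
    rw [map_smul]
    exact h.aForm_smul r _ _
  definite u hu := by
    have h1 := h.le_aForm (toL2Lin_mem u)
    have h2 := norm_sq_le_h1Sq (toL2Lin_mem u)
    change aForm V (toL2Lin h u) (toL2Lin h u) = 0 at hu
    rw [hu] at h1
    have h3 : h1Sq (toL2Lin h u) ≤ 0 := by
      by_contra hc
      linarith [mul_pos h.min_pos (not_le.1 hc)]
    have h4 : ‖toL2Lin h u‖ ^ 2 = 0 := le_antisymm (h2.trans h3) (sq_nonneg _)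
    rw [sq_eq_zero_iff, norm_eq_zero] at h4
    exact toL2Lin_injective (h4.trans (map_zero _).symm)

instance : NormedAddCommGroup (EnergySpace h) := (energyCore h).toNormedAddCommGroup

instance : InnerProductSpace ℝ (EnergySpace h) :=
  InnerProductSpace.ofCore (energyCore h).toCore

theorem inner_eq_aForm (u v : EnergySpace h) :
    inner ℝ u v = aForm V (toL2Lin h u) (toL2Lin h v) := rfl

theorem norm_eq_aNorm (u : EnergySpace h) : ‖u‖ = aNorm V (toL2Lin h u) := by
  rw [aNorm, ← inner_eq_aForm, real_inner_self_eq_norm_sq, Real.sqrt_sq (norm_nonneg _)]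

theorem norm_sq_eq_aForm (u : EnergySpace h) :
    ‖u‖ ^ 2 = aForm V (toL2Lin h u) (toL2Lin h u) := by
  rw [← inner_eq_aForm, real_inner_self_eq_norm_sq]

theorem min_mul_h1Sq_le (u : EnergySpace h) : min νlow 1 * h1Sq (toL2Lin h u) ≤ ‖u‖ ^ 2 := by
  rw [norm_sq_eq_aForm]
  exact h.le_aForm (toL2Lin_mem u)

theorem norm_sq_le_max_mul (u : EnergySpace h) : ‖u‖ ^ 2 ≤ max νup 1 * h1Sq (toL2Lin h u) := by
  rw [norm_sq_eq_aForm]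
  exact h.aForm_le (toL2Lin_mem u)

/-- Synthesis in `H_p^1` from Fourier coefficients. -/
theorem exists_energy_fc_eq (h : IsPotential V νlow νup) {c : (Fin d → ℤ) → ℂ}
    (hc : Summable fun G => (1 + normSq G) * ‖c G‖ ^ 2)
    (hsymm : ∀ G, c (-G) = (starRingEnd ℂ) (c G)) :
    ∃ u : EnergySpace h, ∀ G, boxFourierCoeff (toL2Lin h u) G = c G := by
  have h1 : Summable fun G => ‖c G‖ ^ 2 := by
    refine Summable.of_nonneg_of_le (fun G => sq_nonneg _) (fun G => ?_) hc
    nlinarith [mul_nonneg (normSq_nonneg G) (sq_nonneg ‖c G‖)]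
  obtain ⟨u, hu⟩ := exists_fc_eq h1 hsymm
  have h2 : u ∈ H1p d := by
    rw [mem_H1p_iff]
    simpa only [hu] using hc
  obtain ⟨x, hx⟩ := exists_toL2Lin_eq (h := h) h2
  exact ⟨x, fun G => by rw [hx, hu]⟩

/-- The weighted Fourier transform, an isomorphism of the energy space onto a closed subspace of
`ℓ²`. -/
def weightedFourier (h : IsPotential V νlow νup) (u : EnergySpace h) :
    lp (fun _ : Fin d → ℤ => ℂ) 2 :=
  ⟨fun G => (Real.sqrt (1 + normSq G) : ℂ) * boxFourierCoeff (toL2Lin h u) G, by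
    refine memℓp_gen ?_
    simp only [ENNReal.toReal_ofNat, Real.rpow_ofNat, norm_mul, mul_pow, Complex.norm_real,
      Real.norm_eq_abs, sq_abs]
    refine (mem_H1p_iff.1 (toL2Lin_mem u)).congr fun G => ?_
    rw [Real.sq_sqrt (by linarith [normSq_nonneg G])]⟩

theorem norm_sq_lp (f : lp (fun _ : Fin d → ℤ => ℂ) 2) : ‖f‖ ^ 2 = ∑' G, ‖f G‖ ^ 2 := by
  have := lp.norm_rpow_eq_tsum (p := 2) (by simp) f
  simpa only [ENNReal.toReal_ofNat, Real.rpow_ofNat] using this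

theorem weightedFourier_sub (u v : EnergySpace h) :
    weightedFourier h (u - v) = weightedFourier h u - weightedFourier h v := by
  ext G
  change (Real.sqrt (1 + normSq G) : ℂ) * boxFourierCoeff (toL2Lin h (u - v)) G =
    (Real.sqrt (1 + normSq G) : ℂ) * boxFourierCoeff (toL2Lin h u) G -
      (Real.sqrt (1 + normSq G) : ℂ) * boxFourierCoeff (toL2Lin h v) G
  rw [map_sub, fc_sub]; ring

theorem norm_sq_weightedFourier (u : EnergySpace h) :
    ‖weightedFourier h u‖ ^ 2 = h1Sq (toL2Lin h u) := by
  rw [norm_sq_lp, h1Sq]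
  refine tsum_congr fun G => ?_
  change ‖(Real.sqrt (1 + normSq G) : ℂ) * boxFourierCoeff (toL2Lin h u) G‖ ^ 2 = _
  rw [norm_mul, mul_pow, Complex.norm_real, Real.norm_eq_abs, sq_abs,
    Real.sq_sqrt (by linarith [normSq_nonneg G])]

instance : CompleteSpace (EnergySpace h) := by
  refine Metric.complete_of_cauchySeq_tendsto fun u hu => ?_
  have hα := h.min_pos
  have hα' := max_pos νup
  have hlip : LipschitzWith (Real.toNNReal (Real.sqrt (1 / min νlow 1))) (weightedFourier h) := by
    refine LipschitzWith.of_dist_le_mul fun x y => ?_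
    rw [dist_eq_norm, dist_eq_norm, ← weightedFourier_sub, Real.coe_toNNReal _ (Real.sqrt_nonneg _)]
    refine le_of_sq_le_sq ?_ (by positivity)
    rw [norm_sq_weightedFourier, mul_pow, Real.sq_sqrt (by positivity), one_div,
      inv_mul_eq_div, le_div_iff₀' hα]
    exact min_mul_h1Sq_le (x - y)
  obtain ⟨f, hf⟩ := cauchySeq_tendsto_of_complete (hlip.cauchySeq_comp hu)
  have hcoord : ∀ G, Filter.Tendsto (fun n => weightedFourier h (u n) G) Filter.atTop
      (nhds (f G)) := by
    intro G
    rw [tendsto_iff_norm_sub_tendsto_zero] at hf ⊢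
    refine squeeze_zero (fun _ => norm_nonneg _) (fun n => ?_) hf
    exact lp.norm_apply_le_norm (by simp) (weightedFourier h (u n) - f) G
  have hw : ∀ G : Fin d → ℤ, 0 < 1 + normSq G := fun G => by linarith [normSq_nonneg G]
  have hs0 : ∀ G : Fin d → ℤ, (Real.sqrt (1 + normSq G) : ℂ) ≠ 0 := fun G => by
    rw [Complex.ofReal_ne_zero]; exact (Real.sqrt_pos.2 (hw G)).ne'
  have hsymm : ∀ G, f (-G) = (starRingEnd ℂ) (f G) := by
    intro G
    refine tendsto_nhds_unique (hcoord (-G)) ?_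
    refine ((Complex.continuous_conj.tendsto _).comp (hcoord G)).congr fun n => ?_
    change (starRingEnd ℂ) ((Real.sqrt (1 + normSq G) : ℂ) * boxFourierCoeff (toL2Lin h (u n)) G) =
      (Real.sqrt (1 + normSq (-G)) : ℂ) * boxFourierCoeff (toL2Lin h (u n)) (-G)
    rw [map_mul, Complex.conj_ofReal, normSq_neg, boxFourierCoeff_neg_index]
  have hsum : Summable fun G => ‖f G‖ ^ 2 := by
    have := (lp.memℓp f).summable (by simp)
    simpa only [ENNReal.toReal_ofNat, Real.rpow_ofNat] using this
  obtain ⟨x, hx⟩ := exists_energy_fc_eq h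
    (c := fun G => (Real.sqrt (1 + normSq G) : ℂ)⁻¹ * f G)
    (by
      refine hsum.congr fun G => ?_
      rw [norm_mul, mul_pow, norm_inv, inv_pow, Complex.norm_real, Real.norm_eq_abs, sq_abs,
        Real.sq_sqrt (hw G).le, mul_inv_cancel_left₀ (hw G).ne'])
    (fun G => by rw [normSq_neg, hsymm, map_mul, map_inv₀, Complex.conj_ofReal])
  have hxf : weightedFourier h x = f := by
    ext G
    change (Real.sqrt (1 + normSq G) : ℂ) * boxFourierCoeff (toL2Lin h x) G = f G
    rw [hx, mul_inv_cancel_left₀ (hs0 G)]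
  refine ⟨x, ?_⟩
  rw [tendsto_iff_norm_sub_tendsto_zero] at hf ⊢
  have hlim := hf.const_mul (Real.sqrt (max νup 1))
  rw [mul_zero] at hlim
  refine squeeze_zero (fun _ => norm_nonneg _) (fun n => ?_) hlim
  refine le_of_sq_le_sq ?_ (by positivity)
  rw [mul_pow, Real.sq_sqrt hα'.le, Function.comp_apply, ← hxf, ← weightedFourier_sub,
    norm_sq_weightedFourier]
  exact norm_sq_le_max_mul _

/-- The continuous embedding of the energy space into `L_p^2`. -/
def toL2 (h : IsPotential V νlow νup) : EnergySpace h →L[ℝ] L2p d :=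
  (toL2Lin h).mkContinuous (Real.sqrt (1 / min νlow 1)) fun u => by
    have hα := h.min_pos
    refine le_of_sq_le_sq ?_ (by positivity)
    rw [mul_pow, Real.sq_sqrt (by positivity), one_div, inv_mul_eq_div, le_div_iff₀' hα]
    exact (mul_le_mul_of_nonneg_left (norm_sq_le_h1Sq (toL2Lin_mem u)) hα.le).trans
      (min_mul_h1Sq_le u)

theorem toL2_mem (u : EnergySpace h) : toL2 h u ∈ H1p d := toL2Lin_mem u

theorem toL2_injective : Function.Injective (toL2 h) := toL2Lin_injective

/-- The solution operator: `a(K u, v) = (u, v)` for all `v ∈ H_p^1`. -/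
def solOp (h : IsPotential V νlow νup) : EnergySpace h →L[ℝ] EnergySpace h :=
  ContinuousLinearMap.adjoint (toL2 h) ∘L toL2 h

theorem inner_solOp (u v : EnergySpace h) :
    inner ℝ (solOp h u) v = inner ℝ (toL2 h u) (toL2 h v) :=
  ContinuousLinearMap.adjoint_inner_left (toL2 h) v (toL2 h u)

end EnergySpace

/-! ### Planewave spaces -/

section Planewaves

variable {h : IsPotential V νlow νup}

/-- The elements of the energy space whose Fourier coefficients vanish outside of `S`. -/
def suppSub (h : IsPotential V νlow νup) (S : Set (Fin d → ℤ)) : Submodule ℝ (EnergySpace h) where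
  carrier := {u | ∀ G, G ∉ S → boxFourierCoeff (toL2 h u) G = 0}
  zero_mem' G _ := by rw [map_zero, fc_zero]
  add_mem' {u v} hu hv G hG := by rw [map_add, fc_add, hu G hG, hv G hG, add_zero]
  smul_mem' a u hu G hG := by rw [map_smul, fc_smul, hu G hG, mul_zero]

theorem suppSub_mono {S T : Set (Fin d → ℤ)} (hST : S ⊆ T) : suppSub h S ≤ suppSub h T :=
  fun _ hu G hG => hu G fun hS => hG (hST hS)

instance (𝔾 : Finset (Fin d → ℤ)) : FiniteDimensional ℝ (suppSub h (𝔾 : Set (Fin d → ℤ))) := by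
  let L : suppSub h (𝔾 : Set (Fin d → ℤ)) →ₗ[ℝ] (𝔾 → ℂ) :=
    { toFun := fun u G => boxFourierCoeff (toL2 h u) G
      map_add' := fun u v => by ext G; exact fc_add _ _ _
      map_smul' := fun a u => by ext G; exact fc_smul _ _ _ }
  refine FiniteDimensional.of_injective L ?_
  rintro ⟨u, hu⟩ ⟨v, hv⟩ huv
  ext
  refine toL2_injective (fc_injective fun G => ?_)
  by_cases hG : G ∈ (𝔾 : Set (Fin d → ℤ))
  · exact congrFun huv ⟨G, hG⟩
  · rw [hu G hG, hv G hG]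

theorem cellCoeff_sum (𝔾 : Finset (Fin d → ℤ)) (c : (Fin d → ℤ) → ℂ) (G : Fin d → ℤ) :
    cellCoeff (fun x => ∑ G ∈ 𝔾, c G * planeWave G x) G = if G ∈ 𝔾 then c G else 0 := by
  have h1 : cellCoeff (fun x => ∑ G ∈ 𝔾, c G * planeWave G x) G =
      ∑ G' ∈ 𝔾, c G' * cellCoeff (planeWave G') G := by
    simp only [cellCoeff, Finset.mul_sum]
    rw [integral_finsetSum]
    · refine Finset.sum_congr rfl fun G' _ => ?_
      rw [← integral_const_mul]
      refine integral_congr_ae (Filter.Eventually.of_forall fun x => ?_)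
      simp only; ring
    · intro G' _
      refine ((integrable_conj_planeWave_mul (memLp_planeWave G') G).const_mul (c G')).congr
        (Filter.Eventually.of_forall fun x => ?_)
      simp only; ring
  rw [h1]
  simp [cellCoeff_planeWave]

theorem VSpace_eq_image (𝔾 : Finset (Fin d → ℤ)) :
    VSpace 𝔾 = toL2 h '' suppSub h (𝔾 : Set (Fin d → ℤ)) := by
  ext v
  constructor
  · rintro ⟨⟨c, hc⟩, hv⟩
    obtain ⟨x, rfl⟩ := exists_toL2Lin_eq (h := h) hv
    refine ⟨x, fun G hG => ?_, rfl⟩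
    have h1 : boxFourierCoeff (toL2 h x) G =
        cellCoeff (fun x => ∑ G ∈ 𝔾, c G * planeWave G x) G :=
      integral_congr_ae (by filter_upwards [hc] with y hy; rw [← hy]; rfl)
    rw [h1, cellCoeff_sum, if_neg (by exact_mod_cast hG)]
  · rintro ⟨x, hx, rfl⟩
    refine ⟨⟨boxFourierCoeff (toL2 h x), ?_⟩, toL2_mem x⟩
    set g : (Fin d → ℝ) → ℂ := fun y => ∑ G ∈ 𝔾, boxFourierCoeff (toL2 h x) G * planeWave G y
      with hg
    have hgm : MemLp g 2 (cellMeasure d) := by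
      have := memLp_finsetSum (μ := cellMeasure d) (p := 2) 𝔾
        (f := fun G y => boxFourierCoeff (toL2 h x) G * planeWave G y)
        (fun G _ => (memLp_planeWave G).const_mul _)
      exact this
    have hum := memLp_ofReal (toL2 h x)
    have hdm := hum.sub hgm
    have hzero : ∀ G, cellCoeff ((fun y => ((toL2 h x y : ℝ) : ℂ)) - g) G = 0 := by
      intro G
      have h1 : cellCoeff ((fun y => ((toL2 h x y : ℝ) : ℂ)) - g) G =
          cellCoeff (fun y => ((toL2 h x y : ℝ) : ℂ)) G - cellCoeff g G := by
        simp only [cellCoeff, Pi.sub_apply, mul_sub]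
        exact integral_sub (integrable_conj_planeWave_mul hum G)
          (integrable_conj_planeWave_mul hgm G)
      rw [h1, hg, cellCoeff_sum, ← boxFourierCoeff_eq_cellCoeff]
      split_ifs with hG
      · exact sub_self _
      · rw [hx G (by exact_mod_cast hG), sub_zero]
    have h2 := hasSum_norm_sq_cellCoeff hdm
    simp only [hzero, norm_zero, ne_eq, OfNat.ofNat_ne_zero, not_false_eq_true, zero_pow] at h2
    have h3 := (hasSum_zero.unique h2).symm
    rw [integral_eq_zero_iff_of_nonneg (fun _ => sq_nonneg _) hdm.norm.integrable_sq] at h3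
    filter_upwards [h3] with y hy
    simpa [sub_eq_zero] using hy

theorem mem_ballIndex {M : ℕ} {G : Fin d → ℤ} : G ∈ ballIndex d M ↔ normSq G ≤ (M : ℝ) ^ 2 := by
  have hcast : normSq G ≤ (M : ℝ) ^ 2 ↔ ∑ i, (G i) ^ 2 ≤ (M : ℤ) ^ 2 := by
    rw [normSq]; exact_mod_cast Iff.rfl
  rw [hcast, ballIndex, Finset.mem_filter, and_iff_right_iff_imp]
  intro hG
  have h1 : ∀ i, |G i| ≤ M := by
    intro i
    refine abs_le_of_sq_le_sq ?_ (by positivity)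
    exact (Finset.single_le_sum (f := fun i => (G i) ^ 2) (fun _ _ => sq_nonneg _)
      (Finset.mem_univ i)).trans hG
  rw [Finset.mem_Icc]
  exact ⟨fun i => (abs_le.1 (h1 i)).1, fun i => (abs_le.1 (h1 i)).2⟩

theorem ballIndex_mono {M M' : ℕ} (hM : M ≤ M') : ballIndex d M ⊆ ballIndex d M' := by
  intro G hG
  rw [mem_ballIndex] at *
  have : (M : ℝ) ≤ M' := by exact_mod_cast hM
  exact hG.trans (by gcongr)

theorem isSymm_ballIndex (M : ℕ) : IsSymm (ballIndex d M) := by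
  intro G hG
  rw [mem_ballIndex] at *
  rwa [normSq_neg]

/-- Elliptic regularity: the high Fourier modes of `K u` are small. The tail of `K u` itself is the
test function. -/
theorem exists_solOp_approx (h : IsPotential V νlow νup) :
    ∃ C > 0, ∀ (M : ℕ), 1 ≤ M → ∀ 𝔾 : Finset (Fin d → ℤ), ballIndex d M ⊆ 𝔾 → ∀ x,
      ‖solOp h x - (suppSub h (𝔾 : Set (Fin d → ℤ))).starProjection (solOp h x)‖ ≤
        C / M * ‖x‖ := by
  set κ := ‖toL2 h‖ with hκ
  have hκ0 : 0 ≤ κ := (toL2 h).opNorm_nonneg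
  set A := κ + |νup| * (κ * ‖solOp h‖) with hA
  have hA0 : 0 ≤ A := by positivity
  have hα' := max_pos νup
  refine ⟨Real.sqrt (2 * max νup 1) * A + 1, by positivity, fun M hM 𝔾 hMG x => ?_⟩
  have hM0 : (1 : ℝ) ≤ M := by exact_mod_cast hM
  set y := solOp h x with hy
  set yhat := boxFourierCoeff (toL2 h y) with hyhat
  obtain ⟨v, hv⟩ := exists_energy_fc_eq h
    (c := fun G => if G ∈ ballIndex d M then 0 else yhat G)
    (by
      refine Summable.of_nonneg_of_le (fun G => ?_) (fun G => ?_) (mem_H1p_iff.1 (toL2_mem y))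
      · have := normSq_nonneg G; positivity
      · have := normSq_nonneg G
        refine mul_le_mul_of_nonneg_left ?_ (by linarith)
        split_ifs
        · rw [norm_zero, zero_pow two_ne_zero]; positivity
        · exact le_rfl)
    (fun G => by
      have h1 : -G ∈ ballIndex d M ↔ G ∈ ballIndex d M := by
        simp only [mem_ballIndex, normSq_neg]
      simp only [h1]
      split_ifs
      · simp
      · exact boxFourierCoeff_neg_index _ G)
  change ∀ G, boxFourierCoeff (toL2 h v) G = _ at hv
  have hmem : y - v ∈ suppSub h (𝔾 : Set (Fin d → ℤ)) := by
    intro G hG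
    rw [map_sub, fc_sub, hv, if_neg fun h1 => hG (hMG h1), sub_self]
  have hle : ‖y - (suppSub h (𝔾 : Set (Fin d → ℤ))).starProjection y‖ ≤ ‖v‖ := by
    rw [Submodule.starProjection_minimal]
    refine (ciInf_le ⟨0, ?_⟩ (⟨y - v, hmem⟩ : suppSub h (𝔾 : Set (Fin d → ℤ)))).trans ?_
    · rintro _ ⟨w, rfl⟩; exact norm_nonneg _
    · simp
  refine hle.trans ?_
  set S := ∑' G, normSq G * ‖boxFourierCoeff (toL2 h v) G‖ ^ 2 with hS
  have hS0 : 0 ≤ S := tsum_normSq_nonneg _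
  have e1 : S = inner ℝ (toL2 h x) (toL2 h v) - inner ℝ (h.mul (toL2 h y)) (toL2 h v) := by
    have f1 : inner ℝ y v = inner ℝ (toL2 h x) (toL2 h v) := inner_solOp x v
    have f2 : inner ℝ y v = aForm V (toL2 h y) (toL2 h v) := inner_eq_aForm y v
    rw [h.aForm_eq] at f2
    have f3 : ∑' G, normSq G * ((starRingEnd ℂ) (boxFourierCoeff (toL2 h y) G) *
        boxFourierCoeff (toL2 h v) G).re = S := by
      refine tsum_congr fun G => ?_
      rw [hv]
      split_ifs
      · simp
      · rw [re_conj_mul_self]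
    rw [f3] at f2
    linarith
  set n := ‖toL2 h v‖ with hn
  have hn0 : 0 ≤ n := norm_nonneg _
  have e2 : (M : ℝ) ^ 2 * n ^ 2 ≤ S := by
    have f1 := hasSum_norm_sq_fc (toL2 h v)
    rw [hn, ← f1.tsum_eq, ← tsum_mul_left]
    refine Summable.tsum_le_tsum (fun G => ?_) (f1.summable.mul_left _)
      (summable_normSq_mul (toL2_mem v))
    rw [hv]
    split_ifs with hG
    · simp
    · rw [mem_ballIndex, not_le] at hG
      exact mul_le_mul_of_nonneg_right hG.le (sq_nonneg _)
  have e3 : S ≤ A * ‖x‖ * n := by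
    have f1 : ‖toL2 h x‖ ≤ κ * ‖x‖ := (toL2 h).le_opNorm x
    have f2 : ‖h.mul (toL2 h y)‖ ≤ |νup| * (κ * (‖solOp h‖ * ‖x‖)) := by
      refine (h.norm_mul_le _).trans ?_
      refine mul_le_mul (le_abs_self _) (((toL2 h).le_opNorm y).trans ?_) (norm_nonneg _)
        (abs_nonneg _)
      exact mul_le_mul_of_nonneg_left ((solOp h).le_opNorm x) hκ0
    have f3 := abs_le.1 (abs_real_inner_le_norm (toL2 h x) (toL2 h v))
    have f4 := abs_le.1 (abs_real_inner_le_norm (h.mul (toL2 h y)) (toL2 h v))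
    have f5 := mul_le_mul_of_nonneg_right f1 hn0
    have f6 := mul_le_mul_of_nonneg_right f2 hn0
    have f7 : A * ‖x‖ * n = κ * ‖x‖ * n + |νup| * (κ * (‖solOp h‖ * ‖x‖)) * n := by
      rw [hA]; ring
    rw [f7, e1]
    linarith [f3.2, f4.1]
  have e4 : (M : ℝ) ^ 2 * n ≤ A * ‖x‖ := by
    rcases hn0.eq_or_lt with h0 | h0
    · rw [← h0, mul_zero]; positivity
    · refine le_of_mul_le_mul_right ?_ h0
      calc (M : ℝ) ^ 2 * n * n = (M : ℝ) ^ 2 * n ^ 2 := by ring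
        _ ≤ A * ‖x‖ * n := e2.trans e3
  have e5 : (M : ℝ) ^ 2 * S ≤ (A * ‖x‖) ^ 2 := by
    calc (M : ℝ) ^ 2 * S ≤ (M : ℝ) ^ 2 * (A * ‖x‖ * n) := by gcongr
      _ = A * ‖x‖ * ((M : ℝ) ^ 2 * n) := by ring
      _ ≤ A * ‖x‖ * (A * ‖x‖) := by gcongr
      _ = _ := by ring
  have e6 : ‖v‖ ^ 2 ≤ max νup 1 * (2 * S) := by
    refine (norm_sq_le_max_mul v).trans (mul_le_mul_of_nonneg_left ?_ hα'.le)
    rw [h1Sq_eq (toL2Lin_mem v)]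
    change S + n ^ 2 ≤ 2 * S
    have : n ^ 2 ≤ (M : ℝ) ^ 2 * n ^ 2 := le_mul_of_one_le_left (sq_nonneg _) (one_le_pow₀ hM0)
    linarith
  have e7 : ‖v‖ ≤ Real.sqrt (2 * max νup 1) * A / M * ‖x‖ := by
    refine le_of_sq_le_sq ?_ (by positivity)
    rw [mul_pow, div_pow, mul_pow, Real.sq_sqrt (by positivity), div_mul_eq_mul_div,
      le_div_iff₀ (by positivity)]
    calc ‖v‖ ^ 2 * (M : ℝ) ^ 2 ≤ max νup 1 * (2 * S) * (M : ℝ) ^ 2 := by gcongr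
      _ = 2 * max νup 1 * ((M : ℝ) ^ 2 * S) := by ring
      _ ≤ 2 * max νup 1 * (A * ‖x‖) ^ 2 := by gcongr
      _ = _ := by ring
  refine e7.trans ?_
  gcongr
  linarith

theorem isSolutionOperator_solOp (h : IsPotential V νlow νup) : IsSolutionOperator (solOp h) where
  compact := by
    obtain ⟨C, hC, hbound⟩ := exists_solOp_approx h
    have hlim : Filter.Tendsto (fun M : ℕ =>
        (suppSub h (ballIndex d M : Set (Fin d → ℤ))).starProjection ∘L solOp h) Filter.atTop
        (nhds (solOp h)) := by
      refine (tendsto_iff_norm_sub_tendsto_zero (E := EnergySpace h →L[ℝ] EnergySpace h)).2 ?_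
      have h0 : Filter.Tendsto (fun M : ℕ => C / (M : ℝ)) Filter.atTop (nhds 0) :=
        tendsto_const_div_atTop_nhds_zero_nat C
      refine squeeze_zero' (Filter.Eventually.of_forall fun _ =>
        ContinuousLinearMap.opNorm_nonneg _) ?_ h0
      filter_upwards [Filter.eventually_ge_atTop 1] with M hM
      refine ContinuousLinearMap.opNorm_le_bound _ (by positivity) fun x => ?_
      have := hbound M hM (ballIndex d M) subset_rfl x
      rw [norm_sub_rev] at this
      exact this
    refine isCompactOperator_of_tendsto hlim (Filter.Eventually.of_forall fun M => ?_)
    have h1 : IsCompactOperator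
        ((suppSub h (ballIndex d M : Set (Fin d → ℤ))).orthogonalProjectionOnto ∘L solOp h) :=
      have : ProperSpace (suppSub h (ballIndex d M : Set (Fin d → ℤ))) :=
        FiniteDimensional.proper ℝ _
      isCompactOperator_of_locallyCompactSpace_dom _
    exact h1.clm_comp (suppSub h (ballIndex d M : Set (Fin d → ℤ))).subtypeL
  symm x y := by
    rw [inner_solOp, real_inner_comm, ← inner_solOp, real_inner_comm]
  pos x hx := by
    rw [inner_solOp, real_inner_self_eq_norm_sq]
    have : toL2 h x ≠ 0 := fun h0 => hx (toL2_injective (h0.trans (map_zero _).symm))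
    positivity

end Planewaves

end Planewave

namespace Planewave

variable {d : ℕ} {V : L2p d} {νlow νup : ℝ}

/-! ### Residuals -/

section Residual

/-- The contribution of the mode `G` to the squared `H_p^{-1}` norm. -/
def negDensity (c : (Fin d → ℤ) → ℂ) (G : Fin d → ℤ) : ℝ := (1 + normSq G) ^ (-1 : ℝ) * ‖c G‖ ^ 2

theorem negDensity_nonneg (c : (Fin d → ℤ) → ℂ) (G : Fin d → ℤ) : 0 ≤ negDensity c G :=
  mul_nonneg (Real.rpow_nonneg (by linarith [normSq_nonneg G]) _) (sq_nonneg _)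

theorem negDensity_eq (c : (Fin d → ℤ) → ℂ) (G : Fin d → ℤ) :
    negDensity c G = (1 + normSq G)⁻¹ * ‖c G‖ ^ 2 := by
  rw [negDensity, Real.rpow_neg_one]

variable {h : IsPotential V νlow νup}

theorem residual_eq (h : IsPotential V νlow νup) (μ : ℝ) (u : L2p d) (G : Fin d → ℤ) :
    residual V μ u G = boxFourierCoeff (μ • u - h.mul u : L2p d) G -
      (normSq G : ℂ) * boxFourierCoeff u G := by
  rw [residual, fc_sub, fc_smul, ← boxFourierCoeff_congr (h.coe_mul u)]
  ring

theorem residual_neg_index (h : IsPotential V νlow νup) (μ : ℝ) (u : L2p d) (G : Fin d → ℤ) :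
    residual V μ u (-G) = (starRingEnd ℂ) (residual V μ u G) := by
  rw [residual_eq h, residual_eq h, boxFourierCoeff_neg_index, boxFourierCoeff_neg_index,
    normSq_neg, map_sub, map_mul, Complex.conj_ofReal]

theorem summable_negDensity_residual (h : IsPotential V νlow νup) (μ : ℝ) {u : L2p d}
    (hu : u ∈ H1p d) : Summable (negDensity (residual V μ u)) := by
  refine Summable.of_nonneg_of_le (negDensity_nonneg _) (fun G => ?_)
    (((hasSum_norm_sq_fc (μ • u - h.mul u)).summable.mul_left 2).add
      ((summable_normSq_mul hu).mul_left 2))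
  have hG := normSq_nonneg G
  rw [negDensity_eq, inv_mul_le_iff₀ (by linarith), residual_eq h, sub_eq_add_neg]
  refine (norm_add_sq_le _ _).trans ?_
  rw [norm_neg, norm_mul, Complex.norm_real, Real.norm_of_nonneg hG, mul_pow]
  nlinarith [mul_nonneg hG (sq_nonneg ‖boxFourierCoeff (μ • u - h.mul u : L2p d) G‖),
    mul_nonneg hG (sq_nonneg ‖boxFourierCoeff u G‖)]

theorem memSobolev_residual (h : IsPotential V νlow νup) (μ : ℝ) {u : L2p d}
    (hu : u ∈ H1p d) : MemSobolev (-1) (residual V μ u) :=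
  ⟨summable_negDensity_residual h μ hu, residual_neg_index h μ u⟩

/-- In the energy space, the Fourier series `residual V μ x` is represented by `μ K x - x`. -/
theorem hasSum_inner_residual (μ : ℝ) (x v : EnergySpace h) :
    HasSum (fun G => ((starRingEnd ℂ) (residual V μ (toL2 h x) G) *
      boxFourierCoeff (toL2 h v) G).re) (inner ℝ (μ • solOp h x - x) v) := by
  have h1 := (hasSum_inner_fc (μ • toL2 h x - h.mul (toL2 h x)) (toL2 h v)).sub
    (summable_gradient (toL2_mem x) (toL2_mem v)).hasSum
  have h2 : inner ℝ (μ • solOp h x - x) v =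
      inner ℝ (μ • toL2 h x - h.mul (toL2 h x)) (toL2 h v) - ∑' G, normSq G *
        ((starRingEnd ℂ) (boxFourierCoeff (toL2 h x) G) * boxFourierCoeff (toL2 h v) G).re := by
    have h3 : inner ℝ x v = aForm V (toL2 h x) (toL2 h v) := inner_eq_aForm x v
    rw [inner_sub_left, real_inner_smul_left, inner_solOp, h3, h.aForm_eq, inner_sub_left,
      real_inner_smul_left]
    ring
  rw [h2]
  refine h1.congr_fun fun G => ?_
  rw [residual_eq h, map_sub, sub_mul, Complex.sub_re, map_mul, Complex.conj_ofReal, mul_assoc,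
    Complex.re_ofReal_mul]

/-- The energy norm of the Riesz representative `y`, on the modes in `S`, of the Fourier series `c`
is equivalent to the `H_p^{-1}` norm of the restriction of `c` to `S`. -/
theorem tsum_negDensity_bounds {S : Set (Fin d → ℤ)} (hS : ∀ G ∈ S, -G ∈ S)
    {c : (Fin d → ℤ) → ℂ} (hc : MemSobolev (-1) c) {y : EnergySpace h}
    (hy : y ∈ suppSub h S) (hpair : ∀ v ∈ suppSub h S,
      HasSum (fun G => ((starRingEnd ℂ) (c G) * boxFourierCoeff (toL2 h v) G).re) (inner ℝ y v)) :
    ∑' G, S.indicator (negDensity c) G ≤ max νup 1 * ‖y‖ ^ 2 ∧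
      min νlow 1 * ‖y‖ ^ 2 ≤ ∑' G, S.indicator (negDensity c) G := by
  classical
  have hw : ∀ G : Fin d → ℤ, 0 < 1 + normSq G := fun G => by linarith [normSq_nonneg G]
  have hα := h.min_pos
  have hα' := max_pos νup
  have hsum : Summable (S.indicator (negDensity c)) := Summable.indicator hc.1 S
  set R := ∑' G, S.indicator (negDensity c) G with hR
  have hSneg : ∀ G, -G ∈ S ↔ G ∈ S := fun G => ⟨fun hG => by simpa using hS _ hG, hS G⟩
  constructor
  · -- the Riesz representative of `c` in `H_p^1` serves as test function
    obtain ⟨v, hv⟩ := exists_energy_fc_eq h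
      (c := fun G => if G ∈ S then ((1 + normSq G)⁻¹ : ℝ) * c G else 0)
      (by
        refine hsum.congr fun G => ?_
        by_cases hG : G ∈ S
        · rw [Set.indicator_of_mem hG, if_pos hG, negDensity_eq, norm_mul, mul_pow,
            Complex.norm_real, Real.norm_of_nonneg (inv_nonneg.2 (hw G).le), inv_pow]
          have := (hw G).ne'
          field_simp
        · rw [Set.indicator_of_notMem hG, if_neg hG]; simp)
      (fun G => by
        simp only [hSneg, normSq_neg, hc.2]
        split_ifs
        · rw [map_mul, Complex.conj_ofReal]
        · simp)
    change ∀ G, boxFourierCoeff (toL2 h v) G = _ at hv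
    have hvS : v ∈ suppSub h S := fun G hG => by rw [hv, if_neg hG]
    have h1 : h1Sq (toL2 h v) = R := by
      refine tsum_congr fun G => ?_
      rw [hv]
      by_cases hG : G ∈ S
      · rw [Set.indicator_of_mem hG, if_pos hG, negDensity_eq, norm_mul, mul_pow,
          Complex.norm_real, Real.norm_of_nonneg (inv_nonneg.2 (hw G).le), inv_pow]
        have := (hw G).ne'
        field_simp
      · rw [Set.indicator_of_notMem hG, if_neg hG]; simp
    have h2 : inner ℝ y v = R := by
      rw [← (hpair v hvS).tsum_eq]
      refine tsum_congr fun G => ?_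
      rw [hv]
      by_cases hG : G ∈ S
      · rw [Set.indicator_of_mem hG, if_pos hG, negDensity_eq, mul_left_comm,
          Complex.re_ofReal_mul, re_conj_mul_self]
      · rw [Set.indicator_of_notMem hG, if_neg hG]; simp
    have h3 := norm_sq_le_max_mul v
    change ‖v‖ ^ 2 ≤ max νup 1 * h1Sq (toL2 h v) at h3
    rw [h1] at h3
    have h4 := real_inner_le_norm y v
    rw [h2] at h4
    have h5 : R ^ 2 ≤ max νup 1 * ‖y‖ ^ 2 * R := by
      have hR0 : 0 ≤ R := tsum_nonneg fun G =>
        Set.indicator_nonneg (fun _ _ => negDensity_nonneg _ _) G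
      calc R ^ 2 ≤ (‖y‖ * ‖v‖) ^ 2 := by gcongr
        _ = ‖y‖ ^ 2 * ‖v‖ ^ 2 := by ring
        _ ≤ ‖y‖ ^ 2 * (max νup 1 * R) := by gcongr
        _ = _ := by ring
    by_contra hcon
    have h6 : 0 < R := lt_of_le_of_lt (by positivity) (not_le.1 hcon)
    nlinarith
  · -- Young's inequality with the weight that balances both terms
    have h1 := min_mul_h1Sq_le y
    change min νlow 1 * h1Sq (toL2 h y) ≤ ‖y‖ ^ 2 at h1
    have h2 := hpair y hy
    rw [real_inner_self_eq_norm_sq] at h2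
    set α := min νlow 1
    have h3 : ‖y‖ ^ 2 ≤ ∑' G, (α⁻¹ / 2 * S.indicator (negDensity c) G +
        α / 2 * ((1 + normSq G) * ‖boxFourierCoeff (toL2 h y) G‖ ^ 2)) := by
      rw [← h2.tsum_eq]
      refine h2.summable.tsum_le_tsum (fun G => ?_) ((hsum.mul_left _).add
        ((mem_H1p_iff.1 (toL2_mem y)).mul_left _))
      by_cases hG : G ∈ S
      · rw [Set.indicator_of_mem hG, negDensity_eq]
        refine ((Complex.re_le_norm _).trans_eq (by rw [norm_mul, RCLike.norm_conj])).trans ?_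
        have h4 : α⁻¹ / 2 * ((1 + normSq G)⁻¹ * ‖c G‖ ^ 2) +
            α / 2 * ((1 + normSq G) * ‖boxFourierCoeff (toL2 h y) G‖ ^ 2) -
            ‖c G‖ * ‖boxFourierCoeff (toL2 h y) G‖ = α⁻¹ / 2 * (1 + normSq G)⁻¹ *
            (‖c G‖ - α * (1 + normSq G) * ‖boxFourierCoeff (toL2 h y) G‖) ^ 2 := by
          have := (hw G).ne'
          field_simp
          ring
        have h5 : 0 ≤ α⁻¹ / 2 * (1 + normSq G)⁻¹ *
            (‖c G‖ - α * (1 + normSq G) * ‖boxFourierCoeff (toL2 h y) G‖) ^ 2 := by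
          have := hw G
          positivity
        linarith
      · rw [Set.indicator_of_notMem hG, hy G hG]; simp
    rw [(hsum.mul_left _).tsum_add ((mem_H1p_iff.1 (toL2_mem y)).mul_left _), tsum_mul_left,
      tsum_mul_left] at h3
    change ‖y‖ ^ 2 ≤ α⁻¹ / 2 * R + α / 2 * h1Sq (toL2 h y) at h3
    have h6 : ‖y‖ ^ 2 ≤ α⁻¹ * R := by linarith
    rwa [inv_mul_eq_div, le_div_iff₀' hα] at h6

theorem sobolevNorm_neg_one_sq (c : (Fin d → ℤ) → ℂ) :
    sobolevNorm (-1) c ^ 2 = ∑' G, negDensity c G :=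
  Real.sq_sqrt (tsum_nonneg (negDensity_nonneg c))

variable {N : ℕ}

theorem negNorm_sq (r : ℕ → (Fin d → ℤ) → ℂ) :
    negNorm N r ^ 2 = ∑ l ∈ Finset.Icc 1 N, ∑' G, negDensity (r l) G := by
  rw [negNorm, Real.sq_sqrt (Finset.sum_nonneg fun _ _ => sq_nonneg _)]
  exact Finset.sum_congr rfl fun l _ => sobolevNorm_neg_one_sq _

theorem negNormOn_sq (r : ℕ → (Fin d → ℤ) → ℂ) (D : Finset (Fin d → ℤ)) :
    negNormOn N r D ^ 2 = ∑ l ∈ Finset.Icc 1 N, ∑ G ∈ D, negDensity (r l) G :=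
  Real.sq_sqrt (Finset.sum_nonneg fun l _ => Finset.sum_nonneg fun G _ => negDensity_nonneg (r l) G)

theorem tsum_indicator_finset (D : Finset (Fin d → ℤ)) (f : (Fin d → ℤ) → ℝ) :
    ∑' G, (D : Set (Fin d → ℤ)).indicator f G = ∑ G ∈ D, f G := by
  rw [tsum_eq_sum (s := D) fun G hG => Set.indicator_of_notMem (by exact_mod_cast hG) f]
  exact Finset.sum_congr rfl fun G hG => Set.indicator_of_mem (by exact_mod_cast hG) f

theorem negNorm_nonneg (r : ℕ → (Fin d → ℤ) → ℂ) : 0 ≤ negNorm N r := Real.sqrt_nonneg _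

theorem negNormOn_nonneg (r : ℕ → (Fin d → ℤ) → ℂ) (D : Finset (Fin d → ℤ)) :
    0 ≤ negNormOn N r D := Real.sqrt_nonneg _

theorem negNormOn_le_negNorm {r : ℕ → (Fin d → ℤ) → ℂ}
    (hr : ∀ l ∈ Finset.Icc 1 N, MemSobolev (-1) (r l)) (D : Finset (Fin d → ℤ)) :
    negNormOn N r D ≤ negNorm N r := by
  refine le_of_sq_le_sq ?_ (negNorm_nonneg r)
  rw [negNormOn_sq, negNorm_sq]
  exact Finset.sum_le_sum fun l hl =>
    (hr l hl).1.sum_le_tsum D fun G _ => negDensity_nonneg _ G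

/-- The weighted coefficients on `D`, as an element of a Euclidean space. -/
def weightedTuple (N : ℕ) (r : ℕ → (Fin d → ℤ) → ℂ) (D : Finset (Fin d → ℤ)) :
    EuclideanSpace ℂ ((Finset.Icc 1 N) × D) :=
  WithLp.toLp 2 fun p => (((1 + normSq (p.2 : Fin d → ℤ)) ^ (-1 / 2 : ℝ) : ℝ) : ℂ) * r p.1 p.2

theorem norm_weightedTuple (r : ℕ → (Fin d → ℤ) → ℂ) (D : Finset (Fin d → ℤ)) :
    ‖weightedTuple N r D‖ = negNormOn N r D := by
  rw [EuclideanSpace.norm_eq, negNormOn, Fintype.sum_prod_type,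
    ← Finset.sum_coe_sort (Finset.Icc 1 N)]
  congr 1
  refine Finset.sum_congr rfl fun l _ => ?_
  rw [← Finset.sum_coe_sort D]
  refine Finset.sum_congr rfl fun G _ => ?_
  have hG : 0 ≤ 1 + normSq (G : Fin d → ℤ) := by linarith [normSq_nonneg (G : Fin d → ℤ)]
  change ‖(((1 + normSq (G : Fin d → ℤ)) ^ (-1 / 2 : ℝ) : ℝ) : ℂ) * r l G‖ ^ 2 = _
  rw [norm_mul, mul_pow, Complex.norm_real, Real.norm_of_nonneg (Real.rpow_nonneg hG _),
    ← Real.rpow_natCast, ← Real.rpow_mul hG]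
  norm_num

theorem negNormOn_le_add (r r' : ℕ → (Fin d → ℤ) → ℂ) (D : Finset (Fin d → ℤ)) :
    negNormOn N r D ≤ negNormOn N r' D + negNormOn N (r - r') D := by
  rw [← norm_weightedTuple, ← norm_weightedTuple, ← norm_weightedTuple]
  have h1 : weightedTuple N r D = weightedTuple N r' D + weightedTuple N (r - r') D := by
    ext p
    simp [weightedTuple]
    ring
  rw [h1]
  exact norm_add_le _ _

theorem memSobolev_neg_one_sub {c c' : (Fin d → ℤ) → ℂ} (hc : MemSobolev (-1) c)
    (hc' : MemSobolev (-1) c') : MemSobolev (-1) (c - c') := by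
  constructor
  · refine Summable.of_nonneg_of_le (negDensity_nonneg (c - c')) (fun G => ?_)
      ((hc.1.mul_left 2).add (hc'.1.mul_left 2))
    have h1 := norm_add_sq_le (c G) (-c' G)
    rw [norm_neg, ← sub_eq_add_neg] at h1
    change (1 + normSq G) ^ (-1 : ℝ) * ‖c G - c' G‖ ^ 2 ≤ _
    have h2 : 0 ≤ (1 + normSq G) ^ (-1 : ℝ) :=
      Real.rpow_nonneg (by linarith [normSq_nonneg G]) _
    nlinarith [mul_le_mul_of_nonneg_left h1 h2]
  · intro G
    rw [Pi.sub_apply, Pi.sub_apply, map_sub, hc.2, hc'.2]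

/-- The `H_p^{-1}` norm of a tuple is the supremum of those of its finite truncations. -/
theorem negNorm_le_of_forall_negNormOn_le {r : ℕ → (Fin d → ℤ) → ℂ}
    (hr : ∀ l ∈ Finset.Icc 1 N, MemSobolev (-1) (r l)) {b : ℝ} (hb : 0 ≤ b)
    (h : ∀ D, negNormOn N r D ≤ b) : negNorm N r ≤ b := by
  refine le_of_sq_le_sq ?_ hb
  rw [negNorm_sq]
  have h1 : HasSum (fun G => ∑ l ∈ Finset.Icc 1 N, negDensity (r l) G)
      (∑ l ∈ Finset.Icc 1 N, ∑' G, negDensity (r l) G) :=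
    hasSum_sum fun l hl => (hr l hl).1.hasSum
  refine hasSum_le_of_sum_le h1 fun D => ?_
  rw [Finset.sum_comm, ← negNormOn_sq]
  exact pow_le_pow_left₀ (negNormOn_nonneg r D) (h D) 2

/-- The triangle inequality for the `H_p^{-1}` norm of tuples. -/
theorem negNorm_le_add {r r' : ℕ → (Fin d → ℤ) → ℂ}
    (hr : ∀ l ∈ Finset.Icc 1 N, MemSobolev (-1) (r l))
    (hr' : ∀ l ∈ Finset.Icc 1 N, MemSobolev (-1) (r' l)) :
    negNorm N r ≤ negNorm N r' + negNorm N (r - r') :=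
  negNorm_le_of_forall_negNormOn_le hr (add_nonneg (negNorm_nonneg _) (negNorm_nonneg _)) fun D =>
    (negNormOn_le_add r r' D).trans (add_le_add (negNormOn_le_negNorm hr' D)
      (negNormOn_le_negNorm (fun l hl => memSobolev_neg_one_sub (hr l hl) (hr' l hl)) D))

theorem negNormOn_sub_comm (r r' : ℕ → (Fin d → ℤ) → ℂ) (D : Finset (Fin d → ℤ)) :
    negNormOn N (r - r') D = negNormOn N (r' - r) D := by
  rw [negNormOn, negNormOn]
  simp only [Pi.sub_apply, norm_sub_rev]

theorem negNorm_sub_comm (r r' : ℕ → (Fin d → ℤ) → ℂ) :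
    negNorm N (r - r') = negNorm N (r' - r) := by
  simp only [negNorm, sobolevNorm, Pi.sub_apply, norm_sub_rev]

end Residual

end Planewave

namespace Planewave

/-! ### Comparison of the whole cluster with its Galerkin approximation -/

section Cluster

theorem offset_eq_sum {m : ℕ} (q : Fin m → ℕ) (i : Fin m) :
    offset q i = ∑ j : Fin i, q (Fin.castLE i.2.le j) := by
  rw [offset]
  symm
  refine Finset.sum_bij (fun j _ => Fin.castLE i.2.le j) (fun j _ => ?_) (fun j _ j' _ hjj => ?_)
    (fun j hj => ?_) (fun j _ => rfl)
  · rw [Finset.mem_filter, Fin.lt_def]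
    exact ⟨Finset.mem_univ _, j.2⟩
  · exact Fin.castLE_injective _ hjj
  · exact ⟨⟨j, Fin.lt_def.1 (Finset.mem_filter.1 hj).2⟩, Finset.mem_univ _, rfl⟩

/-- A sum over the cluster, grouped by the distinct eigenvalues. -/
theorem sum_Icc_eq_sum_blocks {m : ℕ} (q : Fin m → ℕ) (f : ℕ → ℝ) :
    ∑ l ∈ Finset.Icc 1 (∑ i, q i), f l = ∑ i, ∑ j : Fin (q i), f (offset q i + 1 + j) := by
  have h1 : ∑ l ∈ Finset.Icc 1 (∑ i, q i), f l = ∑ x : Fin (∑ i, q i), f (x + 1) := by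
    rw [Fin.sum_univ_eq_sum_range (fun x => f (x + 1)), Finset.range_eq_Ico,
      Finset.sum_Ico_add' f 0 _ 1]
    rfl
  rw [h1, ← finSigmaFinEquiv.sum_comp, Fintype.sum_sigma]
  refine Finset.sum_congr rfl fun i _ => Finset.sum_congr rfl fun j _ => ?_
  rw [finSigmaFinEquiv_apply, offset_eq_sum]
  congr 1
  ring

theorem offset_add_le {m : ℕ} (q : Fin m → ℕ) (i : Fin m) : offset q i + q i ≤ ∑ j, q j := by
  rw [offset, add_comm, ← Finset.sum_insert (by simp)]
  exact Finset.sum_le_sum_of_subset (Finset.subset_univ _)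

theorem mem_Icc_of_block {m : ℕ} (q : Fin m → ℕ) (i : Fin m) (j : Fin (q i)) :
    offset q i + 1 + j ∈ Finset.Icc 1 (∑ i, q i) := by
  have h1 := offset_add_le q i
  have h2 := j.2
  rw [Finset.mem_Icc]
  omega

theorem exists_pos_forall_le {ι : Type*} [Finite ι] (f : ι → ℝ) (hf : ∀ i, 0 < f i) :
    ∃ c > 0, ∀ i, c ≤ f i := by
  rcases isEmpty_or_nonempty ι with hι | hι
  · exact ⟨1, one_pos, fun i => isEmptyElim i⟩
  · obtain ⟨i, hi⟩ := Finite.exists_min f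
    exact ⟨f i, hf i, hi⟩

theorem exists_pos_forall_ge {ι : Type*} [Finite ι] (f : ι → ℝ) : ∃ c > 0, ∀ i, f i ≤ c := by
  rcases isEmpty_or_nonempty ι with hι | hι
  · exact ⟨1, one_pos, fun i => isEmptyElim i⟩
  · obtain ⟨i, hi⟩ := Finite.exists_max f
    exact ⟨max (f i) 1, lt_max_of_lt_right one_pos, fun j => (hi j).trans (le_max_left _ _)⟩

variable {E : Type*} [NormedAddCommGroup E] [InnerProductSpace ℝ E]

theorem exists_isEigenbasis {K : E →L[ℝ] E} {μ : ℝ} (hμ : 0 < μ)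
    [FiniteDimensional ℝ (eigSub K ⊤ μ)] {n : ℕ} (hn : n = Module.finrank ℝ (eigSub K ⊤ μ)) :
    ∃ φ : Fin n → E, IsEigenbasis K μ φ := by
  subst hn
  set b := stdOrthonormalBasis ℝ (eigSub K ⊤ μ)
  have hmem : ∀ k, Real.sqrt μ • (b k : E) ∈ eigSub K ⊤ μ := fun k =>
    Submodule.smul_mem _ _ (b k).2
  have hs : Real.sqrt μ * Real.sqrt μ = μ := Real.mul_self_sqrt hμ.le
  refine ⟨fun k => Real.sqrt μ • (b k : E), hμ, hmem, fun k k' => ?_, ?_⟩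
  · have h1 := (hmem k).2 _ (show Real.sqrt μ • (b k' : E) ∈ (⊤ : Submodule ℝ E) from trivial)
    have h2 := orthonormal_iff_ite.1 b.orthonormal k k'
    rw [Submodule.coe_inner] at h2
    rw [real_inner_smul_left, real_inner_smul_right, h2, ← mul_assoc, hs] at h1
    exact (mul_left_cancel₀ hμ.ne' h1).symm
  · intro x hx
    have h1 := b.sum_repr ⟨x, hx⟩
    have h2 : x = ∑ k, b.repr ⟨x, hx⟩ k • (b k : E) := by
      have := congrArg Subtype.val h1
      simpa using this.symm
    rw [h2]
    refine Submodule.sum_mem _ fun k _ => ?_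
    have h3 : b.repr ⟨x, hx⟩ k • (b k : E) =
        (b.repr ⟨x, hx⟩ k * (Real.sqrt μ)⁻¹) • (Real.sqrt μ • (b k : E)) := by
      rw [smul_smul, mul_assoc, inv_mul_cancel₀ (Real.sqrt_pos.2 hμ).ne', mul_one]
    rw [h3]
    exact Submodule.smul_mem _ _ (Submodule.subset_span ⟨k, rfl⟩)

/-- The squared error of the best approximation of a finite family from `W`. -/
def bestError {m : ℕ} {q : Fin m → ℕ} (φ : (i : Fin m) → Fin (q i) → E) (W : Submodule ℝ E)
    [W.HasOrthogonalProjection] : ℝ :=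
  ∑ i, ∑ k, ‖φ i k - W.starProjection (φ i k)‖ ^ 2

/-- For sufficiently accurate spaces, residual-type quantities of the Galerkin eigenvectors agree,
up to a small fraction of the best approximation error, with those of the exact eigenvectors, and
the approximate eigenspaces have a distance to the exact ones of the order of that error. -/
theorem IsAbstractCluster.exists_comparison [CompleteSpace E] {K : E →L[ℝ] E}
    (hK : IsSolutionOperator K) {k₀ N m : ℕ} {lam : Fin m → ℝ} {q : Fin m → ℕ}
    (hc : IsAbstractCluster K k₀ N m lam q) :
    ∃ φ : (i : Fin m) → Fin (q i) → E, (∀ i, IsEigenbasis K (lam i) (φ i)) ∧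
      ∃ C > 0, ∀ ε > 0, ∃ ρ > 0, ∀ (W : Submodule ℝ E) [W.HasOrthogonalProjection] (u : ℕ → E),
        (∀ l ∈ Finset.Icc 1 N, u l ∈ eigSub K W (eigVal K W (k₀ + l))) →
        (∀ l ∈ Finset.Icc 1 N, ∀ l' ∈ Finset.Icc 1 N,
          inner ℝ (K (u l)) (u l') = if l = l' then (1 : ℝ) else 0) →
        (∀ x, ‖K x - W.starProjection (K x)‖ ≤ ρ * ‖x‖) →
        (∀ Q : E →ₗ[ℝ] E, (∀ x, ‖Q x‖ ≤ ‖x - W.starProjection x‖) →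
          |∑ l ∈ Finset.Icc 1 N, ‖Q (eigVal K W (k₀ + l) • K (u l))‖ ^ 2 -
            ∑ i, ∑ k, ‖Q (φ i k)‖ ^ 2| ≤ ε * bestError φ W) ∧
        (∀ i, ∀ v ∈ Submodule.span ℝ (u '' Set.Icc (offset q i + 1) (offset q i + q i)),
          ∃ x ∈ eigSub K ⊤ (lam i), ‖v - x‖ ≤ C * Real.sqrt (bestError φ W) * ‖v‖) ∧
        (∀ i, ∀ x ∈ eigSub K ⊤ (lam i),
          ∃ v ∈ Submodule.span ℝ (u '' Set.Icc (offset q i + 1) (offset q i + q i)),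
            ‖x - v‖ ≤ C * Real.sqrt (bestError φ W) * ‖x‖) := by
  have hφ : ∀ i, ∃ φ : Fin (q i) → E, IsEigenbasis K (lam i) φ := fun i => by
    have := hc.finiteDimensional hK i
    exact exists_isEigenbasis (hc.pos hK i) (hc.multiplicity i)
  choose φ hφ using hφ
  refine ⟨φ, hφ, ?_⟩
  choose C hC ρ₀ hρ₀ ε₀ hε₀ hmain using fun i => hK.exists_comparison (hφ i)
  obtain ⟨Cm, hCm, hCle⟩ := exists_pos_forall_ge C
  obtain ⟨ρm, hρm, hρle⟩ := exists_pos_forall_le ρ₀ hρ₀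
  obtain ⟨εm, hεm, hεle⟩ := exists_pos_forall_le ε₀ hε₀
  have hclose : ∀ l : Finset.Icc 1 N, ∃ ρ₀ > 0, ∀ (W : Submodule ℝ E) [W.HasOrthogonalProjection],
      (∀ x, ‖K x - W.starProjection (K x)‖ ≤ ρ₀ * ‖x‖) →
      |eigVal K W (k₀ + l) - eigVal K ⊤ (k₀ + l)| ≤ εm := fun l => by
    have hl := Finset.mem_Icc.1 l.2
    exact exists_eigVal_close hK (hc.levelSet_nonempty hK (by omega)) (by omega) hεm
  choose ρ₁ hρ₁ hclose using hclose
  obtain ⟨ρe, hρe, hρele⟩ := exists_pos_forall_le ρ₁ hρ₁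
  refine ⟨Cm, hCm, fun ε hε => ⟨min (ε / Cm) (min ρm ρe), by positivity, ?_⟩⟩
  intro W _ u hu horth hW
  set ρ := min (ε / Cm) (min ρm ρe) with hρ
  have hρ0 : 0 < ρ := by positivity
  have hρε : Cm * ρ ≤ ε := by
    rw [← le_div_iff₀' hCm]; exact min_le_left _ _
  have hblock : ∀ i, IsGalerkin K W (fun j : Fin (q i) => eigVal K W (k₀ + (offset q i + 1 + j)))
      (fun j => u (offset q i + 1 + j)) := by
    intro i
    have hmem : ∀ j : Fin (q i), offset q i + 1 + j ∈ Finset.Icc 1 N := fun j => by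
      rw [hc.total]; exact mem_Icc_of_block q i j
    refine ⟨fun j => hu _ (hmem j), fun j j' => ?_⟩
    rw [horth _ (hmem j) _ (hmem j')]
    simp [Fin.ext_iff]
  have hval : ∀ i, ∀ j : Fin (q i),
      |eigVal K W (k₀ + (offset q i + 1 + j)) - lam i| ≤ ε₀ i := by
    intro i j
    have h1 := hclose ⟨offset q i + 1 + j, by rw [hc.total]; exact mem_Icc_of_block q i j⟩ W
      fun x => (hW x).trans (mul_le_mul_of_nonneg_right
        (((min_le_right _ _).trans (min_le_right _ _)).trans (hρele _)) (norm_nonneg x))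
    have hj := j.2
    rw [hc.eigVal_eq hK i (by dsimp only; omega) (by dsimp only; omega)] at h1
    exact h1.trans (hεle i)
  have hcomp := fun i => hmain i W _ _ ρ (hblock i) (hval i) hρ0.le
    (((min_le_right _ _).trans (min_le_left _ _)).trans (hρle i)) hW
  have herr0 : ∀ i, 0 ≤ ∑ k, ‖φ i k - W.starProjection (φ i k)‖ ^ 2 := fun i =>
    Finset.sum_nonneg fun _ _ => sq_nonneg _
  have herr : ∀ i, ∑ k, ‖φ i k - W.starProjection (φ i k)‖ ^ 2 ≤ bestError φ W := fun i =>
    Finset.single_le_sum (f := fun i => ∑ k, ‖φ i k - W.starProjection (φ i k)‖ ^ 2)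
      (fun i _ => herr0 i) (Finset.mem_univ i)
  have hspan : ∀ i, Submodule.span ℝ (u '' Set.Icc (offset q i + 1) (offset q i + q i)) =
      Submodule.span ℝ (Set.range fun j : Fin (q i) => u (offset q i + 1 + j)) := by
    intro i
    congr 1
    ext x
    constructor
    · rintro ⟨l, ⟨h1, h2⟩, rfl⟩
      refine ⟨⟨l - (offset q i + 1), by omega⟩, ?_⟩
      dsimp only
      congr 1; omega
    · rintro ⟨j, rfl⟩
      have hj := j.2
      exact ⟨offset q i + 1 + j, ⟨by omega, by omega⟩, rfl⟩
  have hfac : ∀ i, C i * Real.sqrt (∑ k, ‖φ i k - W.starProjection (φ i k)‖ ^ 2) ≤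
      Cm * Real.sqrt (bestError φ W) := fun i =>
    mul_le_mul (hCle i) (Real.sqrt_le_sqrt (herr i)) (Real.sqrt_nonneg _) hCm.le
  refine ⟨fun Q hQ => ?_, fun i v hv => ?_, fun i x hx => ?_⟩
  · rw [hc.total, sum_Icc_eq_sum_blocks q
      (fun l => ‖Q (eigVal K W (k₀ + l) • K (u l))‖ ^ 2), ← Finset.sum_sub_distrib]
    refine (Finset.abs_sum_le_sum_abs _ _).trans ?_
    rw [bestError, Finset.mul_sum]
    refine Finset.sum_le_sum fun i _ => ((hcomp i).1 Q hQ).trans ?_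
    refine mul_le_mul_of_nonneg_right ?_ (herr0 i)
    exact (mul_le_mul_of_nonneg_right (hCle i) hρ0.le).trans hρε
  · rw [hspan] at hv
    obtain ⟨x, hx, hle⟩ := (hcomp i).2.1 v hv
    rw [← (hφ i).eigSub_eq] at hx
    exact ⟨x, hx, hle.trans (mul_le_mul_of_nonneg_right (hfac i) (norm_nonneg v))⟩
  · rw [(hφ i).eigSub_eq] at hx
    obtain ⟨v, hv, hle⟩ := (hcomp i).2.2 x hx
    rw [hspan]
    exact ⟨v, hv, hle.trans (mul_le_mul_of_nonneg_right (hfac i) (norm_nonneg x))⟩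

end Cluster

end Planewave

namespace Planewave

variable {d : ℕ} {V : L2p d} {νlow νup : ℝ}

/-! ### The planewave discretization as a Galerkin method in the energy space -/

section Translation

variable {h : IsPotential V νlow νup}

theorem H1p_eq_image (h : IsPotential V νlow νup) :
    H1p d = toL2 h '' ((⊤ : Submodule ℝ (EnergySpace h)) : Set (EnergySpace h)) := by
  ext u
  constructor
  · intro hu
    obtain ⟨x, hx⟩ := exists_toL2Lin_eq (h := h) hu
    exact ⟨x, trivial, hx⟩
  · rintro ⟨x, -, rfl⟩
    exact toL2_mem x

theorem aForm_toL2 (x y : EnergySpace h) : aForm V (toL2 h x) (toL2 h y) = inner ℝ x y := rfl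

theorem aNorm_toL2 (x : EnergySpace h) : aNorm V (toL2 h x) = ‖x‖ := (norm_eq_aNorm x).symm

theorem eigenspace_image (W : Submodule ℝ (EnergySpace h)) (μ : ℝ) :
    eigenspace V (toL2 h '' W) μ = toL2 h '' eigSub (solOp h) W μ := by
  ext u
  constructor
  · rintro ⟨⟨x, hx, rfl⟩, hu⟩
    refine ⟨x, ⟨hx, fun v hv => ?_⟩, rfl⟩
    rw [inner_solOp, ← hu _ ⟨v, hv, rfl⟩, aForm_toL2]
  · rintro ⟨x, ⟨hx, hx'⟩, rfl⟩
    refine ⟨⟨x, hx, rfl⟩, ?_⟩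
    rintro _ ⟨v, hv, rfl⟩
    rw [aForm_toL2, hx' v hv, inner_solOp]

theorem span_image (S : Set (EnergySpace h)) :
    Submodule.span ℝ (toL2 h '' S) = (Submodule.span ℝ S).map (toL2Lin h) :=
  (Submodule.map_span (toL2Lin h) S).symm

theorem eigenvalue_image (W : Submodule ℝ (EnergySpace h)) (k : ℕ) :
    eigenvalue V (toL2 h '' W) k = eigVal (solOp h) W k := by
  rw [eigenvalue, eigVal]
  congr 2
  ext t
  have h1 : {u | ∃ μ ≤ t, u ∈ eigenspace V (toL2 h '' W) μ} =
      toL2 h '' {u | ∃ μ ∈ Set.Iic t, u ∈ eigSub (solOp h) W μ} := by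
    ext u
    constructor
    · rintro ⟨μ, hμ, hu⟩
      rw [eigenspace_image] at hu
      obtain ⟨x, hx, rfl⟩ := hu
      exact ⟨x, ⟨μ, hμ, hx⟩, rfl⟩
    · rintro ⟨x, ⟨μ, hμ, hx⟩, rfl⟩
      exact ⟨μ, hμ, by rw [eigenspace_image]; exact ⟨x, hx, rfl⟩⟩
  change (k : Cardinal) ≤ _ ↔ (k : Cardinal) ≤ _
  rw [h1, span_image]
  rw [← (Submodule.equivMapOfInjective (toL2Lin h) toL2Lin_injective
    (Submodule.span ℝ {u | ∃ μ ∈ Set.Iic t, u ∈ eigSub (solOp h) W μ})).rank_eq]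
  rfl

theorem IsCluster.isAbstractCluster (h : IsPotential V νlow νup) {k₀ N m : ℕ} {lam : Fin m → ℝ}
    {q : Fin m → ℕ} (hc : IsCluster V k₀ N m lam q) :
    IsAbstractCluster (solOp h) k₀ N m lam q := by
  have hval : ∀ k, eigenvalue V (H1p d) k = eigVal (solOp h) ⊤ k := fun k => by
    rw [H1p_eq_image h, eigenvalue_image]
  refine ⟨?_, ?_, hc.strictMono, ?_, fun i => ?_, hc.total⟩
  · simpa only [hval] using hc.gap_below
  · simpa only [hval] using hc.gap_above
  · simpa only [hval] using hc.values
  · rw [hc.multiplicity, H1p_eq_image h, eigenspace_image, span_image, Submodule.span_eq]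
    exact (Submodule.equivMapOfInjective (toL2Lin h) toL2Lin_injective _).finrank_eq.symm

theorem bestApprox_le {Y : Set (EnergySpace h)} {y : EnergySpace h} (hy : y ∈ Y)
    (x : EnergySpace h) : bestApprox V (toL2 h '' Y) (toL2 h x) ≤ ‖x - y‖ := by
  refine csInf_le ⟨0, ?_⟩ ⟨toL2 h y, ⟨y, hy, rfl⟩, ?_⟩
  · rintro _ ⟨v, -, rfl⟩
    exact Real.sqrt_nonneg _
  · simp only
    rw [← map_sub, aNorm_toL2]

theorem bestApprox_nonneg (Y : Set (L2p d)) (u : L2p d) : 0 ≤ bestApprox V Y u :=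
  Real.sInf_nonneg (by rintro _ ⟨v, -, rfl⟩; exact Real.sqrt_nonneg _)

theorem bestApprox_eq (W : Submodule ℝ (EnergySpace h)) [W.HasOrthogonalProjection]
    (x : EnergySpace h) : bestApprox V (toL2 h '' W) (toL2 h x) = ‖x - W.starProjection x‖ := by
  refine le_antisymm (bestApprox_le (W.starProjection_apply_mem x) x) ?_
  refine le_csInf ⟨_, ⟨toL2 h 0, ⟨0, W.zero_mem, rfl⟩, rfl⟩⟩ ?_
  rintro _ ⟨_, ⟨w, hw, rfl⟩, rfl⟩
  simp only
  rw [← map_sub, aNorm_toL2, Submodule.starProjection_minimal]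
  refine ciInf_le ⟨0, ?_⟩ (⟨w, hw⟩ : W)
  rintro _ ⟨v, rfl⟩
  exact norm_nonneg _

theorem oneSidedDist_nonneg (X Y : Set (L2p d)) : 0 ≤ oneSidedDist V X Y :=
  Real.sSup_nonneg (by rintro _ ⟨u, -, rfl⟩; exact bestApprox_nonneg _ _)

theorem oneSidedDist_le {X Y : Set (EnergySpace h)} {b : ℝ} (hb : 0 ≤ b)
    (hXY : ∀ x ∈ X, ∃ y ∈ Y, ‖x - y‖ ≤ b * ‖x‖) :
    oneSidedDist V (toL2 h '' X) (toL2 h '' Y) ≤ b := by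
  refine Real.sSup_le ?_ hb
  rintro _ ⟨_, ⟨⟨x, hx, rfl⟩, hx1⟩, rfl⟩
  obtain ⟨y, hy, hle⟩ := hXY x hx
  rw [aNorm_toL2] at hx1
  rw [hx1, mul_one] at hle
  exact (bestApprox_le hy x).trans hle

theorem tupleDist_le {m : ℕ} {X Y : Fin m → Set (L2p d)} {b : ℝ} (hb : 0 ≤ b)
    (hXY : ∀ i, oneSidedDist V (X i) (Y i) ≤ b) (hYX : ∀ i, oneSidedDist V (Y i) (X i) ≤ b) :
    tupleDist V X Y ≤ Real.sqrt m * b := by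
  rw [tupleDist, ← Real.sqrt_sq hb, ← Real.sqrt_mul (by positivity)]
  refine Real.sqrt_le_sqrt ?_
  calc ∑ i, spaceDist V (X i) (Y i) ^ 2 ≤ ∑ _i : Fin m, b ^ 2 :=
        Finset.sum_le_sum fun i _ => pow_le_pow_left₀
          ((oneSidedDist_nonneg _ _).trans (le_max_left _ _)) (max_le (hXY i) (hYX i)) 2
    _ = m * b ^ 2 := by simp

variable {k₀ N : ℕ} {𝔾 : Finset (Fin d → ℤ)}

/-- Discrete solutions correspond to Galerkin eigenvectors in the energy space. -/
theorem IsDiscreteSolution.exists_galerkin (h : IsPotential V νlow νup) {u : ℕ → L2p d}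
    (hu : IsDiscreteSolution V k₀ N 𝔾 u) : ∃ x : ℕ → EnergySpace h,
      (∀ l ∈ Finset.Icc 1 N, toL2 h (x l) = u l) ∧
      (∀ l ∈ Finset.Icc 1 N, x l ∈ eigSub (solOp h) (suppSub h (𝔾 : Set (Fin d → ℤ)))
        (eigVal (solOp h) (suppSub h (𝔾 : Set (Fin d → ℤ))) (k₀ + l))) ∧
      ∀ l ∈ Finset.Icc 1 N, ∀ l' ∈ Finset.Icc 1 N,
        inner ℝ (solOp h (x l)) (x l') = if l = l' then (1 : ℝ) else 0 := by
  classical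
  have h1 : ∀ l ∈ Finset.Icc 1 N, ∃ x ∈ eigSub (solOp h) (suppSub h (𝔾 : Set (Fin d → ℤ)))
      (eigVal (solOp h) (suppSub h (𝔾 : Set (Fin d → ℤ))) (k₀ + l)), toL2 h x = u l := by
    intro l hl
    have := hu.1 l hl
    rw [VSpace_eq_image (h := h), eigenvalue_image, eigenspace_image] at this
    exact this
  choose! x hx hxu using h1
  refine ⟨x, hxu, hx, fun l hl l' hl' => ?_⟩
  rw [inner_solOp, hxu l hl, hxu l' hl', hu.2 l hl l' hl']

/-- Comparison of the planewave approximation of the cluster with the exact eigenspaces. -/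
theorem IsCluster.exists_comparison (h : IsPotential V νlow νup) {m : ℕ} {lam : Fin m → ℝ}
    {q : Fin m → ℕ} (hc : IsCluster V k₀ N m lam q) :
    ∃ φ : (i : Fin m) → Fin (q i) → EnergySpace h,
      (∀ i k, toL2 h (φ i k) ∈ eigenspace V (H1p d) (lam i)) ∧
      ∃ C > 0, ∀ ε > 0, ∃ M : ℕ, ∀ 𝔾 : Finset (Fin d → ℤ), ballIndex d M ⊆ 𝔾 →
        ∀ u, IsDiscreteSolution V k₀ N 𝔾 u → ∃ x : ℕ → EnergySpace h,
        (∀ l ∈ Finset.Icc 1 N, toL2 h (x l) = u l) ∧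
        (∀ l ∈ Finset.Icc 1 N, (suppSub h (𝔾 : Set (Fin d → ℤ))).starProjection
          (eigenvalue V (VSpace 𝔾) (k₀ + l) • solOp h (x l)) = x l) ∧
        (∀ Q : EnergySpace h →ₗ[ℝ] EnergySpace h,
          (∀ y, ‖Q y‖ ≤ ‖y - (suppSub h (𝔾 : Set (Fin d → ℤ))).starProjection y‖) →
          |∑ l ∈ Finset.Icc 1 N, ‖Q (eigenvalue V (VSpace 𝔾) (k₀ + l) • solOp h (x l))‖ ^ 2 -
            ∑ i, ∑ k, ‖Q (φ i k)‖ ^ 2| ≤ ε * bestError φ (suppSub h (𝔾 : Set (Fin d → ℤ)))) ∧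
        tupleDist V (fun i => eigenspace V (H1p d) (lam i)) (fun i => discreteSpace q u i) ≤
          C * Real.sqrt (bestError φ (suppSub h (𝔾 : Set (Fin d → ℤ)))) := by
  have hK := isSolutionOperator_solOp h
  have hc' := hc.isAbstractCluster h
  obtain ⟨φ, hφ, C, hC, hmain⟩ := hc'.exists_comparison hK
  refine ⟨φ, fun i k => ?_, Real.sqrt m * C + 1, by positivity, fun ε hε => ?_⟩
  · rw [H1p_eq_image h, eigenspace_image]
    exact ⟨_, (hφ i).mem k, rfl⟩
  obtain ⟨ρ, hρ, hmain⟩ := hmain ε hε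
  obtain ⟨C', hC', happrox⟩ := exists_solOp_approx h
  obtain ⟨M, hM⟩ := exists_nat_ge (C' / ρ)
  refine ⟨M + 1, fun 𝔾 h𝔾 u hu => ?_⟩
  obtain ⟨x, hxu, hx, horth⟩ := hu.exists_galerkin h
  have hval : ∀ l, eigenvalue V (VSpace 𝔾) (k₀ + l) =
      eigVal (solOp h) (suppSub h (𝔾 : Set (Fin d → ℤ))) (k₀ + l) := fun l => by
    rw [VSpace_eq_image (h := h), eigenvalue_image]
  simp only [hval]
  obtain ⟨h1, h2, h3⟩ := hmain (suppSub h (𝔾 : Set (Fin d → ℤ))) x hx horth fun y => by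
    refine (happrox (M + 1) (by omega) 𝔾 h𝔾 y).trans
      (mul_le_mul_of_nonneg_right ?_ (norm_nonneg y))
    rw [div_le_iff₀ (by positivity)]
    rw [div_le_iff₀ hρ] at hM
    push_cast
    linarith
  refine ⟨x, hxu, fun l hl => ?_, h1, ?_⟩
  · refine Submodule.eq_starProjection_of_mem_of_inner_eq_zero (hx l hl).1 fun v hv => ?_
    rw [inner_sub_left, (hx l hl).2 v hv, real_inner_smul_left, sub_self]
  set b := Real.sqrt (bestError φ (suppSub h (𝔾 : Set (Fin d → ℤ)))) with hb
  have hb0 : 0 ≤ b := Real.sqrt_nonneg _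
  have hexact : ∀ i, eigenspace V (H1p d) (lam i) = toL2 h '' eigSub (solOp h) ⊤ (lam i) :=
    fun i => by rw [H1p_eq_image h, eigenspace_image]
  have hdisc : ∀ i, discreteSpace q u i =
      toL2 h '' Submodule.span ℝ (x '' Set.Icc (offset q i + 1) (offset q i + q i)) := by
    intro i
    have himg : u '' Set.Icc (offset q i + 1) (offset q i + q i) =
        toL2 h '' (x '' Set.Icc (offset q i + 1) (offset q i + q i)) := by
      rw [Set.image_image]
      refine Set.image_congr fun l hl => (hxu l ?_).symm
      have h4 := offset_add_le q i
      rw [← hc.total] at h4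
      rw [Finset.mem_Icc]
      exact ⟨by have := hl.1; omega, hl.2.trans h4⟩
    rw [discreteSpace, himg, span_image]
    rfl
  have h4 : tupleDist V (fun i => eigenspace V (H1p d) (lam i)) (fun i => discreteSpace q u i) ≤
      Real.sqrt m * (C * b) := by
    refine tupleDist_le (by positivity) (fun i => ?_) (fun i => ?_)
    · rw [hexact, hdisc]
      exact oneSidedDist_le (by positivity) (h3 i)
    · rw [hexact, hdisc]
      exact oneSidedDist_le (by positivity) (h2 i)
  refine h4.trans ?_
  nlinarith

end Translation

end Planewave

namespace Planewave

/-! ### One step of the adaptive algorithm -/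

section Projections

variable {E : Type*} [NormedAddCommGroup E] [InnerProductSpace ℝ E] {W W' : Submodule ℝ E}
  [W.HasOrthogonalProjection] [W'.HasOrthogonalProjection]

theorem starProjection_sub_starProjection (hW : W ≤ W') (x : E) :
    W'.starProjection x - W.starProjection x = W'.starProjection (x - W.starProjection x) := by
  rw [map_sub, Submodule.starProjection_eq_self_iff.2 (hW (W.starProjection_apply_mem x))]

theorem norm_starProjection_sub_le (hW : W ≤ W') (x : E) :
    ‖W'.starProjection x - W.starProjection x‖ ≤ ‖x - W.starProjection x‖ := by
  rw [starProjection_sub_starProjection hW]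
  exact W'.norm_starProjection_apply_le _

theorem norm_sub_starProjection_sq_eq_add (hW : W ≤ W') (x : E) :
    ‖x - W.starProjection x‖ ^ 2 =
      ‖x - W'.starProjection x‖ ^ 2 + ‖W'.starProjection x - W.starProjection x‖ ^ 2 := by
  have h1 : x - W.starProjection x = (x - W'.starProjection x) +
      (W'.starProjection x - W.starProjection x) := by abel
  have h2 : inner ℝ (x - W'.starProjection x) (W'.starProjection x - W.starProjection x) = 0 :=
    W'.starProjection_inner_eq_zero x _
      (W'.sub_mem (W'.starProjection_apply_mem x) (hW (W.starProjection_apply_mem x)))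
  conv_lhs => rw [h1, norm_add_sq_real, h2]
  ring

variable {m : ℕ} {q : Fin m → ℕ} (φ : (i : Fin m) → Fin (q i) → E)

theorem bestError_nonneg (W : Submodule ℝ E) [W.HasOrthogonalProjection] : 0 ≤ bestError φ W :=
  Finset.sum_nonneg fun _ _ => Finset.sum_nonneg fun _ _ => sq_nonneg _

theorem bestError_eq_add (hW : W ≤ W') : bestError φ W = bestError φ W' +
    ∑ i, ∑ k, ‖W'.starProjection (φ i k) - W.starProjection (φ i k)‖ ^ 2 := by
  simp only [bestError, ← Finset.sum_add_distrib, norm_sub_starProjection_sq_eq_add hW]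

end Projections

variable {d : ℕ} {V : L2p d} {νlow νup : ℝ} {h : IsPotential V νlow νup} {k₀ N : ℕ}
  {𝔾 𝔾' : Finset (Fin d → ℤ)} {u : ℕ → L2p d} {x : ℕ → EnergySpace h}

/-- The elliptic projection onto a planewave space. -/
abbrev projOn (h : IsPotential V νlow νup) (𝔾 : Finset (Fin d → ℤ)) :
    EnergySpace h →L[ℝ] EnergySpace h :=
  (suppSub h (𝔾 : Set (Fin d → ℤ))).starProjection

/-- The continuous solutions `w_l = λ_l K u_l`, whose elliptic projections are the discrete
eigenfunctions. -/
def liftedSol (h : IsPotential V νlow νup) (k₀ : ℕ) (𝔾 : Finset (Fin d → ℤ))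
    (x : ℕ → EnergySpace h) (l : ℕ) : EnergySpace h :=
  eigenvalue V (VSpace 𝔾) (k₀ + l) • solOp h (x l)

theorem suppSub_finset_mono (h𝔾 : 𝔾 ⊆ 𝔾') :
    suppSub h (𝔾 : Set (Fin d → ℤ)) ≤ suppSub h (𝔾' : Set (Fin d → ℤ)) :=
  suppSub_mono (by exact_mod_cast h𝔾)

theorem memSobolev_discreteResidual (hxu : ∀ l ∈ Finset.Icc 1 N, toL2 h (x l) = u l) :
    ∀ l ∈ Finset.Icc 1 N, MemSobolev (-1) (discreteResidual V k₀ 𝔾 u l) := fun l hl => by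
  rw [discreteResidual, ← hxu l hl]
  exact memSobolev_residual h _ (toL2_mem _)

/-- The `H_p^{-1}` norm of the residual on the modes of a larger index set is equivalent to the
energy norm of the increment of the elliptic projection. -/
theorem negNormOn_discreteResidual_bounds (hxu : ∀ l ∈ Finset.Icc 1 N, toL2 h (x l) = u l)
    (hx : ∀ l ∈ Finset.Icc 1 N, projOn h 𝔾 (liftedSol h k₀ 𝔾 x l) = x l)
    (h𝔾 : 𝔾 ⊆ 𝔾') (hsymm : IsSymm 𝔾') :
    negNormOn N (discreteResidual V k₀ 𝔾 u) 𝔾' ^ 2 ≤ max νup 1 * ∑ l ∈ Finset.Icc 1 N,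
        ‖projOn h 𝔾' (liftedSol h k₀ 𝔾 x l) - projOn h 𝔾 (liftedSol h k₀ 𝔾 x l)‖ ^ 2 ∧
      min νlow 1 * ∑ l ∈ Finset.Icc 1 N,
        ‖projOn h 𝔾' (liftedSol h k₀ 𝔾 x l) - projOn h 𝔾 (liftedSol h k₀ 𝔾 x l)‖ ^ 2 ≤
      negNormOn N (discreteResidual V k₀ 𝔾 u) 𝔾' ^ 2 := by
  have key : ∀ l ∈ Finset.Icc 1 N, _ := fun l hl => by
    have h1 := starProjection_sub_starProjection (suppSub_finset_mono (h := h) h𝔾)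
      (liftedSol h k₀ 𝔾 x l)
    have h2 := tsum_negDensity_bounds (h := h) (S := (𝔾' : Set (Fin d → ℤ)))
      (fun G hG => by exact_mod_cast hsymm G (by exact_mod_cast hG))
      (memSobolev_discreteResidual (k₀ := k₀) (𝔾 := 𝔾) hxu l hl)
      (y := projOn h 𝔾' (liftedSol h k₀ 𝔾 x l) - projOn h 𝔾 (liftedSol h k₀ 𝔾 x l))
      (by rw [h1]; exact Submodule.starProjection_apply_mem _ _)
      (fun v hv => by
        have h3 := hasSum_inner_residual (h := h) (eigenvalue V (VSpace 𝔾) (k₀ + l)) (x l) v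
        rw [hxu l hl] at h3
        rw [h1, Submodule.inner_starProjection_left_eq_right,
          Submodule.starProjection_eq_self_iff.2 hv, hx l hl]
        exact h3)
    rw [tsum_indicator_finset] at h2
    exact h2
  rw [negNormOn_sq, Finset.mul_sum, Finset.mul_sum]
  exact ⟨Finset.sum_le_sum fun l hl => (key l hl).1, Finset.sum_le_sum fun l hl => (key l hl).2⟩

/-- The `H_p^{-1}` norm of the full residual is equivalent to the energy error of the elliptic
projection. -/
theorem negNorm_discreteResidual_bounds (hxu : ∀ l ∈ Finset.Icc 1 N, toL2 h (x l) = u l)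
    (hx : ∀ l ∈ Finset.Icc 1 N, projOn h 𝔾 (liftedSol h k₀ 𝔾 x l) = x l) :
    negNorm N (discreteResidual V k₀ 𝔾 u) ^ 2 ≤ max νup 1 * ∑ l ∈ Finset.Icc 1 N,
        ‖liftedSol h k₀ 𝔾 x l - projOn h 𝔾 (liftedSol h k₀ 𝔾 x l)‖ ^ 2 ∧
      min νlow 1 * ∑ l ∈ Finset.Icc 1 N,
        ‖liftedSol h k₀ 𝔾 x l - projOn h 𝔾 (liftedSol h k₀ 𝔾 x l)‖ ^ 2 ≤
      negNorm N (discreteResidual V k₀ 𝔾 u) ^ 2 := by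
  have key : ∀ l ∈ Finset.Icc 1 N, _ := fun l hl => by
    have h2 := tsum_negDensity_bounds (h := h) (S := Set.univ) (fun G _ => Set.mem_univ _)
      (memSobolev_discreteResidual (k₀ := k₀) (𝔾 := 𝔾) hxu l hl)
      (y := liftedSol h k₀ 𝔾 x l - projOn h 𝔾 (liftedSol h k₀ 𝔾 x l))
      (fun G hG => absurd (Set.mem_univ G) hG)
      (fun v _ => by
        have h3 := hasSum_inner_residual (h := h) (eigenvalue V (VSpace 𝔾) (k₀ + l)) (x l) v
        rw [hxu l hl] at h3
        rw [hx l hl]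
        exact h3)
    rw [Set.indicator_univ] at h2
    exact h2
  rw [negNorm_sq, Finset.mul_sum, Finset.mul_sum]
  exact ⟨Finset.sum_le_sum fun l hl => (key l hl).1, Finset.sum_le_sum fun l hl => (key l hl).2⟩

/-- The residual of a discrete solution is orthogonal to the discrete space, and so its modes in `𝔾`
do not contribute. -/
theorem negNormOn_discreteResidual_sdiff (hxu : ∀ l ∈ Finset.Icc 1 N, toL2 h (x l) = u l)
    (hx : ∀ l ∈ Finset.Icc 1 N, projOn h 𝔾 (liftedSol h k₀ 𝔾 x l) = x l)
    (h𝔾 : 𝔾 ⊆ 𝔾') (hsymm : IsSymm 𝔾) :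
    negNormOn N (discreteResidual V k₀ 𝔾 u) (𝔾' \ 𝔾) ^ 2 =
      negNormOn N (discreteResidual V k₀ 𝔾 u) 𝔾' ^ 2 := by
  have h1 := (negNormOn_discreteResidual_bounds hxu hx subset_rfl hsymm).1
  simp only [sub_self, norm_zero, ne_eq, OfNat.ofNat_ne_zero, not_false_eq_true, zero_pow,
    Finset.sum_const_zero, mul_zero] at h1
  have h2 := le_antisymm h1 (sq_nonneg _)
  rw [negNormOn_sq] at h2
  rw [negNormOn_sq, negNormOn_sq]
  simp only [← Finset.sum_sdiff h𝔾, Finset.sum_add_distrib, h2, add_zero]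

section Step

variable {m : ℕ} {q : Fin m → ℕ} {φ : (i : Fin m) → Fin (q i) → EnergySpace h} {ε : ℝ}

/-- The property of the lifted discrete solutions that is provided by the comparison theorem. -/
def IsComparable (φ : (i : Fin m) → Fin (q i) → EnergySpace h) (k₀ N : ℕ)
    (𝔾 : Finset (Fin d → ℤ)) (x : ℕ → EnergySpace h) (ε : ℝ) : Prop :=
  ∀ Q : EnergySpace h →ₗ[ℝ] EnergySpace h, (∀ y, ‖Q y‖ ≤ ‖y - projOn h 𝔾 y‖) →
    |∑ l ∈ Finset.Icc 1 N, ‖Q (liftedSol h k₀ 𝔾 x l)‖ ^ 2 - ∑ i, ∑ k, ‖Q (φ i k)‖ ^ 2| ≤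
      ε * bestError φ (suppSub h (𝔾 : Set (Fin d → ℤ)))

theorem IsComparable.residual (hcomp : IsComparable φ k₀ N 𝔾 x ε) :
    |∑ l ∈ Finset.Icc 1 N, ‖liftedSol h k₀ 𝔾 x l - projOn h 𝔾 (liftedSol h k₀ 𝔾 x l)‖ ^ 2 -
      bestError φ (suppSub h (𝔾 : Set (Fin d → ℤ)))| ≤
      ε * bestError φ (suppSub h (𝔾 : Set (Fin d → ℤ))) :=
  hcomp ((1 - projOn h 𝔾 : EnergySpace h →L[ℝ] EnergySpace h) : EnergySpace h →ₗ[ℝ] EnergySpace h)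
    fun _ => le_rfl

theorem IsComparable.increment (hcomp : IsComparable φ k₀ N 𝔾 x ε) (h𝔾 : 𝔾 ⊆ 𝔾') :
    |∑ l ∈ Finset.Icc 1 N,
        ‖projOn h 𝔾' (liftedSol h k₀ 𝔾 x l) - projOn h 𝔾 (liftedSol h k₀ 𝔾 x l)‖ ^ 2 -
      (bestError φ (suppSub h (𝔾 : Set (Fin d → ℤ))) -
        bestError φ (suppSub h (𝔾' : Set (Fin d → ℤ))))| ≤
      ε * bestError φ (suppSub h (𝔾 : Set (Fin d → ℤ))) := by
  have h1 := hcomp ((projOn h 𝔾' - projOn h 𝔾 : EnergySpace h →L[ℝ] EnergySpace h) :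
    EnergySpace h →ₗ[ℝ] EnergySpace h)
    fun y => norm_starProjection_sub_le (suppSub_finset_mono (h := h) h𝔾) y
  have h2 := bestError_eq_add φ (suppSub_finset_mono (h := h) h𝔾)
  rw [h2, add_sub_cancel_left, ← h2]
  exact h1

/-- Error reduction: a marking that captures a fixed fraction of the residual contracts the best
approximation error, by Pythagoras' identity. -/
theorem bestError_le_of_marking (hxu : ∀ l ∈ Finset.Icc 1 N, toL2 h (x l) = u l)
    (hx : ∀ l ∈ Finset.Icc 1 N, projOn h 𝔾 (liftedSol h k₀ 𝔾 x l) = x l)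
    (hcomp : IsComparable φ k₀ N 𝔾 x ε) (hε : 0 ≤ ε) {D : Finset (Fin d → ℤ)}
    (hsymm : IsSymm (𝔾 ∪ D)) {t : ℝ} (ht0 : 0 ≤ t) (ht1 : min νlow 1 / max νup 1 * t ^ 2 ≤ 1)
    (hD : t * negNorm N (discreteResidual V k₀ 𝔾 u) ≤
      negNormOn N (discreteResidual V k₀ 𝔾 u) D) :
    bestError φ (suppSub h ((𝔾 ∪ D : Finset (Fin d → ℤ)) : Set (Fin d → ℤ))) ≤
      (1 + 2 * ε - min νlow 1 / max νup 1 * t ^ 2) *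
        bestError φ (suppSub h (𝔾 : Set (Fin d → ℤ))) := by
  have hsub : 𝔾 ⊆ 𝔾 ∪ D := Finset.subset_union_left
  have h1 := abs_le.1 hcomp.residual
  have h2 := abs_le.1 (hcomp.increment hsub)
  have h3 := (negNormOn_discreteResidual_bounds hxu hx hsub hsymm).1
  have h4 := (negNorm_discreteResidual_bounds hxu hx).2
  have hα := h.min_pos
  have hα' := max_pos νup
  have hB := bestError_nonneg φ (suppSub h (𝔾 : Set (Fin d → ℤ)))
  set B := bestError φ (suppSub h (𝔾 : Set (Fin d → ℤ)))
  set B' := bestError φ (suppSub h ((𝔾 ∪ D : Finset (Fin d → ℤ)) : Set (Fin d → ℤ)))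
  set X := ∑ l ∈ Finset.Icc 1 N,
    ‖liftedSol h k₀ 𝔾 x l - projOn h 𝔾 (liftedSol h k₀ 𝔾 x l)‖ ^ 2
  set Y := ∑ l ∈ Finset.Icc 1 N,
    ‖projOn h (𝔾 ∪ D) (liftedSol h k₀ 𝔾 x l) - projOn h 𝔾 (liftedSol h k₀ 𝔾 x l)‖ ^ 2
  set R := negNorm N (discreteResidual V k₀ 𝔾 u)
  have h5 : negNormOn N (discreteResidual V k₀ 𝔾 u) D ^ 2 ≤
      negNormOn N (discreteResidual V k₀ 𝔾 u) (𝔾 ∪ D) ^ 2 := by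
    rw [negNormOn_sq, negNormOn_sq]
    exact Finset.sum_le_sum fun l _ => Finset.sum_le_sum_of_subset_of_nonneg
      Finset.subset_union_right fun G _ _ => negDensity_nonneg _ G
  have h6 : t ^ 2 * (min νlow 1 * X) ≤ max νup 1 * Y := by
    calc t ^ 2 * (min νlow 1 * X) ≤ t ^ 2 * R ^ 2 := by gcongr
      _ = (t * R) ^ 2 := by ring
      _ ≤ negNormOn N (discreteResidual V k₀ 𝔾 u) D ^ 2 :=
        pow_le_pow_left₀ (mul_nonneg ht0 (negNorm_nonneg _)) hD 2
      _ ≤ _ := h5.trans h3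
  set τ := min νlow 1 / max νup 1 * t ^ 2 with hτ
  have hτ0 : 0 ≤ τ := by positivity
  have h7 : τ * X ≤ Y := by
    have : τ * X = t ^ 2 * (min νlow 1 * X) / max νup 1 := by rw [hτ]; ring
    rw [this, div_le_iff₀' hα']
    exact h6
  have h8 : τ * ((1 - ε) * B) ≤ τ * X := mul_le_mul_of_nonneg_left (by linarith) hτ0
  nlinarith [mul_nonneg (mul_nonneg hε hB) (sub_nonneg.2 ht1)]

/-- Optimality of the marking: an enrichment that reduces the best approximation error by a factor
of three captures a fixed fraction of the residual. -/
theorem le_negNormOn_of_bestError_le (hxu : ∀ l ∈ Finset.Icc 1 N, toL2 h (x l) = u l)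
    (hx : ∀ l ∈ Finset.Icc 1 N, projOn h 𝔾 (liftedSol h k₀ 𝔾 x l) = x l)
    (hcomp : IsComparable φ k₀ N 𝔾 x ε) (hε : ε ≤ 1 / 4) (hsymm : IsSymm 𝔾) (h𝔾 : 𝔾 ⊆ 𝔾')
    (hsymm' : IsSymm 𝔾') (hB : bestError φ (suppSub h (𝔾' : Set (Fin d → ℤ))) ≤
      bestError φ (suppSub h (𝔾 : Set (Fin d → ℤ))) / 3) :
    Real.sqrt (min νlow 1 / (3 * max νup 1)) * negNorm N (discreteResidual V k₀ 𝔾 u) ≤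
      negNormOn N (discreteResidual V k₀ 𝔾 u) (𝔾' \ 𝔾) := by
  have hα := h.min_pos
  have hα' := max_pos νup
  refine le_of_sq_le_sq ?_ (negNormOn_nonneg _ _)
  rw [mul_pow, Real.sq_sqrt (by positivity),
    negNormOn_discreteResidual_sdiff hxu hx h𝔾 hsymm]
  have h1 := abs_le.1 hcomp.residual
  have h2 := abs_le.1 (hcomp.increment h𝔾)
  have h3 := (negNormOn_discreteResidual_bounds hxu hx h𝔾 hsymm').2
  have h4 := (negNorm_discreteResidual_bounds hxu hx).1
  have hB0 := bestError_nonneg φ (suppSub h (𝔾 : Set (Fin d → ℤ)))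
  set B := bestError φ (suppSub h (𝔾 : Set (Fin d → ℤ)))
  set B' := bestError φ (suppSub h (𝔾' : Set (Fin d → ℤ)))
  set X := ∑ l ∈ Finset.Icc 1 N,
    ‖liftedSol h k₀ 𝔾 x l - projOn h 𝔾 (liftedSol h k₀ 𝔾 x l)‖ ^ 2
  set Y := ∑ l ∈ Finset.Icc 1 N,
    ‖projOn h 𝔾' (liftedSol h k₀ 𝔾 x l) - projOn h 𝔾 (liftedSol h k₀ 𝔾 x l)‖ ^ 2
  have hεB : ε * B ≤ 1 / 4 * B := mul_le_mul_of_nonneg_right hε hB0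
  refine le_trans ?_ h3
  rw [div_mul_eq_mul_div, div_le_iff₀ (by positivity)]
  -- `X ≤ 5 B / 4` and `Y ≥ (2 / 3 - 1 / 4) B`
  have h5 : X ≤ 3 * Y := by linarith
  calc min νlow 1 * negNorm N (discreteResidual V k₀ 𝔾 u) ^ 2 ≤
        min νlow 1 * (max νup 1 * X) := by gcongr
    _ ≤ min νlow 1 * (max νup 1 * (3 * Y)) := by gcongr
    _ = _ := by ring

end Step

section Feasible

variable {r rt : ℕ → (Fin d → ℤ) → ℂ} {D : Finset (Fin d → ℤ)} {θ ζ κ : ℝ}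

/-- Marking with an approximate residual captures a fraction of the exact residual. -/
theorem le_negNormOn_of_approx (hr : ∀ l ∈ Finset.Icc 1 N, MemSobolev (-1) (r l))
    (hrt : ∀ l ∈ Finset.Icc 1 N, MemSobolev (-1) (rt l)) (hζ : 0 < ζ) (hζθ : ζ < θ)
    (happrox : negNorm N (rt - r) ≤ ζ * negNorm N rt)
    (hD : θ * negNorm N rt ≤ negNormOn N rt D) :
    (θ - ζ) / (1 + ζ) * negNorm N r ≤ negNormOn N r D := by
  have h1 := negNorm_le_add hr hrt
  rw [negNorm_sub_comm] at h1
  have h2 := negNormOn_le_add (N := N) rt r D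
  have h3 := negNormOn_le_negNorm (fun l hl => memSobolev_neg_one_sub (hrt l hl) (hr l hl)) D
  change negNormOn N (rt - r) D ≤ negNorm N (rt - r) at h3
  rw [div_mul_eq_mul_div, div_le_iff₀ (by linarith)]
  have h4 : (θ - ζ) * negNorm N r ≤ (θ - ζ) * ((1 + ζ) * negNorm N rt) :=
    mul_le_mul_of_nonneg_left (by linarith) (by linarith)
  have h5 : (θ - ζ) * negNorm N rt * (1 + ζ) ≤ negNormOn N r D * (1 + ζ) :=
    mul_le_mul_of_nonneg_right (by linarith) (by linarith)
  linarith

/-- An index set that captures a fraction `κ` of the exact residual is an admissible marking for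
the approximate residual. -/
theorem le_negNormOn_approx (hr : ∀ l ∈ Finset.Icc 1 N, MemSobolev (-1) (r l))
    (hrt : ∀ l ∈ Finset.Icc 1 N, MemSobolev (-1) (rt l)) (hκ : 0 ≤ κ)
    (hζκ : ζ < (κ - θ) / (1 + κ)) (happrox : negNorm N (rt - r) ≤ ζ * negNorm N rt)
    (hD : κ * negNorm N r ≤ negNormOn N r D) :
    θ * negNorm N rt ≤ negNormOn N rt D := by
  have h1 := negNorm_le_add hrt hr
  have h2 := negNormOn_le_add (N := N) r rt D
  rw [negNormOn_sub_comm] at h2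
  have h3 := negNormOn_le_negNorm (fun l hl => memSobolev_neg_one_sub (hrt l hl) (hr l hl)) D
  change negNormOn N (rt - r) D ≤ negNorm N (rt - r) at h3
  have h4 : κ * ((1 - ζ) * negNorm N rt) ≤ κ * negNorm N r :=
    mul_le_mul_of_nonneg_left (by linarith) hκ
  rw [lt_div_iff₀ (by linarith)] at hζκ
  nlinarith [mul_le_mul_of_nonneg_right hζκ.le (negNorm_nonneg (N := N) rt)]

end Feasible

end Planewave

namespace Planewave

/-! ### Nonlinear approximation and convergence rates -/

section Rates

/-- If `B` decreases at least geometrically, then the sum of `B_j^{-p}` is dominated by its last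
term. -/
theorem sum_rpow_neg_le {B : ℕ → ℝ} {ξ p : ℝ} (hξ0 : 0 < ξ) (hξ1 : ξ < 1) (hp : 0 < p) {n : ℕ}
    (hB : ∀ j < n, B (j + 1) ≤ ξ * B j) (hn : 0 < B n) :
    ∑ j ∈ Finset.range n, B j ^ (-p) ≤ ξ ^ p / (1 - ξ ^ p) * B n ^ (-p) := by
  have hβ0 : 0 < ξ ^ p := Real.rpow_pos_of_pos hξ0 p
  have hβ1 : ξ ^ p < 1 := Real.rpow_lt_one hξ0.le hξ1 hp
  have hβ2 : 0 < 1 - ξ ^ p := by linarith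
  induction n with
  | zero =>
    rw [Finset.sum_range_zero]
    have := Real.rpow_nonneg hn.le (-p)
    positivity
  | succ n ih =>
    have h1 := hB n n.lt_succ_self
    have h2 : 0 < B n := pos_of_mul_pos_right (hn.trans_le h1) hξ0.le
    have h3 := ih (fun j hj => hB j (hj.trans n.lt_succ_self)) h2
    have h4 : B n ^ (-p) ≤ ξ ^ p * B (n + 1) ^ (-p) := by
      have h5 : (ξ * B n) ^ (-p) ≤ B (n + 1) ^ (-p) :=
        Real.rpow_le_rpow_of_nonpos hn h1 (by linarith)
      rw [Real.mul_rpow hξ0.le h2.le, Real.rpow_neg hξ0.le, inv_mul_le_iff₀ hβ0] at h5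
      exact h5
    rw [Finset.sum_range_succ]
    calc ∑ j ∈ Finset.range n, B j ^ (-p) + B n ^ (-p) ≤
          ξ ^ p / (1 - ξ ^ p) * B n ^ (-p) + B n ^ (-p) := by linarith
      _ = 1 / (1 - ξ ^ p) * B n ^ (-p) := by field_simp; ring
      _ ≤ 1 / (1 - ξ ^ p) * (ξ ^ p * B (n + 1) ^ (-p)) := by gcongr
      _ = _ := by ring

variable {d : ℕ} {V : L2p d} {νlow νup : ℝ} {h : IsPotential V νlow νup} {s : ℝ}

/-- Membership in the approximation class gives approximations with a controlled number of degrees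
of freedom for every tolerance. -/
theorem exists_card_le_of_mem_approxClass {𝔾₀ : Finset (Fin d → ℤ)} (hs : 0 < s)
    {x : EnergySpace h} (hx : toL2 h x ∈ approxClass V 𝔾₀ s) :
    ∃ A > 0, ∀ η > 0, ∃ 𝔾 : Finset (Fin d → ℤ), 𝔾₀ ⊆ 𝔾 ∧ IsSymm 𝔾 ∧
      ‖x - projOn h 𝔾 x‖ ≤ η ∧ (𝔾.card : ℝ) - 𝔾₀.card ≤ A * η ^ (-(1 / s)) := by
  have hfin := hx.2
  set a := (approxSeminorm V 𝔾₀ s (toL2 h x)).toReal with ha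
  have ha0 : 0 ≤ a := ENNReal.toReal_nonneg
  refine ⟨(a + 1) ^ (1 / s), by positivity, fun η hη => ?_⟩
  have h1 : ENNReal.ofReal η *
      ⨅ (𝔾 : Finset (Fin d → ℤ)) (_ : 𝔾₀ ⊆ 𝔾 ∧ IsSymm 𝔾 ∧
        bestApprox V (VSpace 𝔾) (toL2 h x) ≤ η),
        ENNReal.ofReal (((𝔾.card : ℝ) - (𝔾₀.card : ℝ)) ^ s) ≤ ENNReal.ofReal a := by
    rw [ha, ENNReal.ofReal_toReal hfin.ne]
    exact le_iSup₂ (f := fun (ε : ℝ) (_ : 0 < ε) => ENNReal.ofReal ε *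
      ⨅ (𝔾 : Finset (Fin d → ℤ)) (_ : 𝔾₀ ⊆ 𝔾 ∧ IsSymm 𝔾 ∧
        bestApprox V (VSpace 𝔾) (toL2 h x) ≤ ε),
        ENNReal.ofReal (((𝔾.card : ℝ) - (𝔾₀.card : ℝ)) ^ s)) η hη
  have h2 : (⨅ (𝔾 : Finset (Fin d → ℤ)) (_ : 𝔾₀ ⊆ 𝔾 ∧ IsSymm 𝔾 ∧
      bestApprox V (VSpace 𝔾) (toL2 h x) ≤ η),
      ENNReal.ofReal (((𝔾.card : ℝ) - (𝔾₀.card : ℝ)) ^ s)) < ENNReal.ofReal ((a + 1) / η) := by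
    by_contra hcon
    have h3 := (mul_le_mul_right (not_lt.1 hcon) (ENNReal.ofReal η)).trans h1
    rw [← ENNReal.ofReal_mul hη.le, mul_div_cancel₀ _ hη.ne',
      ENNReal.ofReal_le_ofReal_iff ha0] at h3
    linarith
  simp only [iInf_lt_iff] at h2
  obtain ⟨𝔾, ⟨hsub, hsymm, hbest⟩, hlt⟩ := h2
  rw [VSpace_eq_image (h := h), bestApprox_eq] at hbest
  refine ⟨𝔾, hsub, hsymm, hbest, ?_⟩
  have hc0 : (0 : ℝ) ≤ (𝔾.card : ℝ) - 𝔾₀.card := by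
    rw [sub_nonneg]; exact_mod_cast Finset.card_le_card hsub
  rw [ENNReal.ofReal_lt_ofReal_iff (by positivity)] at hlt
  calc (𝔾.card : ℝ) - 𝔾₀.card = (((𝔾.card : ℝ) - 𝔾₀.card) ^ s) ^ (1 / s) := by
        rw [← Real.rpow_mul hc0, mul_one_div_cancel hs.ne', Real.rpow_one]
    _ ≤ ((a + 1) / η) ^ (1 / s) := Real.rpow_le_rpow (by positivity) hlt.le (by positivity)
    _ = _ := by
        rw [Real.div_rpow (by positivity) hη.le, Real.rpow_neg hη.le]
        rfl

theorem IsSymm.union {𝔾 𝔾' : Finset (Fin d → ℤ)} (h1 : IsSymm 𝔾) (h2 : IsSymm 𝔾') :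
    IsSymm (𝔾 ∪ 𝔾') := by
  intro G hG
  rw [Finset.mem_union] at *
  exact hG.imp (h1 G) (h2 G)

theorem IsSymm.sdiff {𝔾 𝔾' : Finset (Fin d → ℤ)} (h1 : IsSymm 𝔾) (h2 : IsSymm 𝔾') :
    IsSymm (𝔾 \ 𝔾') := by
  intro G hG
  rw [Finset.mem_sdiff] at *
  exact ⟨h1 G hG.1, fun hc => hG.2 (by simpa using h2 _ hc)⟩

theorem norm_sub_projOn_antitone {𝔾 𝔾' : Finset (Fin d → ℤ)} (h𝔾 : 𝔾 ⊆ 𝔾') (x : EnergySpace h) :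
    ‖x - projOn h 𝔾' x‖ ≤ ‖x - projOn h 𝔾 x‖ := by
  refine le_of_sq_le_sq ?_ (norm_nonneg _)
  have := norm_sub_starProjection_sq_eq_add (suppSub_finset_mono (h := h) h𝔾) x
  rw [this]
  linarith [sq_nonneg ‖projOn h 𝔾' x - projOn h 𝔾 x‖]

variable {m : ℕ} {q : Fin m → ℕ} {φ : (i : Fin m) → Fin (q i) → EnergySpace h}

/-- The error of the best approximation of an eigenbasis in the approximation class can be reduced
by a factor of three at a cost that is governed by the error itself. -/
theorem exists_enrichment {𝔾₀ : Finset (Fin d → ℤ)} (hs : 0 < s)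
    (hφ : ∀ i k, toL2 h (φ i k) ∈ approxClass V 𝔾₀ s) :
    ∃ A > 0, ∀ 𝔾 : Finset (Fin d → ℤ), 𝔾₀ ⊆ 𝔾 → IsSymm 𝔾 →
      0 < bestError φ (suppSub h (𝔾 : Set (Fin d → ℤ))) →
      ∃ 𝔾' : Finset (Fin d → ℤ), 𝔾 ⊆ 𝔾' ∧ IsSymm 𝔾' ∧
        bestError φ (suppSub h (𝔾' : Set (Fin d → ℤ))) ≤
          bestError φ (suppSub h (𝔾 : Set (Fin d → ℤ))) / 3 ∧
        ((𝔾' \ 𝔾).card : ℝ) ≤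
          A * bestError φ (suppSub h (𝔾 : Set (Fin d → ℤ))) ^ (-(1 / (2 * s))) := by
  classical
  choose a ha happ using fun p : (i : Fin m) × Fin (q i) =>
    exists_card_le_of_mem_approxClass hs (hφ p.1 p.2)
  obtain ⟨A, hA, hAle⟩ := exists_pos_forall_ge a
  set n := Fintype.card ((i : Fin m) × Fin (q i)) with hn
  refine ⟨(n + 1) * (A * (3 * (n + 1)) ^ (1 / (2 * s))), by positivity, fun 𝔾 h𝔾 hsymm hB => ?_⟩
  set B := bestError φ (suppSub h (𝔾 : Set (Fin d → ℤ)))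
  -- the tolerance per basis vector: the `n` squared errors add up to at most `B / 3`
  set η := Real.sqrt (B / (3 * (n + 1))) with hη
  have hη0 : 0 < η := Real.sqrt_pos.2 (by positivity)
  choose 𝔽 hsub h𝔽 herr hcard using fun p => happ p η hη0
  refine ⟨𝔾 ∪ Finset.univ.biUnion 𝔽, Finset.subset_union_left, hsymm.union ?_, ?_, ?_⟩
  · intro G hG
    rw [Finset.mem_biUnion] at *
    obtain ⟨p, hp, hG⟩ := hG
    exact ⟨p, hp, h𝔽 p G hG⟩
  · have h1 : ∀ p : (i : Fin m) × Fin (q i),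
        ‖φ p.1 p.2 - projOn h (𝔾 ∪ Finset.univ.biUnion 𝔽) (φ p.1 p.2)‖ ^ 2 ≤
          B / (3 * (n + 1)) := by
      intro p
      rw [← Real.sq_sqrt (show 0 ≤ B / (3 * (n + 1)) by positivity)]
      refine pow_le_pow_left₀ (norm_nonneg _) ((norm_sub_projOn_antitone ?_ _).trans (herr p)) 2
      exact (Finset.subset_biUnion_of_mem 𝔽 (Finset.mem_univ p)).trans Finset.subset_union_right
    rw [bestError, ← Fintype.sum_sigma (fun p : (i : Fin m) × Fin (q i) =>
      ‖φ p.1 p.2 - projOn h (𝔾 ∪ Finset.univ.biUnion 𝔽) (φ p.1 p.2)‖ ^ 2)]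
    refine (Finset.sum_le_sum fun p _ => h1 p).trans ?_
    rw [Finset.sum_const, Finset.card_univ, ← hn, nsmul_eq_mul, mul_div_assoc',
      div_le_div_iff₀ (by positivity) (by norm_num)]
    nlinarith
  · have h1 : ((𝔾 ∪ Finset.univ.biUnion 𝔽) \ 𝔾).card ≤ ∑ p, (𝔽 p \ 𝔾₀).card := by
      refine (Finset.card_le_card ?_).trans Finset.card_biUnion_le
      intro G hG
      rw [Finset.mem_sdiff, Finset.mem_union, Finset.mem_biUnion] at hG
      obtain ⟨h2 | ⟨p, hp, h2⟩, h3⟩ := hG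
      · exact absurd h2 h3
      · rw [Finset.mem_biUnion]
        exact ⟨p, hp, Finset.mem_sdiff.2 ⟨h2, fun hc => h3 (h𝔾 hc)⟩⟩
    have hη2 : η ^ (-(1 / s)) = (3 * (n + 1)) ^ (1 / (2 * s)) * B ^ (-(1 / (2 * s))) := by
      rw [hη, Real.sqrt_eq_rpow, ← Real.rpow_mul (by positivity),
        show (1 / 2 : ℝ) * -(1 / s) = -(1 / (2 * s)) by field_simp,
        Real.div_rpow hB.le (by positivity),
        Real.rpow_neg (show (0 : ℝ) ≤ 3 * (n + 1) by positivity)]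
      rw [div_inv_eq_mul, mul_comm]
    have h2 : ∀ p, ((𝔽 p \ 𝔾₀).card : ℝ) ≤ A * η ^ (-(1 / s)) := by
      intro p
      rw [Finset.card_sdiff_of_subset (hsub p), Nat.cast_sub (Finset.card_le_card (hsub p))]
      exact (hcard p).trans (mul_le_mul_of_nonneg_right (hAle p) (by positivity))
    calc (((𝔾 ∪ Finset.univ.biUnion 𝔽) \ 𝔾).card : ℝ) ≤ ∑ p, ((𝔽 p \ 𝔾₀).card : ℝ) := by
          exact_mod_cast h1
      _ ≤ ∑ _p : (i : Fin m) × Fin (q i), A * η ^ (-(1 / s)) := Finset.sum_le_sum fun p _ => h2 p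
      _ = n * (A * η ^ (-(1 / s))) := by rw [Finset.sum_const, Finset.card_univ, nsmul_eq_mul]
      _ ≤ (n + 1) * (A * η ^ (-(1 / s))) :=
          mul_le_mul_of_nonneg_right (by linarith) (by positivity)
      _ = _ := by rw [hη2]; ring

variable {k₀ N : ℕ} {θ ζ tol : ℝ} {M₀ n : ℕ} {𝔾 : ℕ → Finset (Fin d → ℤ)}
  {u : ℕ → ℕ → L2p d} {rt : ℕ → ℕ → (Fin d → ℤ) → ℂ} {D : ℕ → Finset (Fin d → ℤ)}

/-- All index sets generated by the algorithm are symmetric and contain the initial ball. -/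
theorem IsRun.isSymm_and_subset (hrun : IsRun V k₀ N θ ζ tol M₀ n 𝔾 u rt D) :
    ∀ j ≤ n, IsSymm (𝔾 j) ∧ ballIndex d M₀ ⊆ 𝔾 j := by
  intro j
  induction j with
  | zero =>
    intro _
    rw [hrun.start]
    exact ⟨isSymm_ballIndex M₀, subset_rfl⟩
  | succ j ih =>
    intro hj
    obtain ⟨h1, h2⟩ := ih (by omega)
    rw [hrun.refine_eq j (by omega)]
    exact ⟨h1.union (hrun.mark j (by omega)).1.2.1, h2.trans Finset.subset_union_left⟩

theorem IsRun.card_le (hrun : IsRun V k₀ N θ ζ tol M₀ n 𝔾 u rt D) :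
    ∀ j ≤ n, ((𝔾 j).card : ℝ) - (𝔾 0).card ≤ ∑ i ∈ Finset.range j, ((D i).card : ℝ) := by
  intro j
  induction j with
  | zero => intro _; simp
  | succ j ih =>
    intro hj
    have h1 := ih (by omega)
    have h2 : ((𝔾 (j + 1)).card : ℝ) ≤ (𝔾 j).card + (D j).card := by
      rw [hrun.refine_eq j (by omega)]
      exact_mod_cast Finset.card_union_le _ _
    rw [Finset.sum_range_succ]
    linarith

/-- The convergence rate, for eigenbases in the approximation class of a fixed coarse index set. -/
theorem IsCluster.exists_rate (h : IsPotential V νlow νup) {lam : Fin m → ℝ}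
    (hc : IsCluster V k₀ N m lam q) (hs : 0 < s) {κ : ℝ}
    (hκ : κ = Real.sqrt (min νlow 1 / (3 * max νup 1))) (hθκ : θ < κ)
    (hζ : 0 < ζ) (hζθ : ζ < θ) (hζκ : ζ < (κ - θ) / (1 + κ)) :
    ∃ Mstar : ℕ, ∀ M₁, Mstar ≤ M₁ → (∀ i, eigenspace V (H1p d) (lam i) ⊆
        approxClass V (ballIndex d M₁) s) →
      ∃ C > 0, ∀ M₀, M₁ ≤ M₀ → ∀ tol n 𝔾 u rt D, IsRun V k₀ N θ ζ tol M₀ n 𝔾 u rt D →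
        (𝔾 0).card < (𝔾 n).card →
        tupleDist V (fun i => eigenspace V (H1p d) (lam i)) (fun i => discreteSpace q (u n) i) ≤
          C * (((𝔾 n).card : ℝ) - ((𝔾 0).card : ℝ)) ^ (-s) := by
  have hα := h.min_pos
  have hα' := max_pos νup
  have hκ0 : 0 < κ := by rw [hκ]; exact Real.sqrt_pos.2 (by positivity)
  obtain ⟨φ, hφ, C, hC, hcomp⟩ := hc.exists_comparison h
  set t := (θ - ζ) / (1 + ζ) with ht
  have ht0 : 0 < t := div_pos (by linarith) (by linarith)
  set τ := min νlow 1 / max νup 1 * t ^ 2 with hτ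
  have hτ0 : 0 < τ := by positivity
  have hratio : min νlow 1 / max νup 1 ≤ 1 :=
    (div_le_one hα').2 ((min_le_right _ _).trans (le_max_right _ _))
  have hκ1 : κ ≤ 1 := by
    rw [hκ, Real.sqrt_le_one]
    rw [div_le_one (by positivity)]
    linarith [min_le_right νlow 1, le_max_right νup 1]
  have hτ1 : τ ≤ 1 := by
    have h1 : t ≤ 1 := (div_le_one (by linarith)).2 (by linarith)
    calc τ ≤ 1 * 1 ^ 2 := by rw [hτ]; gcongr
      _ = 1 := by norm_num
  -- `τ / 4` makes the contraction factor `1 + 2 (τ / 4) - τ = 1 - τ / 2`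
  obtain ⟨Mstar, hM⟩ := hcomp (τ / 4) (by positivity)
  refine ⟨Mstar, fun M₁ hM₁ hclass => ?_⟩
  obtain ⟨A, hA, henrich⟩ := exists_enrichment (φ := φ) hs fun i k => hclass i (hφ i k)
  set ξ := 1 - τ / 2 with hξ
  have hξ0 : 0 < ξ := by linarith
  have hξ1 : ξ < 1 := by linarith
  set p := 1 / (2 * s) with hp
  have hp0 : 0 < p := by positivity
  have hβ0 : 0 < ξ ^ p := Real.rpow_pos_of_pos hξ0 p
  have hβ1 : 0 < 1 - ξ ^ p := by linarith [Real.rpow_lt_one hξ0.le hξ1 hp0]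
  set A' := A * (ξ ^ p / (1 - ξ ^ p)) with hA'
  have hA'0 : 0 < A' := by positivity
  refine ⟨C * A' ^ s, by positivity, fun M₀ hM₀ tol n 𝔾 u rt D hrun hcard => ?_⟩
  have hinv := hrun.isSymm_and_subset
  have hball : ∀ j ≤ n, ballIndex d M₁ ⊆ 𝔾 j := fun j hj =>
    (ballIndex_mono hM₀).trans (hinv j hj).2
  set B : ℕ → ℝ := fun j => bestError φ (suppSub h (𝔾 j : Set (Fin d → ℤ))) with hBdef
  have hstep : ∀ j < n, B (j + 1) ≤ ξ * B j ∧ (0 < B j → ((D j).card : ℝ) ≤ A * B j ^ (-p)) := by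
    intro j hj
    obtain ⟨x, hxu, hx, hQ, -⟩ := hM (𝔾 j) ((ballIndex_mono hM₁).trans (hball j hj.le)) (u j)
      (hrun.solve j hj.le)
    have hQ' : IsComparable φ k₀ N (𝔾 j) x (τ / 4) := hQ
    obtain ⟨⟨hdisj, hDsymm, hD⟩, hmin⟩ := hrun.mark j hj
    have hr := memSobolev_discreteResidual (k₀ := k₀) (𝔾 := 𝔾 j) hxu
    have hsymm := (hinv j hj.le).1
    constructor
    · have h1 := bestError_le_of_marking hxu hx hQ' (by positivity) (hsymm.union hDsymm) ht0.le
        hτ1 (le_negNormOn_of_approx hr (hrun.approx_mem j hj) hζ hζθ (hrun.approx j hj) hD)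
      rw [← hrun.refine_eq j hj] at h1
      refine h1.trans_eq ?_
      rw [hξ, hBdef]
      ring
    · intro hBj
      obtain ⟨𝔽, hsub, h𝔽, herr, hcard⟩ := henrich (𝔾 j) (hball j hj.le) hsymm hBj
      have h1 := le_negNormOn_of_bestError_le hxu hx hQ' (by linarith) hsymm hsub h𝔽 herr
      rw [← hκ] at h1
      have h2 := le_negNormOn_approx hr (hrun.approx_mem j hj) hκ0.le hζκ (hrun.approx j hj) h1
      have h3 := hmin (𝔽 \ 𝔾 j) ⟨Finset.sdiff_disjoint, h𝔽.sdiff hsymm, h2⟩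
      exact le_trans (by exact_mod_cast h3) hcard
  obtain ⟨-, -, -, -, hdist⟩ := hM (𝔾 n) ((ballIndex_mono hM₁).trans (hball n le_rfl)) (u n)
    (hrun.solve n le_rfl)
  refine hdist.trans ?_
  change C * Real.sqrt (B n) ≤ _
  have hδ : 0 < ((𝔾 n).card : ℝ) - (𝔾 0).card := by
    rw [sub_pos]; exact_mod_cast hcard
  rcases (bestError_nonneg φ (suppSub h (𝔾 n : Set (Fin d → ℤ)))).eq_or_lt with h0 | h0
  · change 0 = B n at h0
    rw [← h0, Real.sqrt_zero, mul_zero]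
    positivity
  change 0 < B n at h0
  have hpos : ∀ i ≤ n, 0 < B (n - i) := by
    intro i
    induction i with
    | zero => intro _; exact h0
    | succ i ih =>
      intro hi
      have h1 := (hstep (n - (i + 1)) (by omega)).1
      rw [show n - (i + 1) + 1 = n - i by omega] at h1
      exact pos_of_mul_pos_right ((ih (by omega)).trans_le h1) hξ0.le
  have hbound : ((𝔾 n).card : ℝ) - (𝔾 0).card ≤ A' * B n ^ (-p) := by
    calc ((𝔾 n).card : ℝ) - (𝔾 0).card ≤ ∑ j ∈ Finset.range n, ((D j).card : ℝ) :=
          hrun.card_le n le_rfl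
      _ ≤ ∑ j ∈ Finset.range n, A * B j ^ (-p) := by
          refine Finset.sum_le_sum fun j hj => ?_
          rw [Finset.mem_range] at hj
          have h1 := hpos (n - j) (by omega)
          rw [Nat.sub_sub_self hj.le] at h1
          exact (hstep j hj).2 h1
      _ = A * ∑ j ∈ Finset.range n, B j ^ (-p) := by rw [Finset.mul_sum]
      _ ≤ A * (ξ ^ p / (1 - ξ ^ p) * B n ^ (-p)) :=
          mul_le_mul_of_nonneg_left
            (sum_rpow_neg_le hξ0 hξ1 hp0 (fun j hj => (hstep j hj).1) h0) hA.le
      _ = _ := by rw [hA']; ring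
  have hps : -p * -s = 1 / 2 := by rw [hp]; field_simp
  have h1 : (A' * B n ^ (-p)) ^ (-s) ≤ (((𝔾 n).card : ℝ) - (𝔾 0).card) ^ (-s) :=
    Real.rpow_le_rpow_of_nonpos hδ hbound (by linarith)
  rw [Real.mul_rpow hA'0.le (by positivity), ← Real.rpow_mul h0.le, hps, ← Real.sqrt_eq_rpow,
    Real.rpow_neg hA'0.le, inv_mul_le_iff₀ (by positivity)] at h1
  rw [mul_assoc]
  exact mul_le_mul_of_nonneg_left h1 hC.le

end Rates

end Planewave

end

theorem mainTheorem3 (d : ℕ) (hd : 1 ≤ d)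
    (V : Planewave.L2p d) (σ : ℝ) (hσ : (d : ℝ) / 2 < σ)
    (hV : Planewave.MemSobolev σ (Planewave.boxFourierCoeff V))
    (νlow νup : ℝ) (hν : 0 < νlow)
    (hlow : ∀ᵐ x ∂(Planewave.cellMeasure d), νlow ≤ V x)
    (hup : ∀ᵐ x ∂(Planewave.cellMeasure d), V x ≤ νup)
    (k₀ N m : ℕ) (lam : Fin m → ℝ) (q : Fin m → ℕ)
    (hcluster : Planewave.IsCluster V k₀ N m lam q)
    (s : ℝ) (hs : 0 < s)
    (κ : ℝ) (hκ : κ = Real.sqrt (min νlow 1 / (3 * max νup 1)))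
    (θ ζ : ℝ) (hθ : 0 < θ) (hθκ : θ < κ)
    (hζ : 0 < ζ) (hζθ : ζ < θ) (hζκ : ζ < (κ - θ) / (1 + κ)) :
    ∃ (Mstar : ℕ) (C : ℝ), 0 < C ∧
      ∀ M₀ : ℕ, Mstar ≤ M₀ →
        (∀ i, Planewave.eigenspace V (Planewave.H1p d) (lam i) ⊆
          Planewave.approxClass V (Planewave.ballIndex d M₀) s) →
        ∀ (tol : ℝ), 0 ≤ tol → tol < 1 →
        ∀ (n : ℕ) (𝔾 : ℕ → Finset (Fin d → ℤ)) (u : ℕ → ℕ → Planewave.L2p d)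
          (rt : ℕ → ℕ → (Fin d → ℤ) → ℂ) (D : ℕ → Finset (Fin d → ℤ)),
          Planewave.IsRun V k₀ N θ ζ tol M₀ n 𝔾 u rt D →
          (𝔾 0).card < (𝔾 n).card →
          Planewave.tupleDist V
              (fun i => Planewave.eigenspace V (Planewave.H1p d) (lam i))
              (fun i => Planewave.discreteSpace q (u n) i) ≤
            C * (((𝔾 n).card : ℝ) - ((𝔾 0).card : ℝ)) ^ (-s) := by
  have h : Planewave.IsPotential V νlow νup := ⟨hν, hlow, hup⟩
  obtain ⟨Mstar, hrate⟩ := hcluster.exists_rate h hs hκ hθκ hζ hζθ hζκ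
  by_cases hclass : ∃ M₁, Mstar ≤ M₁ ∧ ∀ i, Planewave.eigenspace V (Planewave.H1p d) (lam i) ⊆
      Planewave.approxClass V (Planewave.ballIndex d M₁) s
  · -- a single coarse index set for which the eigenfunctions are in the approximation class
    -- supplies a constant that is valid for all finer initial sets
    obtain ⟨M₁, hM₁, hclass⟩ := hclass
    obtain ⟨C, hC, hmain⟩ := hrate M₁ hM₁ hclass
    exact ⟨M₁, C, hC, fun M₀ hM₀ _ tol _ _ n 𝔾 u rt D hrun hcard =>
      hmain M₀ hM₀ tol n 𝔾 u rt D hrun hcard⟩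
  · push Not at hclass
    refine ⟨Mstar, 1, one_pos, fun M₀ hM₀ hin => ?_⟩
    obtain ⟨i, hi⟩ := hclass M₀ hM₀
    exact absurd (hin i) hi
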